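/- Let $V$ be a connected compact topological $n$-manifold ($n\ge 0$, Hausdorff, second countable, possibly with boundary) with boundary $\partial V$ and interior $M=V\setminus\partial V$, and fix an orientation of $V$, i.e. a locally consistent choice of generators $o_x\in H_n(M,M\setminus\{x\};\mathbb Z)$, $x\in M$. Homology has real coefficients unless indicated. Definitions. - The relative fundamental class $[V,\partial V]\in H_n(V,\partial V)$ is the class whose restriction to $H_n(V,V\setminus\{x\})$ is the image of $o_x$ for every $x\in M$. Put $\|V,\partial V\|=\inf\{\|c\|_1\}$, where $c=\sum a_\sigma\sigma$ runs over the singular chains of $V$ that are relative cycles representing $[V,\partial V]$ and $\|c\|_1=\sum|a_\sigma|$. - A locally finite $k$-chain of $M$ is a formal, possibly infinite, real linear combination $c=\sum a_\sigma\sigma$ of singular $k$-simplices of $M$ such that every compact subset of $M$ meets the images of only finitely many simplices $\sigma$ with $a_\sigma\neq 0$. A locally finite fundamental cycle is a locally finite $n$-cycle $c$ such that, for every $x\in M$, the finite sum of the terms of $c$ whose simplices contain $x$ in their image represents the image of $o_x$ in $H_n(M,M\setminus\{x\})$. Put $\|M\|=\inf\{\|c\|_1\}\in[0,\infty]$, where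 $c$ runs over the locally finite fundamental cycles. - If $M$ carries a smooth structure and $g_M$ is a smooth Riemannian metric on it, put $\|M,g_M\|_{\mathrm{Lip}}=\inf\{\|c\|_1\}\in[0,\infty]$, where $c$ runs over the locally finite fundamental cycles with $\mathrm{Lip}(c)<\infty$. Here $\mathrm{Lip}(c)$ is the supremum of the Lipschitz constants of the simplices occurring in $c$, with respect to the Euclidean metric on the standard simplex and the Riemannian distance on $M$. - For a pair $(X,A)$, $H_b^*(X,A)$ is the cohomology of the complex of bounded real singular cochains of $X$ that vanish on the simplices contained in $A$, with the seminorm $\|\varphi\|_\infty=\inf\{\sup_\sigma|f(\sigma)| : f \text{ a bounded cocycle representing } \varphi\}$, and $H_b^*(X)=H_b^*(X,\emptyset)$. Theorem. Suppose that the map $H_b^n(V,\partial V)\to H_b^n(V)$ induced by the inclusion $(V,\emptyset)\to(V,\partial V)$ is an isometric isomorphism, i.e. a linear bijection preserving the seminorms, and that $\|M\|<\infty$. Then $$\|V,\partial V\|=\|M\|.$$ If moreover $g_M$ is a smooth Riemannian metric on $M$ (for any smooth structure on $M$) with $\|M,g_M\|_{\mathrm{Lip}}<\infty$, then $$\|V,\partial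 V\|=\|M\|=\|M,g_M\|_{\mathrm{Lip}}.$$ -/

import Mathlib

open scoped ENNReal Manifold ContDiff Topology

noncomputable section

namespace SimplicialVolume

/-! ## Singular chains -/

section Chains

variable {X Y : Type*} [TopologicalSpace X] [TopologicalSpace Y]

/-- Singular `k`-simplices of `X`. -/
abbrev SingularSimplex (k : ℕ) (X : Type*) [TopologicalSpace X] : Type _ :=
  C(stdSimplex ℝ (Fin (k + 1)), X)

/-- The inclusion `Δᵏ → Δᵏ⁺¹` of the face opposite to the `i`-th vertex. -/
def faceInclusion {k : ℕ} (i : Fin (k + 2)) :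
    C(stdSimplex ℝ (Fin (k + 1)), stdSimplex ℝ (Fin (k + 2))) :=
  ⟨stdSimplex.map i.succAbove, stdSimplex.continuous_map i.succAbove⟩

/-- The `i`-th face of a singular simplex. -/
def face {k : ℕ} (i : Fin (k + 2)) (σ : SingularSimplex (k + 1) X) : SingularSimplex k X :=
  σ.comp (faceInclusion i)

lemma range_face_subset {k : ℕ} (i : Fin (k + 2)) (σ : SingularSimplex (k + 1) X) :
    Set.range (face i σ) ⊆ Set.range σ := by
  rintro _ ⟨t, rfl⟩
  exact ⟨faceInclusion i t, rfl⟩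

/-- Singular `k`-chains of `X` with coefficients in `R`. -/
abbrev Chain (R : Type*) [CommRing R] (k : ℕ) (X : Type*) [TopologicalSpace X] : Type _ :=
  SingularSimplex k X →₀ R

/-- The singular boundary operator `∂ σ = ∑ᵢ (-1)ⁱ ∂ᵢ σ`. -/
def boundary (R : Type*) [CommRing R] (k : ℕ) (X : Type*) [TopologicalSpace X] :
    Chain R (k + 1) X →ₗ[R] Chain R k X :=
  ∑ i : Fin (k + 2), (-1 : R) ^ (i : ℕ) • Finsupp.lmapDomain R R (face i)

/-- The chains all of whose simplices lie in the subspace `A`. -/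
def chainsIn (R : Type*) [CommRing R] (k : ℕ) (A : Set X) : Submodule R (Chain R k X) :=
  Finsupp.supported R R {σ | Set.range σ ⊆ A}

/-! ## Relative singular homology -/

/-- Relative cycles: `k`-chains of `X` whose boundary is a chain of `A`. -/
def relCycles (R : Type*) [CommRing R] (A : Set X) : (k : ℕ) → Submodule R (Chain R k X)
  | 0 => ⊤
  | k + 1 => (chainsIn R k A).comap (boundary R k X)

/-- Relative boundaries: sums of a boundary in `X` and a chain of `A`. -/
def relBoundaries (R : Type*) [CommRing R] (A : Set X) (k : ℕ) : Submodule R (Chain R k X) :=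
  LinearMap.range (boundary R k X) ⊔ chainsIn R k A

instance (R : Type*) [CommRing R] (k : ℕ) (N : Submodule R (Chain R k X)) : AddCommGroup N :=
  Submodule.addCommGroup N

/-- The relative singular homology `H_k(X, A; R)`. -/
abbrev RelHomology (R : Type*) [CommRing R] (A : Set X) (k : ℕ) : Type _ :=
  relCycles R A k ⧸ (relBoundaries R A k).submoduleOf (relCycles R A k)

/-- The class of a relative cycle. -/
abbrev RelHomology.mk {R : Type*} [CommRing R] {A : Set X} {k : ℕ} (z : relCycles R A k) :
    RelHomology R A k :=
  Submodule.Quotient.mk z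

/-- The chain `c` is a relative cycle of `(X, A)` in the class `α`. -/
def Represents {R : Type*} [CommRing R] {A : Set X} {k : ℕ} (c : Chain R k X)
    (α : RelHomology R A k) : Prop :=
  ∃ h : c ∈ relCycles R A k, RelHomology.mk ⟨c, h⟩ = α

/-- The push-forward of chains along a continuous map. -/
def chainMap (R : Type*) [CommRing R] (k : ℕ) (f : C(X, Y)) : Chain R k X →ₗ[R] Chain R k Y :=
  Finsupp.lmapDomain R R (fun σ => f.comp σ)

lemma boundary_chainMap (R : Type*) [CommRing R] (k : ℕ) (f : C(X, Y)) (c : Chain R (k + 1) X) :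
    boundary R k Y (chainMap R (k + 1) f c) = chainMap R k f (boundary R k X c) := by
  simp only [boundary, LinearMap.sum_apply, LinearMap.smul_apply, map_sum, map_smul]
  refine Finset.sum_congr rfl fun i _ => ?_
  simp only [chainMap, Finsupp.lmapDomain_apply, ← Finsupp.mapDomain_comp]
  rfl

lemma chainMap_mem_chainsIn (R : Type*) [CommRing R] (k : ℕ) (f : C(X, Y)) {A : Set X} {B : Set Y}
    (h : Set.MapsTo f A B) {c : Chain R k X} (hc : c ∈ chainsIn R k A) :
    chainMap R k f c ∈ chainsIn R k B := by
  classical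
  rw [chainsIn, Finsupp.mem_supported] at hc ⊢
  intro τ hτ
  obtain ⟨σ, hσ, rfl⟩ := Finset.mem_image.1 (Finsupp.mapDomain_support hτ)
  rintro _ ⟨t, rfl⟩
  exact h (hc hσ ⟨t, rfl⟩)

lemma chainMap_mem_relCycles (R : Type*) [CommRing R] (f : C(X, Y)) {A : Set X} {B : Set Y}
    (h : Set.MapsTo f A B) (k : ℕ) {c : Chain R k X} (hc : c ∈ relCycles R A k) :
    chainMap R k f c ∈ relCycles R B k := by
  cases k with
  | zero => trivial
  | succ k =>
    simp only [relCycles, Submodule.mem_comap] at hc ⊢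
    rw [boundary_chainMap]
    exact chainMap_mem_chainsIn R k f h hc

lemma chainMap_mem_relBoundaries (R : Type*) [CommRing R] (f : C(X, Y)) {A : Set X} {B : Set Y}
    (h : Set.MapsTo f A B) (k : ℕ) {c : Chain R k X} (hc : c ∈ relBoundaries R A k) :
    chainMap R k f c ∈ relBoundaries R B k := by
  obtain ⟨_, ⟨b, rfl⟩, a, ha, rfl⟩ := Submodule.mem_sup.1 hc
  rw [map_add, ← boundary_chainMap]
  exact Submodule.add_mem_sup ⟨_, rfl⟩ (chainMap_mem_chainsIn R k f h ha)

/-- The map `H_k(X, A; R) → H_k(Y, B; R)` induced by a map of pairs `f : (X, A) → (Y, B)`. -/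
def RelHomology.map (R : Type*) [CommRing R] (f : C(X, Y)) {A : Set X} {B : Set Y}
    (h : Set.MapsTo f A B) (k : ℕ) : RelHomology R A k →ₗ[R] RelHomology R B k :=
  Submodule.mapQ _ _
    ((chainMap R k f).restrict fun _ hc => chainMap_mem_relCycles R f h k hc)
    (fun z hz => chainMap_mem_relBoundaries R f h k (c := z.1) hz)

/-- The restriction `H_k(X, A; R) → H_k(X, B; R)` for `A ⊆ B`. -/
def RelHomology.restrict (R : Type*) [CommRing R] {A B : Set X} (h : A ⊆ B) (k : ℕ) :
    RelHomology R A k →ₗ[R] RelHomology R B k :=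
  RelHomology.map R (ContinuousMap.id X) (fun _ hx => h hx) k

/-- The change of coefficients from `ℤ` to `ℝ` on chains. -/
def realChain (k : ℕ) (X : Type*) [TopologicalSpace X] : Chain ℤ k X →+ Chain ℝ k X :=
  Finsupp.mapRange.addMonoidHom (Int.castAddHom ℝ)

lemma boundary_realChain (k : ℕ) (c : Chain ℤ (k + 1) X) :
    boundary ℝ k X (realChain (k + 1) X c) = realChain k X (boundary ℤ k X c) := by
  induction c using Finsupp.induction_linear with
  | zero => simp
  | add f g hf hg => simp only [map_add, hf, hg]
  | single σ a =>
    simp only [boundary, realChain, LinearMap.sum_apply, LinearMap.smul_apply, map_sum,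
      Finsupp.lmapDomain_apply, Finsupp.mapDomain_single, Finsupp.mapRange.addMonoidHom_apply,
      Finsupp.mapRange_single, Finsupp.smul_single]
    refine Finset.sum_congr rfl fun i _ => ?_
    simp

lemma realChain_mem_chainsIn (k : ℕ) {A : Set X} {c : Chain ℤ k X} (hc : c ∈ chainsIn ℤ k A) :
    realChain k X c ∈ chainsIn ℝ k A := by
  rw [chainsIn, Finsupp.mem_supported] at hc ⊢
  exact fun τ hτ => hc (Finsupp.support_mapRange (hf := map_zero _) hτ)

lemma realChain_mem_relCycles {A : Set X} (k : ℕ) {c : Chain ℤ k X} (hc : c ∈ relCycles ℤ A k) :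
    realChain k X c ∈ relCycles ℝ A k := by
  cases k with
  | zero => trivial
  | succ k =>
    simp only [relCycles, Submodule.mem_comap] at hc ⊢
    rw [boundary_realChain]
    exact realChain_mem_chainsIn k hc

lemma realChain_mem_relBoundaries {A : Set X} (k : ℕ) {c : Chain ℤ k X}
    (hc : c ∈ relBoundaries ℤ A k) : realChain k X c ∈ relBoundaries ℝ A k := by
  obtain ⟨_, ⟨b, rfl⟩, a, ha, rfl⟩ := Submodule.mem_sup.1 hc
  rw [map_add, ← boundary_realChain]
  exact Submodule.add_mem_sup ⟨_, rfl⟩ (realChain_mem_chainsIn k ha)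

/-- The change of coefficients `H_k(X, A; ℤ) → H_k(X, A; ℝ)`. -/
def RelHomology.toReal (A : Set X) (k : ℕ) : RelHomology ℤ A k →+ RelHomology ℝ A k :=
  QuotientAddGroup.map _ _
    (((realChain k X).comp (relCycles ℤ A k).subtype.toAddMonoidHom).codRestrict
      (relCycles ℝ A k).toAddSubgroup fun z => realChain_mem_relCycles k z.2)
    (fun (z : relCycles ℤ A k) hz => realChain_mem_relBoundaries k (c := z.1) hz)

/-- The `ℓ¹`-norm `∑ |a_σ|` of a (finite or infinite) real chain `∑ a_σ σ`, in `[0, ∞]`. -/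
def l1Norm {k : ℕ} (c : SingularSimplex k X → ℝ) : ℝ≥0∞ :=
  ∑' σ, ‖c σ‖ₑ

/-- The `ℓ¹`-seminorm of a class in `H_k(X, A; ℝ)`. -/
def RelHomology.seminorm {A : Set X} {k : ℕ} (α : RelHomology ℝ A k) : ℝ≥0∞ :=
  ⨅ (c : Chain ℝ k X) (_ : Represents c α), l1Norm c

/-! ## Bounded cohomology -/

/-- The singular coboundary operator on real cochains, written as functions on simplices. -/
def coboundary (k : ℕ) (X : Type*) [TopologicalSpace X] :
    (SingularSimplex k X → ℝ) →ₗ[ℝ] (SingularSimplex (k + 1) X → ℝ) where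
  toFun f σ := ∑ i : Fin (k + 2), (-1 : ℝ) ^ (i : ℕ) * f (face i σ)
  map_add' f g := by
    funext σ
    simp [mul_add, Finset.sum_add_distrib]
  map_smul' r f := by
    funext σ
    simp [Finset.mul_sum, mul_left_comm]

/-- `C_b^k(X, A)`: bounded real cochains of `X` that vanish on the simplices of `A`. -/
def boundedCochains (A : Set X) (k : ℕ) : Submodule ℝ (SingularSimplex k X → ℝ) where
  carrier := {f | (∃ C : ℝ, ∀ σ, |f σ| ≤ C) ∧ 
    ∀ σ : SingularSimplex k X, Set.range σ ⊆ A → f σ = 0}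
  zero_mem' := ⟨⟨0, by simp⟩, by simp⟩
  add_mem' := by
    rintro f g ⟨⟨C, hC⟩, hf⟩ ⟨⟨D, hD⟩, hg⟩
    refine ⟨⟨C + D, fun σ => (abs_add_le _ _).trans (add_le_add (hC σ) (hD σ))⟩, fun σ hσ => ?_⟩
    simp [hf σ hσ, hg σ hσ]
  smul_mem' := by
    rintro r f ⟨⟨C, hC⟩, hf⟩
    refine ⟨⟨|r| * C, fun σ => ?_⟩, fun σ hσ => by simp [hf σ hσ]⟩
    simpa [abs_mul] using mul_le_mul_of_nonneg_left (hC σ) (abs_nonneg r)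

/-- Bounded cocycles of `(X, A)`. -/
def boundedCocycles (A : Set X) (k : ℕ) : Submodule ℝ (SingularSimplex k X → ℝ) :=
  boundedCochains A k ⊓ LinearMap.ker (coboundary k X)

/-- Coboundaries of bounded cochains of `(X, A)`. -/
def boundedCoboundaries (A : Set X) : (k : ℕ) → Submodule ℝ (SingularSimplex k X → ℝ)
  | 0 => ⊥
  | k + 1 => (boundedCochains A k).map (coboundary k X)

/-- The bounded cohomology `H_b^k(X, A)`; the absolute group `H_b^k(X)` is the case `A = ∅`. -/
abbrev BoundedCohomology (A : Set X) (k : ℕ) : Type _ :=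
  boundedCocycles A k ⧸ (boundedCoboundaries A k).submoduleOf (boundedCocycles A k)

/-- The `ℓ^∞`-norm of a cochain, in `[0, ∞]`. -/
def linftyNorm {k : ℕ} (f : SingularSimplex k X → ℝ) : ℝ≥0∞ :=
  ⨆ σ, ‖f σ‖ₑ

/-- The `ℓ^∞`-seminorm of a bounded cohomology class. -/
def BoundedCohomology.seminorm {A : Set X} {k : ℕ} (φ : BoundedCohomology A k) : ℝ≥0∞ :=
  ⨅ (z : boundedCocycles A k) (_ : Submodule.Quotient.mk z = φ), linftyNorm z.1

lemma boundedCochains_anti {A B : Set X} (h : A ⊆ B) (k : ℕ) :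
    boundedCochains B k ≤ boundedCochains A k :=
  fun _ hf => ⟨hf.1, fun σ hσ => hf.2 σ (hσ.trans h)⟩

lemma boundedCocycles_anti {A B : Set X} (h : A ⊆ B) (k : ℕ) :
    boundedCocycles B k ≤ boundedCocycles A k :=
  inf_le_inf_right _ (boundedCochains_anti h k)

lemma boundedCoboundaries_anti {A B : Set X} (h : A ⊆ B) (k : ℕ) :
    boundedCoboundaries B k ≤ boundedCoboundaries A k := by
  cases k with
  | zero => exact le_rfl
  | succ k => exact Submodule.map_mono (boundedCochains_anti h k)

/-- The map `H_b^k(X, B) → H_b^k(X, A)` induced by the inclusion `(X, A) → (X, B)`, `A ⊆ B`. -/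
def BoundedCohomology.pullback {A B : Set X} (h : A ⊆ B) (k : ℕ) :
    BoundedCohomology B k →ₗ[ℝ] BoundedCohomology A k :=
  Submodule.mapQ _ _ (Submodule.inclusion (boundedCocycles_anti h k))
    (fun z hz => boundedCoboundaries_anti h k (x := z.1) hz)

/-- The inclusion `(X, ∅) → (X, A)` induces an isometric isomorphism
`H_b^k(X, A) → H_b^k(X)`. -/
def InducesIsometricIso (A : Set X) (k : ℕ) : Prop :=
  Function.Bijective (BoundedCohomology.pullback (Set.empty_subset A) k) ∧
    ∀ β : BoundedCohomology A k,
      (BoundedCohomology.pullback (Set.empty_subset A) k β).seminorm = β.seminorm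

/-! ## Locally finite chains -/

/-- A formal infinite sum `∑ c_σ σ` is locally finite if every compact subset meets the images of
only finitely many of the simplices occurring in it. -/
def IsLocallyFiniteChain {k : ℕ} (c : SingularSimplex k X → ℝ) : Prop :=
  ∀ K : Set X, IsCompact K → {σ | c σ ≠ 0 ∧ (Set.range σ ∩ K).Nonempty}.Finite

/-- The boundary of a locally finite chain: the coefficient of `τ` is the sum of the `(-1)ⁱ c_σ`
over all pairs `(i, σ)` with `∂ᵢ σ = τ`. -/
def lfBoundary {k : ℕ} (c : SingularSimplex (k + 1) X → ℝ) : SingularSimplex k X → ℝ :=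
  fun τ => ∑ i : Fin (k + 2), (-1 : ℝ) ^ (i : ℕ) *
    ∑ᶠ σ : {σ : SingularSimplex (k + 1) X // face i σ = τ}, c σ.1

/-- The sums in `lfBoundary` are finite for locally finite chains. -/
lemma IsLocallyFiniteChain.finite_support {k : ℕ} {c : SingularSimplex (k + 1) X → ℝ}
    (hc : IsLocallyFiniteChain c) (i : Fin (k + 2)) (τ : SingularSimplex k X) :
    (Function.support fun σ : {σ : SingularSimplex (k + 1) X // face i σ = τ} => c σ.1).Finite := by
  have h := hc (Set.range τ) (isCompact_range τ.continuous)
  refine (h.preimage Subtype.val_injective.injOn).subset ?_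
  rintro ⟨σ, rfl⟩ hσ
  obtain ⟨x, hx⟩ := Set.range_nonempty (face i σ)
  exact ⟨hσ, x, range_face_subset i σ hx, hx⟩

/-- Locally finite cycles. -/
def IsLocallyFiniteCycle : {k : ℕ} → (SingularSimplex k X → ℝ) → Prop
  | 0, c => IsLocallyFiniteChain c
  | _ + 1, c => IsLocallyFiniteChain c ∧ lfBoundary c = 0

lemma IsLocallyFiniteCycle.isLocallyFiniteChain {k : ℕ} {c : SingularSimplex k X → ℝ}
    (hc : IsLocallyFiniteCycle c) : IsLocallyFiniteChain c := by
  cases k with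
  | zero => exact hc
  | succ k => exact hc.1

open Classical in
/-- For a locally finite chain `c` and a compact set `K`, the finite chain `c|_K` of all terms of
`c` whose simplices meet `K`. -/
def IsLocallyFiniteChain.truncate {k : ℕ} {c : SingularSimplex k X → ℝ}
    (hc : IsLocallyFiniteChain c) {K : Set X} (hK : IsCompact K) : Chain ℝ k X :=
  Finsupp.ofSupportFinite (fun σ => if (Set.range σ ∩ K).Nonempty then c σ else 0)
    ((hc K hK).subset fun σ hσ => by
      by_cases h : (Set.range σ ∩ K).Nonempty <;> simp_all)

end Chains

/-! ## Manifolds, orientations and fundamental classes -/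

/-- The half-space `{x ∈ ℝⁿ | 0 ≤ x₀}`; for `n = 0` this is the point `ℝ⁰`. -/
abbrev HalfSpace (n : ℕ) : Type :=
  {x : EuclideanSpace ℝ (Fin n) // ∀ i : Fin n, (i : ℕ) = 0 → 0 ≤ x i}

/-- (Topological) `n`-manifolds, possibly with boundary: second countable Hausdorff spaces that are
locally homeomorphic to open subsets of the half-space. -/
structure IsManifoldWithBoundary (n : ℕ) (V : Type*) [TopologicalSpace V] : Prop where
  t2 : T2Space V
  secondCountable : SecondCountableTopology V
  chart : ∀ x : V, ∃ e : OpenPartialHomeomorph V (HalfSpace n), x ∈ e.source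

/-- The interior of an `n`-manifold: the points with a neighbourhood homeomorphic to an open subset
of `ℝⁿ`. -/
def manifoldInterior (n : ℕ) (V : Type*) [TopologicalSpace V] : Set V :=
  {x | ∃ e : OpenPartialHomeomorph V (EuclideanSpace ℝ (Fin n)), x ∈ e.source}

/-- The boundary of an `n`-manifold: the complement of the interior. -/
def manifoldBoundary (n : ℕ) (V : Type*) [TopologicalSpace V] : Set V :=
  (manifoldInterior n V)ᶜ

/-- An orientation of an `n`-manifold `M` without boundary: a choice of generators of the local
homology groups `H_n(M, M ∖ {x}; ℤ)` that is locally induced by a class in `H_n(M, M ∖ U; ℤ)`. -/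
structure ManifoldOrientation (n : ℕ) (M : Type*) [TopologicalSpace M] where
  /-- The local orientation at a point. -/
  cls : ∀ x : M, RelHomology ℤ ({x}ᶜ : Set M) n
  generates : ∀ x : M, Submodule.span ℤ {cls x} = ⊤
  consistent : ∀ x : M, ∃ (U : Set M) (_ : IsOpen U) (_ : x ∈ U) (β : RelHomology ℤ Uᶜ n),
    ∀ (y : M) (hy : y ∈ U), RelHomology.restrict ℤ
      (Set.compl_subset_compl.2 (Set.singleton_subset_iff.2 hy)) n β = cls y

section OpenManifold

variable {n : ℕ} {M : Type*} [TopologicalSpace M]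

/-- The image of the local orientation at `x` in `H_n(M, M ∖ {x}; ℝ)`. -/
def ManifoldOrientation.realCls (o : ManifoldOrientation n M) (x : M) :
    RelHomology ℝ ({x}ᶜ : Set M) n :=
  RelHomology.toReal _ n (o.cls x)

/-- Locally finite fundamental cycles of an oriented `n`-manifold `M` without boundary: the locally
finite `n`-cycles that restrict to the given local orientation at every point of `M`. -/
def IsLFFundamentalCycle (o : ManifoldOrientation n M) (c : SingularSimplex n M → ℝ) : Prop :=
  ∃ hc : IsLocallyFiniteCycle c, ∀ x : M,
    Represents (hc.isLocallyFiniteChain.truncate (isCompact_singleton (x := x))) (o.realCls x)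

/-- The (locally finite) simplicial volume `‖M‖`, in `[0, ∞]`. -/
def lfVolume (o : ManifoldOrientation n M) : ℝ≥0∞ :=
  ⨅ (c : SingularSimplex n M → ℝ) (_ : IsLFFundamentalCycle o c), l1Norm c

/-- The Lipschitz constant in `[0, ∞]` of a singular simplex with respect to a distance on `M` and
the Euclidean distance on the standard simplex. -/
def lipConst (d : M → M → ℝ≥0∞) {k : ℕ} (σ : SingularSimplex k M) : ℝ≥0∞ :=
  sInf {L | ∀ s t : stdSimplex ℝ (Fin (k + 1)),
    d (σ s) (σ t) ≤ L * edist (WithLp.toLp 2 s.1 : EuclideanSpace ℝ (Fin (k + 1)))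
      (WithLp.toLp 2 t.1 : EuclideanSpace ℝ (Fin (k + 1)))}

/-- The Lipschitz constant of a chain: the supremum of the Lipschitz constants of the simplices
occurring in it. -/
def chainLipConst (d : M → M → ℝ≥0∞) {k : ℕ} (c : SingularSimplex k M → ℝ) : ℝ≥0∞ :=
  ⨆ (σ : SingularSimplex k M) (_ : c σ ≠ 0), lipConst d σ

variable [ChartedSpace (EuclideanSpace ℝ (Fin n)) M] [IsManifold (𝓡 n) ∞ M]

/-- Smooth Riemannian metrics on a smooth `n`-manifold. -/
abbrev SmoothRiemannianMetric (n : ℕ) (M : Type*) [TopologicalSpace M]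
    [ChartedSpace (EuclideanSpace ℝ (Fin n)) M] [IsManifold (𝓡 n) ∞ M] : Type _ :=
  Bundle.ContMDiffRiemannianMetric (𝓡 n) ∞ (EuclideanSpace ℝ (Fin n))
    (fun x : M => TangentSpace (𝓡 n) x)

open scoped Bundle in
/-- The distance induced by a Riemannian metric: the infimum of the lengths of `C¹` paths. -/
def metricDist (g : SmoothRiemannianMetric n M) (x y : M) : ℝ≥0∞ :=
  letI : Bundle.RiemannianBundle (fun x : M => TangentSpace (𝓡 n) x) := ⟨g.toRiemannianMetric⟩
  Manifold.riemannianEDist (𝓡 n) x y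

/-- The geometric (Lipschitz) simplicial volume `‖M, g‖_Lip`, in `[0, ∞]`. -/
def lipVolume (o : ManifoldOrientation n M) (g : SmoothRiemannianMetric n M) : ℝ≥0∞ :=
  ⨅ (c : SingularSimplex n M → ℝ) (_ : IsLFFundamentalCycle o c)
    (_ : chainLipConst (metricDist g) c < ⊤), l1Norm c

end OpenManifold

section ManifoldWithBoundary

variable {n : ℕ} {V : Type*} [TopologicalSpace V]

/-- The inclusion of the interior of `V` into `V`. -/
def interiorInclusion (n : ℕ) (V : Type*) [TopologicalSpace V] : C(manifoldInterior n V, V) :=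
  ⟨Subtype.val, continuous_subtype_val⟩

lemma mapsTo_interiorInclusion (x : manifoldInterior n V) :
    Set.MapsTo (interiorInclusion n V) ({x}ᶜ) ({(x : V)}ᶜ) :=
  fun _ hy h => hy (Subtype.ext h)

lemma manifoldBoundary_subset (x : manifoldInterior n V) :
    manifoldBoundary n V ⊆ {(x : V)}ᶜ :=
  Set.compl_subset_compl.2 (Set.singleton_subset_iff.2 x.2)

/-- The relative fundamental class `[V, ∂V] ∈ H_n(V, ∂V; ℝ)` of a manifold `V` with oriented
interior: it restricts to the given local orientation in `H_n(V, V ∖ {x}; ℝ)` at every interior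
point `x`. -/
def IsRelFundamentalClass (o : ManifoldOrientation n (manifoldInterior n V))
    (α : RelHomology ℝ (manifoldBoundary n V) n) : Prop :=
  ∀ x : manifoldInterior n V, RelHomology.restrict ℝ (manifoldBoundary_subset x) n α =
    RelHomology.map ℝ (interiorInclusion n V) (mapsTo_interiorInclusion x) n (o.realCls x)

/-- The relative simplicial volume `‖V, ∂V‖`: the `ℓ¹`-seminorm of the relative fundamental class
(which is unique for connected compact `V`). -/
def relVolume (o : ManifoldOrientation n (manifoldInterior n V)) : ℝ≥0∞ :=
  ⨅ (α : RelHomology ℝ (manifoldBoundary n V) n) (_ : IsRelFundamentalClass o α), α.seminorm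

end ManifoldWithBoundary

end SimplicialVolume

end

/-!
# The simplicial volume of a manifold with boundary and of its interior

Let `V` be compact with interior `M`, and suppose that the bounded cohomology of `(V, ∂V)` maps
isometrically onto that of `V` in the top degree. The theorem follows from three inequalities.

*The relative volume is at most the locally finite one* (`relVolume_le_lfVolume`). By a collar
argument there is a homotopy of `V`, fixed on `∂V`, which ends with a map that sends the complement
of a compact set `L ⊆ M` into `∂V`. A locally finite fundamental cycle `c`, truncated to the
simplices that meet `L` and pushed along this map, becomes a relative cycle of `V` of no larger norm
(`IsOutwardPush.pushedCycle`). It is fundamental since the homotopy tracks through a point stay in a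
compact subset of `M`. Conversely, every relative fundamental cycle is homologous to this one
(`IsOutwardPush.sub_pushedCycle_mem`): a relative cycle that is trivial at every point of `L` is
trivial relative to the complement of `L`. The latter fact, `locallyDetermined_of_isCompact`, is
proved from scratch: singular homology is developed by acyclic models (the prism operator and
barycentric subdivision), Mayer–Vietoris and excision arguments, starting from convex compact sets
in Euclidean space. The same computation distinguishes boundary points from interior points, which
the collar argument needs.

*The locally finite volume is at most the relative one* (`lfVolume_le_relVolume`). Let `c` be a
locally finite fundamental cycle of finite norm, `z` a relative fundamental cycle and `f` a cocycle
of `M` that is bounded by one. As `V` can be pushed into `M`, the cocycle `f` extends to `V` up to a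
bounded coboundary, and by hypothesis the extension may be chosen to vanish on `∂V` and to be
bounded by `1 + ε`. Bounded coboundaries vanish on summable cycles (`tsum_coboundary_mul`), so
`⟨f, c⟩` is the value of this relative cocycle on the pushed cycle, hence on `z`, and
`|⟨f, c⟩| ≤ (1 + ε) ‖z‖` (`abs_tsum_mul_le`). By the Hahn–Banach theorem in the space of summable
chains, `c` can be changed by the boundary of a *finite* chain so that its norm becomes arbitrarily
close to `‖z‖` (`exists_l1Norm_add_boundary_lt`).

*The Lipschitz volume is at most the relative one* (`lipVolume_le_relVolume`). The last step applies
to a Lipschitz cycle `c` of finite norm and only spoils the Lipschitz property of finitely many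
simplices. These are repaired chart by chart: in a chart, a simplex is moved to its Bernstein
polynomial (`bernstein`). Bernstein polynomials are compatible with faces, so this is a deformation
on the level of chains (`IsDeformation`); it is supported in a compact set, affects finitely many
simplices, and does not increase the norm (`exists_lipschitz_fundamentalCycle`). Charts are locally
bi-Lipschitz for a Riemannian distance (`exists_isBiLipschitz_metricDist`).
-/

noncomputable section

namespace SimplicialVolume

/-! ### Singular chains, cones and acyclic models -/

section Algebra

variable {X Y Z : Type*} [TopologicalSpace X] [TopologicalSpace Y] [TopologicalSpace Z]

/-- The sign cancellation behind `∂ ∂ = 0`. -/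
lemma alternating_double_sum {A : Type*} [AddCommGroup A] [Module ℝ A] {k : ℕ}
    (g : Fin (k + 3) → Fin (k + 2) → A)
    (hg : ∀ i j : Fin (k + 2), i ≤ j → g j.succ i = g i.castSucc j) :
    ∑ j : Fin (k + 3), (-1 : ℝ) ^ (j : ℕ) • ∑ i : Fin (k + 2), (-1 : ℝ) ^ (i : ℕ) • g j i = 0 := by
  simp only [Finset.smul_sum, smul_smul, ← Finset.sum_product']
  let P := Fin (k + 3) × Fin (k + 2)
  let S : Finset P := {ij : P | (ij.1 : ℕ) ≤ (ij.2 : ℕ)}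
  rw [Finset.univ_product_univ, ← Finset.sum_add_sum_compl S, ← eq_neg_iff_add_eq_zero,
    ← Finset.sum_neg_distrib]
  let φ : ∀ ij : P, ij ∈ S → P := fun ij hij =>
    (ij.2.succ, Fin.castLT ij.1 (lt_of_le_of_lt (Finset.mem_filter.mp hij).right (Fin.is_lt ij.2)))
  refine Finset.sum_bij φ ?_ ?_ ?_ ?_
  · intro ij hij
    simp_rw [S, φ, Finset.compl_filter, Finset.mem_filter_univ, Fin.val_succ,
      Fin.val_castLT] at hij ⊢
    lia
  · rintro ⟨i, j⟩ hij ⟨i', j'⟩ hij' h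
    rw [Prod.mk_inj]
    have h2 := congr_arg (fun q : P => (q.2 : ℕ)) h
    have h1 := congr_arg (fun q : P => (q.1 : ℕ)) h
    simp only [φ, Fin.val_castLT, Fin.val_succ] at h1 h2
    exact ⟨Fin.ext h2, Fin.ext (by lia)⟩
  · rintro ⟨i', j'⟩ hij'
    simp_rw [S, Finset.compl_filter, Finset.mem_filter_univ, not_le] at hij'
    refine ⟨(Fin.castSucc j', i'.pred ?_), ?_, ?_⟩
    · rintro rfl
      simp at hij'
    · simpa [S] using! Nat.le_sub_one_of_lt hij'
    · simp [φ]
  · rintro ⟨i, j⟩ hij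
    have hij' : (i : ℕ) ≤ j := by simpa [S] using hij
    have h := hg (i.castLT (hij'.trans_lt j.is_lt)) j hij'
    simp only [φ, Fin.val_succ, Fin.val_castLT, h, Fin.castSucc_castLT]
    rw [← neg_smul]
    congr 1
    ring

lemma faceInclusion_comp {k : ℕ} {i j : Fin (k + 2)} (h : i ≤ j) :
    (faceInclusion j.succ).comp (faceInclusion i) =
      (faceInclusion i.castSucc).comp (faceInclusion j) := by
  ext1 t
  simp only [faceInclusion, ContinuousMap.comp_apply, ContinuousMap.coe_mk,
    stdSimplex.map_comp_apply]
  congr 1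
  funext l
  simp only [Function.comp, Fin.succAbove]
  rcases i with ⟨i, _⟩
  rcases j with ⟨j, _⟩
  rcases l with ⟨l, _⟩
  split_ifs <;> · simp at * <;> lia

lemma face_face {k : ℕ} {i j : Fin (k + 2)} (h : i ≤ j) (σ : SingularSimplex (k + 2) X) :
    face i (face j.succ σ) = face j (face i.castSucc σ) := by
  simp only [face, ContinuousMap.comp_assoc, faceInclusion_comp h]

lemma boundary_single {k : ℕ} (σ : SingularSimplex (k + 1) X) (a : ℝ) :
    boundary ℝ k X (Finsupp.single σ a) =
      ∑ i : Fin (k + 2), (-1 : ℝ) ^ (i : ℕ) • Finsupp.single (face i σ) a := by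
  simp [boundary, LinearMap.sum_apply, Finsupp.mapDomain_single]

lemma boundary_boundary {k : ℕ} (c : Chain ℝ (k + 2) X) :
    boundary ℝ k X (boundary ℝ (k + 1) X c) = 0 := by
  induction c using Finsupp.induction_linear with
  | zero => simp
  | add f g hf hg => simp [hf, hg]
  | single σ a =>
    simp only [boundary_single, map_sum, map_smul]
    exact alternating_double_sum (fun j i => Finsupp.single (face i (face j σ)) a)
      fun i j h => by simp only [face_face h]

lemma chainMap_single {k : ℕ} (f : C(X, Y)) (σ : SingularSimplex k X) (a : ℝ) :
    chainMap ℝ k f (Finsupp.single σ a) = Finsupp.single (f.comp σ) a := by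
  simp [chainMap, Finsupp.mapDomain_single]

lemma chainMap_comp {k : ℕ} (g : C(Y, Z)) (f : C(X, Y)) (c : Chain ℝ k X) :
    chainMap ℝ k g (chainMap ℝ k f c) = chainMap ℝ k (g.comp f) c := by
  simp only [chainMap, Finsupp.lmapDomain_apply, ← Finsupp.mapDomain_comp]
  rfl

lemma chainMap_id {k : ℕ} (c : Chain ℝ k X) : chainMap ℝ k (ContinuousMap.id X) c = c := by
  simp only [chainMap, Finsupp.lmapDomain_apply, ContinuousMap.id_comp]
  exact Finsupp.mapDomain_id

lemma single_mem_chainsIn {k : ℕ} {A : Set X} {σ : SingularSimplex k X} (h : Set.range σ ⊆ A)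
    (a : ℝ) : Finsupp.single σ a ∈ chainsIn ℝ k A :=
  Finsupp.single_mem_supported ℝ a h

lemma chainsIn_mono {k : ℕ} {A B : Set X} (h : A ⊆ B) : chainsIn ℝ k A ≤ chainsIn ℝ k B :=
  Finsupp.supported_mono fun _ hσ => hσ.trans h

lemma chainsIn_univ {k : ℕ} : chainsIn ℝ k (Set.univ : Set X) = ⊤ := by
  simp [chainsIn]

lemma mem_chainsIn_inter {k : ℕ} {A B : Set X} {c : Chain ℝ k X} (hA : c ∈ chainsIn ℝ k A)
    (hB : c ∈ chainsIn ℝ k B) : c ∈ chainsIn ℝ k (A ∩ B) := by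
  rw [chainsIn, Finsupp.mem_supported] at *
  exact fun σ hσ => Set.subset_inter (hA hσ) (hB hσ)

/-- To check a property of the chains in `A` it suffices to treat single simplices. -/
lemma chainsIn_le {k : ℕ} {A : Set X} {p : Submodule ℝ (Chain ℝ k X)}
    (h : ∀ σ : SingularSimplex k X, Set.range σ ⊆ A → Finsupp.single σ 1 ∈ p) :
    chainsIn ℝ k A ≤ p := by
  rw [chainsIn, Finsupp.supported_eq_span_single, Submodule.span_le]
  rintro _ ⟨σ, hσ, rfl⟩
  exact h σ hσ

lemma boundary_mem_chainsIn {k : ℕ} {A : Set X} {c : Chain ℝ (k + 1) X}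
    (hc : c ∈ chainsIn ℝ (k + 1) A) : boundary ℝ k X c ∈ chainsIn ℝ k A := by
  suffices h : chainsIn ℝ (k + 1) A ≤ (chainsIn ℝ k A).comap (boundary ℝ k X) from h hc
  refine chainsIn_le fun σ hσ => ?_
  rw [Submodule.mem_comap, boundary_single]
  exact Submodule.sum_mem _ fun i _ => Submodule.smul_mem _ _
    (single_mem_chainsIn ((range_face_subset i σ).trans hσ) 1)

lemma relCycles_mono {k : ℕ} {A B : Set X} (h : A ⊆ B) : relCycles ℝ A k ≤ relCycles ℝ B k := by
  cases k with
  | zero => exact le_rfl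
  | succ k => exact Submodule.comap_mono (chainsIn_mono h)

lemma relBoundaries_mono {k : ℕ} {A B : Set X} (h : A ⊆ B) :
    relBoundaries ℝ A k ≤ relBoundaries ℝ B k :=
  sup_le_sup_left (chainsIn_mono h) _

lemma mem_relBoundaries {k : ℕ} {A : Set X} {z : Chain ℝ k X} :
    z ∈ relBoundaries ℝ A k ↔
      ∃ u : Chain ℝ (k + 1) X, ∃ a ∈ chainsIn ℝ k A, z = boundary ℝ k X u + a := by
  rw [relBoundaries, Submodule.mem_sup]
  constructor
  · rintro ⟨_, ⟨u, rfl⟩, a, ha, rfl⟩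
    exact ⟨u, a, ha, rfl⟩
  · rintro ⟨u, a, ha, rfl⟩
    exact ⟨_, ⟨u, rfl⟩, a, ha, rfl⟩

lemma boundary_mem_relBoundaries {k : ℕ} {A : Set X} (u : Chain ℝ (k + 1) X) :
    boundary ℝ k X u ∈ relBoundaries ℝ A k :=
  Submodule.mem_sup_left ⟨u, rfl⟩

lemma chainsIn_le_relBoundaries {k : ℕ} {A : Set X} : chainsIn ℝ k A ≤ relBoundaries ℝ A k :=
  le_sup_right

lemma relBoundaries_le_relCycles {k : ℕ} {A : Set X} :
    relBoundaries ℝ A k ≤ relCycles ℝ A k := by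
  cases k with
  | zero => exact le_top
  | succ k =>
    intro z hz
    obtain ⟨u, a, ha, rfl⟩ := mem_relBoundaries.1 hz
    simp only [relCycles, Submodule.mem_comap, map_add, boundary_boundary, zero_add]
    exact boundary_mem_chainsIn ha

/-- The augmentation `∑ a_σ σ ↦ ∑ a_σ`. -/
def augmentation {k : ℕ} : Chain ℝ k X →ₗ[ℝ] ℝ :=
  Finsupp.linearCombination ℝ fun _ => (1 : ℝ)

lemma augmentation_single {k : ℕ} (σ : SingularSimplex k X) (a : ℝ) :
    augmentation (Finsupp.single σ a) = a := by
  simp [augmentation]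

lemma augmentation_boundary (c : Chain ℝ 1 X) : augmentation (boundary ℝ 0 X c) = 0 := by
  induction c using Finsupp.induction_linear with
  | zero => simp
  | add f g hf hg => simp [hf, hg]
  | single σ a =>
    rw [boundary_single, Fin.sum_univ_two, map_add, map_smul, map_smul, augmentation_single,
      augmentation_single]
    simp

end Algebra

/-! ### The cone operator of a contraction -/

section Cone

variable {X : Type*} [TopologicalSpace X]

lemma faceInclusion_apply_self {k : ℕ} (i : Fin (k + 2)) (t : stdSimplex ℝ (Fin (k + 1))) :
    faceInclusion i t i = 0 := by
  simp only [faceInclusion, ContinuousMap.coe_mk, stdSimplex.map_coe,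
    FunOnFinite.linearMap_apply_apply]
  exact Finset.sum_eq_zero fun j hj => absurd (Finset.mem_filter.1 hj).2 (Fin.succAbove_ne i j)

lemma faceInclusion_apply_succAbove {k : ℕ} (i : Fin (k + 2)) (j : Fin (k + 1))
    (t : stdSimplex ℝ (Fin (k + 1))) : faceInclusion i t (i.succAbove j) = t j := by
  simp only [faceInclusion, ContinuousMap.coe_mk, stdSimplex.map_coe,
    FunOnFinite.linearMap_apply_apply]
  rw [Finset.sum_eq_single j]
  · intro l hl hlj
    exact absurd (Fin.succAbove_right_injective (Finset.mem_filter.1 hl).2) hlj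
  · intro h
    simp at h

/-- The quotient map `Δᵏ × [0, 1] → Δᵏ⁺¹`, `(s, u) ↦ (u, (1 - u) s)`, that collapses
`Δᵏ × {1}` to the vertex `0`. -/
def joinVertex (k : ℕ) : C(stdSimplex ℝ (Fin (k + 1)) × unitInterval, stdSimplex ℝ (Fin (k + 2))) :=
  ⟨fun q => ⟨Fin.cons (q.2 : ℝ) fun i => (1 - (q.2 : ℝ)) * q.1 i, by
      refine ⟨fun i => ?_, ?_⟩
      · refine Fin.cases ?_ (fun j => ?_) i
        · exact q.2.2.1
        · exact mul_nonneg (sub_nonneg.2 q.2.2.2) (q.1.2.1 j)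
      · rw [Fin.sum_univ_succ]
        simp [← Finset.mul_sum]⟩, by
    refine Continuous.subtype_mk (continuous_pi fun i => ?_) _
    refine Fin.cases ?_ (fun j => ?_) i
    · exact continuous_subtype_val.comp continuous_snd
    · exact (continuous_const.sub (continuous_subtype_val.comp continuous_snd)).mul
        ((continuous_apply j).comp (continuous_subtype_val.comp continuous_fst))⟩

lemma joinVertex_zero {k : ℕ} (q) : joinVertex k q 0 = q.2 := rfl

lemma joinVertex_succ {k : ℕ} (q) (j : Fin (k + 1)) :
    joinVertex k q j.succ = (1 - (q.2 : ℝ)) * q.1 j := rfl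

lemma joinVertex_surjective (k : ℕ) : Function.Surjective (joinVertex k) := by
  intro t
  by_cases h : t 0 = 1
  · refine ⟨(Classical.arbitrary _, 1), stdSimplex.ext (funext fun i => ?_)⟩
    have h0 : ∑ j : Fin (k + 1), t j.succ = 0 := by
      have := t.2.2
      rw [Fin.sum_univ_succ] at this
      change t 0 + ∑ j : Fin (k + 1), t j.succ = 1 at this
      linarith
    rw [Finset.sum_eq_zero_iff_of_nonneg fun j _ => stdSimplex.zero_le t _] at h0
    refine Fin.cases ?_ (fun j => ?_) i
    · simp [joinVertex_zero, h]
    · simp [joinVertex_succ, h0 j (Finset.mem_univ _)]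
  · have h1 : 0 < 1 - t 0 := sub_pos.2 (lt_of_le_of_ne (stdSimplex.le_one t 0) h)
    refine ⟨(⟨fun j => t j.succ / (1 - t 0), fun j => div_nonneg (t.2.1 _) h1.le, ?_⟩,
      ⟨t 0, t.2.1 0, stdSimplex.le_one t 0⟩), stdSimplex.ext (funext fun i => ?_)⟩
    · have := t.2.2
      rw [Fin.sum_univ_succ] at this
      change t 0 + ∑ j : Fin (k + 1), t j.succ = 1 at this
      rw [← Finset.sum_div, div_eq_one_iff_eq h1.ne']
      linarith
    · refine Fin.cases rfl (fun j => ?_) i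
      rw [joinVertex_succ]
      exact mul_div_cancel₀ _ h1.ne'

lemma isQuotientMap_joinVertex (k : ℕ) : Topology.IsQuotientMap (joinVertex k) :=
  (joinVertex k).continuous.isClosedMap.isQuotientMap (joinVertex k).continuous
    (joinVertex_surjective k)

/-- The contraction `G` of `X` contracts to the point `p`. -/
structure IsContraction (G : C(X × unitInterval, X)) (p : X) : Prop where
  zero : ∀ x, G (x, 0) = x
  one : ∀ x, G (x, 1) = p

variable {G : C(X × unitInterval, X)} {p : X} (hG : IsContraction G p)

lemma coneSimplex_factors (hG : IsContraction G p) {k : ℕ} (σ : SingularSimplex k X) :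
    Function.FactorsThrough (G.comp (σ.prodMap (ContinuousMap.id unitInterval)))
      (joinVertex k) := by
  rintro ⟨s, u⟩ ⟨s', u'⟩ h
  have hu : u = u' := by
    have := congr_arg (fun t : stdSimplex ℝ (Fin (k + 2)) => t 0) h
    exact Subtype.ext this
  subst hu
  by_cases hu1 : u = 1
  · subst hu1
    simp [hG.one]
  · have : s = s' := by
      refine stdSimplex.ext (funext fun j => ?_)
      have := congr_arg (fun t : stdSimplex ℝ (Fin (k + 2)) => t j.succ) h
      simp only [joinVertex_succ] at this
      refine mul_left_cancel₀ (fun h0 => hu1 ?_) this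
      exact Subtype.ext (sub_eq_zero.1 h0).symm
    rw [this]

/-- The cone over a singular simplex with respect to a contraction `G` of `X`: it maps
`(u, (1 - u) s)` to `G (σ s, u)`. -/
def coneSimplex (hG : IsContraction G p) {k : ℕ} (σ : SingularSimplex k X) :
    SingularSimplex (k + 1) X :=
  (isQuotientMap_joinVertex k).lift (G.comp (σ.prodMap (ContinuousMap.id _)))
    (coneSimplex_factors hG σ)

lemma coneSimplex_joinVertex {k : ℕ} (σ : SingularSimplex k X) (s) (u : unitInterval) :
    coneSimplex hG σ (joinVertex k (s, u)) = G (σ s, u) :=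
  DFunLike.congr_fun ((isQuotientMap_joinVertex k).lift_comp
    (G.comp (σ.prodMap (ContinuousMap.id _))) (coneSimplex_factors hG σ)) (s, u)

lemma face_zero_coneSimplex {k : ℕ} (σ : SingularSimplex k X) :
    face 0 (coneSimplex hG σ) = σ := by
  ext1 t
  have : faceInclusion 0 t = joinVertex k (t, 0) := by
    refine stdSimplex.ext (funext fun i => ?_)
    refine Fin.cases ?_ (fun j => ?_) i
    · rw [faceInclusion_apply_self]
      rfl
    · rw [← Fin.succAbove_zero_apply, faceInclusion_apply_succAbove, Fin.succAbove_zero_apply,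
        joinVertex_succ]
      simp
  rw [face, ContinuousMap.comp_apply, this, coneSimplex_joinVertex, hG.zero]

lemma faceInclusion_succ_joinVertex {k : ℕ} (i : Fin (k + 2)) (s : stdSimplex ℝ (Fin (k + 1)))
    (u : unitInterval) :
    faceInclusion i.succ (joinVertex k (s, u)) = joinVertex (k + 1) (faceInclusion i s, u) := by
  refine stdSimplex.ext (funext fun l => ?_)
  refine Fin.cases ?_ (fun j => ?_) l
  · have : (0 : Fin (k + 3)) = i.succ.succAbove 0 := by simp
    rw [this, faceInclusion_apply_succAbove, ← this]
    rfl
  · rw [joinVertex_succ]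
    rcases Fin.eq_self_or_eq_succAbove i j with rfl | ⟨m, rfl⟩
    · rw [faceInclusion_apply_self, faceInclusion_apply_self, mul_zero]
    · rw [faceInclusion_apply_succAbove, ← Fin.succ_succAbove_succ, faceInclusion_apply_succAbove,
        joinVertex_succ]

lemma face_succ_coneSimplex {k : ℕ} (i : Fin (k + 2)) (σ : SingularSimplex (k + 1) X) :
    face i.succ (coneSimplex hG σ) = coneSimplex hG (face i σ) := by
  ext1 t
  obtain ⟨⟨s, u⟩, rfl⟩ := joinVertex_surjective k t
  rw [coneSimplex_joinVertex, face, ContinuousMap.comp_apply, faceInclusion_succ_joinVertex,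
    coneSimplex_joinVertex]
  rfl

lemma face_one_coneSimplex (σ : SingularSimplex 0 X) :
    face 1 (coneSimplex hG σ) = ContinuousMap.const _ p := by
  ext1 t
  have : faceInclusion 1 t = joinVertex 0 (t, 1) := by
    refine stdSimplex.ext (funext fun i => ?_)
    refine Fin.cases ?_ (fun j => ?_) i
    · have : (0 : Fin 2) = (1 : Fin 2).succAbove 0 := by simp
      rw [this, faceInclusion_apply_succAbove, ← this, joinVertex_zero]
      simp
    · rw [joinVertex_succ, Subsingleton.elim j 0]
      exact (faceInclusion_apply_self _ _).trans (by simp)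
  rw [face, ContinuousMap.comp_apply, this, coneSimplex_joinVertex, hG.one]
  rfl

/-- The cone operator on chains. -/
def cone (hG : IsContraction G p) (k : ℕ) : Chain ℝ k X →ₗ[ℝ] Chain ℝ (k + 1) X :=
  Finsupp.lmapDomain ℝ ℝ (coneSimplex hG)

lemma cone_single {k : ℕ} (σ : SingularSimplex k X) (a : ℝ) :
    cone hG k (Finsupp.single σ a) = Finsupp.single (coneSimplex hG σ) a := by
  simp [cone, Finsupp.mapDomain_single]

lemma boundary_cone {k : ℕ} (c : Chain ℝ (k + 1) X) :
    boundary ℝ (k + 1) X (cone hG (k + 1) c) = c - cone hG k (boundary ℝ k X c) := by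
  induction c using Finsupp.induction_linear with
  | zero => simp
  | add f g hf hg =>
    simp only [map_add, hf, hg]
    abel
  | single σ a =>
    rw [cone_single, boundary_single, Fin.sum_univ_succ, boundary_single, map_sum, sub_eq_add_neg,
      ← Finset.sum_neg_distrib]
    simp only [face_zero_coneSimplex, face_succ_coneSimplex, map_smul, cone_single, Fin.val_succ,
      pow_succ, mul_neg, mul_one, neg_smul, Fin.val_zero, pow_zero, one_smul]

lemma boundary_cone_zero (c : Chain ℝ 0 X) :
    boundary ℝ 0 X (cone hG 0 c) =
      c - Finsupp.single (ContinuousMap.const _ p) (augmentation c) := by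
  induction c using Finsupp.induction_linear with
  | zero => simp
  | add f g hf hg =>
    simp only [map_add, hf, hg, Finsupp.single_add]
    abel
  | single σ a =>
    rw [cone_single, boundary_single, Fin.sum_univ_two]
    simp [face_zero_coneSimplex, face_one_coneSimplex, augmentation_single, sub_eq_add_neg]

lemma cone_mem_chainsIn {k : ℕ} {A : Set X} (hA : ∀ x ∈ A, ∀ u, G (x, u) ∈ A)
    {c : Chain ℝ k X} (hc : c ∈ chainsIn ℝ k A) : cone hG k c ∈ chainsIn ℝ (k + 1) A := by
  suffices h : chainsIn ℝ k A ≤ (chainsIn ℝ (k + 1) A).comap (cone hG k) from h hc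
  refine chainsIn_le fun σ hσ => ?_
  rw [Submodule.mem_comap, cone_single]
  refine single_mem_chainsIn ?_ 1
  rintro _ ⟨t, rfl⟩
  obtain ⟨⟨s, u⟩, rfl⟩ := joinVertex_surjective k t
  rw [coneSimplex_joinVertex]
  exact hA _ (hσ ⟨s, rfl⟩) u

end Cone

/-! ### Acyclic models -/

section Models

variable {E : ℕ → Type} [∀ k, TopologicalSpace (E k)]

/-- The alternating sum of the push-forwards of a chain of `E k` under the coface maps of a
cosimplicial space. -/
def cofaceSum (d : ∀ k, Fin (k + 2) → C(E k, E (k + 1))) (m k : ℕ) :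
    Chain ℝ m (E k) →ₗ[ℝ] Chain ℝ m (E (k + 1)) :=
  ∑ i : Fin (k + 2), (-1 : ℝ) ^ (i : ℕ) • chainMap ℝ m (d k i)

lemma cofaceSum_apply (d : ∀ k, Fin (k + 2) → C(E k, E (k + 1))) (m k : ℕ) (c : Chain ℝ m (E k)) :
    cofaceSum d m k c = ∑ i : Fin (k + 2), (-1 : ℝ) ^ (i : ℕ) • chainMap ℝ m (d k i) c := by
  simp [cofaceSum]

lemma boundary_cofaceSum (d : ∀ k, Fin (k + 2) → C(E k, E (k + 1))) (m k : ℕ)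
    (c : Chain ℝ (m + 1) (E k)) :
    boundary ℝ m _ (cofaceSum d (m + 1) k c) = cofaceSum d m k (boundary ℝ m _ c) := by
  simp [cofaceSum_apply, boundary_chainMap]

lemma cofaceSum_cofaceSum {d : ∀ k, Fin (k + 2) → C(E k, E (k + 1))}
    (hd : ∀ k (i j : Fin (k + 2)), i ≤ j →
      (d (k + 1) j.succ).comp (d k i) = (d (k + 1) i.castSucc).comp (d k j))
    (m k : ℕ) (c : Chain ℝ m (E k)) : cofaceSum d m (k + 1) (cofaceSum d m k c) = 0 := by
  rw [cofaceSum_apply d m (k + 1), cofaceSum_apply d m k c]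
  simp only [map_sum, map_smul, chainMap_comp]
  exact alternating_double_sum (fun j i => chainMap ℝ m ((d (k + 1) j).comp (d k i)) c)
    fun i j h => by simp only [hd k i j h]

/-- Two families of model chains on contractible models with the same augmentation, each
compatible with the boundary operator, are joined by a natural chain homotopy. -/
lemma exists_model_homotopy {d : ∀ k, Fin (k + 2) → C(E k, E (k + 1))}
    (hd : ∀ k (i j : Fin (k + 2)), i ≤ j →
      (d (k + 1) j.succ).comp (d k i) = (d (k + 1) i.castSucc).comp (d k j))
    {G : ∀ k, C(E k × unitInterval, E k)} {p : ∀ k, E k} (hG : ∀ k, IsContraction (G k) (p k))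
    (a a' : ∀ k, Chain ℝ k (E k))
    (ha : ∀ k, boundary ℝ k _ (a (k + 1)) = cofaceSum d k k (a k))
    (ha' : ∀ k, boundary ℝ k _ (a' (k + 1)) = cofaceSum d k k (a' k))
    (h0 : augmentation (a 0) = augmentation (a' 0)) :
    ∃ T : ∀ k, Chain ℝ (k + 1) (E k), boundary ℝ 0 _ (T 0) = a' 0 - a 0 ∧
      ∀ k, boundary ℝ (k + 1) _ (T (k + 1)) =
        a' (k + 1) - a (k + 1) - cofaceSum d (k + 1) k (T k) := by
  let Inv : ∀ k, Chain ℝ (k + 1) (E k) → Prop := fun k T =>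
    cofaceSum d k k (a' k - a k - boundary ℝ k _ T) = 0
  let T0 : Chain ℝ 1 (E 0) := cone (hG 0) 0 (a' 0 - a 0)
  have hT0 : boundary ℝ 0 _ T0 = a' 0 - a 0 := by
    simp [T0, boundary_cone_zero, h0, map_sub]
  let next : ∀ k, Chain ℝ (k + 1) (E k) → Chain ℝ (k + 2) (E (k + 1)) := fun k T =>
    cone (hG (k + 1)) (k + 1) (a' (k + 1) - a (k + 1) - cofaceSum d (k + 1) k T)
  have hnext : ∀ k T, Inv k T → boundary ℝ (k + 1) _ (next k T) =
      a' (k + 1) - a (k + 1) - cofaceSum d (k + 1) k T := by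
    intro k T hT
    have h : boundary ℝ k _ (a' (k + 1) - a (k + 1) - cofaceSum d (k + 1) k T) = 0 := by
      rw [← hT, map_sub, map_sub, ha, ha', boundary_cofaceSum, map_sub, map_sub]
    rw [boundary_cone, h, map_zero, sub_zero]
  have hInv : ∀ k T, Inv k T → Inv (k + 1) (next k T) := by
    intro k T hT
    simp only [Inv, hnext k T hT, sub_sub_cancel, cofaceSum_cofaceSum hd]
  let T : ∀ k, Chain ℝ (k + 1) (E k) := fun k => Nat.rec T0 next k
  have hT : ∀ k, Inv k (T k) := by
    intro k
    induction k with
    | zero =>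
      change cofaceSum d 0 0 (a' 0 - a 0 - boundary ℝ 0 _ T0) = 0
      rw [hT0, sub_self, map_zero]
    | succ k ih => exact hInv k _ ih
  exact ⟨T, hT0, fun k => hnext k _ (hT k)⟩

end Models

/-! ### The prism operator of a natural family of homotopies -/

section Prism

variable {X Y : Type*} [TopologicalSpace X] [TopologicalSpace Y]

/-- The straight-line contraction of the standard simplex to the point `b`. -/
def simplexContraction {k : ℕ} (b : stdSimplex ℝ (Fin (k + 1))) :
    C(stdSimplex ℝ (Fin (k + 1)) × unitInterval, stdSimplex ℝ (Fin (k + 1))) :=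
  ⟨fun q => ⟨(1 - (q.2 : ℝ)) • q.1.1 + (q.2 : ℝ) • b.1,
    convex_stdSimplex ℝ _ q.1.2 b.2 (sub_nonneg.2 q.2.2.2) q.2.2.1 (by ring)⟩, by
    refine Continuous.subtype_mk ?_ _
    fun_prop⟩

lemma isContraction_simplexContraction {k : ℕ} (b : stdSimplex ℝ (Fin (k + 1))) :
    IsContraction (simplexContraction b) b :=
  ⟨fun x => Subtype.ext (by simp [simplexContraction]),
    fun x => Subtype.ext (by simp [simplexContraction])⟩

/-- The straight-line contraction of `Δᵏ × [0, 1]`. -/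
def prismContraction {k : ℕ} (b : stdSimplex ℝ (Fin (k + 1))) :
    C((stdSimplex ℝ (Fin (k + 1)) × unitInterval) × unitInterval,
      stdSimplex ℝ (Fin (k + 1)) × unitInterval) :=
  ⟨fun q => (simplexContraction b (q.1.1, q.2), unitInterval.symm q.2 * q.1.2), by fun_prop⟩

lemma isContraction_prismContraction {k : ℕ} (b : stdSimplex ℝ (Fin (k + 1))) :
    IsContraction (prismContraction b) (b, 0) := by
  refine ⟨fun x => ?_, fun x => ?_⟩
  · simp [prismContraction, (isContraction_simplexContraction b).zero]
  · simp [prismContraction, (isContraction_simplexContraction b).one]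

/-- The inclusion of `Δᵏ` into `Δᵏ × [0, 1]` at height `u`. -/
def atHeight (k : ℕ) (u : unitInterval) :
    C(stdSimplex ℝ (Fin (k + 1)), stdSimplex ℝ (Fin (k + 1)) × unitInterval) :=
  ⟨fun x => (x, u), by fun_prop⟩

/-- The coface maps `Δᵏ × [0, 1] → Δᵏ⁺¹ × [0, 1]`. -/
def prismFace (k : ℕ) (i : Fin (k + 2)) :
    C(stdSimplex ℝ (Fin (k + 1)) × unitInterval, stdSimplex ℝ (Fin (k + 2)) × unitInterval) :=
  (faceInclusion i).prodMap (ContinuousMap.id _)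

lemma exists_prismChain : ∃ T : ∀ k, Chain ℝ (k + 1) (stdSimplex ℝ (Fin (k + 1)) × unitInterval),
    boundary ℝ 0 _ (T 0) = Finsupp.single (atHeight 0 1) 1 - Finsupp.single (atHeight 0 0) 1 ∧
      ∀ k, boundary ℝ (k + 1) _ (T (k + 1)) = Finsupp.single (atHeight (k + 1) 1) 1 -
        Finsupp.single (atHeight (k + 1) 0) 1 - cofaceSum prismFace (k + 1) k (T k) := by
  have h : ∀ (u : unitInterval) (k : ℕ),
      boundary ℝ k _ (Finsupp.single (atHeight (k + 1) u) (1 : ℝ)) =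
        cofaceSum prismFace k k (Finsupp.single (atHeight k u) (1 : ℝ)) := by
    intro u k
    rw [boundary_single, cofaceSum_apply]
    refine Finset.sum_congr rfl fun i _ => ?_
    rw [chainMap_single]
    rfl
  refine exists_model_homotopy (E := fun k => stdSimplex ℝ (Fin (k + 1)) × unitInterval)
    (d := prismFace) ?_
    (fun k => isContraction_prismContraction (Classical.arbitrary (stdSimplex ℝ (Fin (k + 1)))))
    (fun k => Finsupp.single (atHeight k 0) 1) (fun k => Finsupp.single (atHeight k 1) 1)
    (h 0) (h 1) ?_
  · intro k i j hij
    ext1 ⟨t, u⟩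
    exact Prod.ext (DFunLike.congr_fun (faceInclusion_comp hij) t) rfl
  · rw [augmentation_single, augmentation_single]

/-- A chain of `Δᵏ × [0, 1]` that plays the role of the triangulated prism. -/
def prismChain (k : ℕ) : Chain ℝ (k + 1) (stdSimplex ℝ (Fin (k + 1)) × unitInterval) :=
  exists_prismChain.choose k

/-- A homotopy of every singular simplex, compatible with the passage to faces. -/
def NaturalHomotopy
    (H : ∀ k, SingularSimplex k X → C(stdSimplex ℝ (Fin (k + 1)) × unitInterval, Y)) :
    Prop :=
  ∀ k (i : Fin (k + 2)) (σ : SingularSimplex (k + 1) X),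
    H k (face i σ) = (H (k + 1) σ).comp (prismFace k i)

/-- The prism operator of a family of homotopies of simplices. -/
def prism (H : ∀ k, SingularSimplex k X → C(stdSimplex ℝ (Fin (k + 1)) × unitInterval, Y)) (k : ℕ) :
    Chain ℝ k X →ₗ[ℝ] Chain ℝ (k + 1) Y :=
  Finsupp.linearCombination ℝ fun σ => chainMap ℝ (k + 1) (H k σ) (prismChain k)

/-- The value of a family of homotopies of simplices at the time `u`, on chains. -/
def homotopyAt (H : ∀ k, SingularSimplex k X → C(stdSimplex ℝ (Fin (k + 1)) × unitInterval, Y))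
    (u : unitInterval) (k : ℕ) : Chain ℝ k X →ₗ[ℝ] Chain ℝ k Y :=
  Finsupp.lmapDomain ℝ ℝ fun σ => (H k σ).comp (atHeight k u)

variable {H : ∀ k, SingularSimplex k X → C(stdSimplex ℝ (Fin (k + 1)) × unitInterval, Y)}

lemma prism_single {k : ℕ} (σ : SingularSimplex k X) (a : ℝ) :
    prism H k (Finsupp.single σ a) = a • chainMap ℝ (k + 1) (H k σ) (prismChain k) := by
  simp [prism]

lemma homotopyAt_single {k : ℕ} (u : unitInterval) (σ : SingularSimplex k X) (a : ℝ) :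
    homotopyAt H u k (Finsupp.single σ a) = Finsupp.single ((H k σ).comp (atHeight k u)) a := by
  simp [homotopyAt, Finsupp.mapDomain_single]

lemma boundary_prism_zero (c : Chain ℝ 0 X) :
    boundary ℝ 0 Y (prism H 0 c) = homotopyAt H 1 0 c - homotopyAt H 0 0 c := by
  induction c using Finsupp.induction_linear with
  | zero => simp
  | add f g hf hg =>
    simp only [map_add, hf, hg]
    abel
  | single σ a =>
    rw [prism_single, map_smul, boundary_chainMap, prismChain, exists_prismChain.choose_spec.1,
      map_sub, chainMap_single, chainMap_single, homotopyAt_single, homotopyAt_single, smul_sub,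
      Finsupp.smul_single_one, Finsupp.smul_single_one]

lemma boundary_prism (hH : NaturalHomotopy H) {k : ℕ} (c : Chain ℝ (k + 1) X) :
    boundary ℝ (k + 1) Y (prism H (k + 1) c) =
      homotopyAt H 1 (k + 1) c - homotopyAt H 0 (k + 1) c - prism H k (boundary ℝ k X c) := by
  induction c using Finsupp.induction_linear with
  | zero => simp
  | add f g hf hg =>
    simp only [map_add, hf, hg]
    abel
  | single σ a =>
    rw [prism_single, map_smul, boundary_chainMap, prismChain, exists_prismChain.choose_spec.2,
      map_sub, map_sub, chainMap_single, chainMap_single, homotopyAt_single, homotopyAt_single,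
      smul_sub, smul_sub, Finsupp.smul_single_one, Finsupp.smul_single_one, boundary_single,
      map_sum, cofaceSum_apply, map_sum, Finset.smul_sum]
    congr 1
    refine Finset.sum_congr rfl fun i _ => ?_
    rw [map_smul, map_smul, prism_single, chainMap_comp, hH, smul_comm]
    rfl

lemma homotopyAt_boundary (hH : NaturalHomotopy H) (u : unitInterval) {k : ℕ}
    (c : Chain ℝ (k + 1) X) :
    boundary ℝ k Y (homotopyAt H u (k + 1) c) = homotopyAt H u k (boundary ℝ k X c) := by
  induction c using Finsupp.induction_linear with
  | zero => simp
  | add f g hf hg => simp only [map_add, hf, hg]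
  | single σ a =>
    rw [homotopyAt_single, boundary_single, boundary_single, map_sum]
    refine Finset.sum_congr rfl fun i _ => ?_
    rw [map_smul, homotopyAt_single, hH]
    rfl

/-- A natural family with values in `B` on the simplices of `A` sends chains of `A` to `B`. -/
lemma chainMap_range_mem_chainsIn {E : Type*} [TopologicalSpace E] {k : ℕ} {B : Set Y} {f : C(E, Y)}
    (h : Set.range f ⊆ B) (c : Chain ℝ k E) : chainMap ℝ k f c ∈ chainsIn ℝ k B :=
  chainMap_mem_chainsIn ℝ k f (A := Set.univ) (fun x _ => h ⟨x, rfl⟩)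
    (by rw [chainsIn_univ]; trivial)

lemma prism_mem_chainsIn {A : Set X} {B : Set Y} {k : ℕ}
    (h : ∀ σ : SingularSimplex k X, Set.range σ ⊆ A → Set.range (H k σ) ⊆ B) {c : Chain ℝ k X}
    (hc : c ∈ chainsIn ℝ k A) : prism H k c ∈ chainsIn ℝ (k + 1) B := by
  suffices h : chainsIn ℝ k A ≤ (chainsIn ℝ (k + 1) B).comap (prism H k) from h hc
  refine chainsIn_le fun σ hσ => ?_
  rw [Submodule.mem_comap, prism_single]
  exact Submodule.smul_mem _ _ (chainMap_range_mem_chainsIn (h σ hσ) _)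

/-- Homotopic relative cycles are homologous. -/
lemma homotopyAt_sub_mem_relBoundaries (hH : NaturalHomotopy H) {A : Set X} {B : Set Y} {k : ℕ}
    (h : ∀ k (σ : SingularSimplex k X), Set.range σ ⊆ A → Set.range (H k σ) ⊆ B) {c : Chain ℝ k X}
    (hc : c ∈ relCycles ℝ A k) :
    homotopyAt H 1 k c - homotopyAt H 0 k c ∈ relBoundaries ℝ B k := by
  cases k with
  | zero =>
    rw [← boundary_prism_zero]
    exact boundary_mem_relBoundaries _
  | succ k =>
    rw [mem_relBoundaries]
    refine ⟨prism H (k + 1) c, _, prism_mem_chainsIn (h k) hc, ?_⟩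
    rw [boundary_prism hH]
    abel

/-- The homotopies of simplices given by a homotopy of maps. -/
def homotopyFamily (F : C(X × unitInterval, Y)) (k : ℕ) (σ : SingularSimplex k X) :
    C(stdSimplex ℝ (Fin (k + 1)) × unitInterval, Y) :=
  F.comp (σ.prodMap (ContinuousMap.id _))

lemma naturalHomotopy_homotopyFamily (F : C(X × unitInterval, Y)) :
    NaturalHomotopy (homotopyFamily F) := fun _ _ _ => rfl

/-- The map at time `u` of a homotopy. -/
def timeMap (F : C(X × unitInterval, Y)) (u : unitInterval) : C(X, Y) :=
  ⟨fun x => F (x, u), by fun_prop⟩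

lemma range_homotopyFamily_subset {F : C(X × unitInterval, Y)} {A : Set X} {B : Set Y}
    (h : ∀ x ∈ A, ∀ u, F (x, u) ∈ B) (k : ℕ) (σ : SingularSimplex k X) (hσ : Set.range σ ⊆ A) :
    Set.range (homotopyFamily F k σ) ⊆ B := by
  rintro _ ⟨⟨t, u⟩, rfl⟩
  exact h _ (hσ ⟨t, rfl⟩) u

lemma timeMap_sub_mem_relBoundaries {F : C(X × unitInterval, Y)} {A : Set X} {B : Set Y}
    (h : ∀ x ∈ A, ∀ u, F (x, u) ∈ B) {k : ℕ} {c : Chain ℝ k X} (hc : c ∈ relCycles ℝ A k) :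
    chainMap ℝ k (timeMap F 1) c - chainMap ℝ k (timeMap F 0) c ∈ relBoundaries ℝ B k :=
  homotopyAt_sub_mem_relBoundaries (naturalHomotopy_homotopyFamily F)
    (range_homotopyFamily_subset h) hc

/-- A contraction that preserves `A` shows that the relative homology of `(X, A)` vanishes. -/
lemma relCycles_le_relBoundaries_of_contraction {G : C(X × unitInterval, X)} {p : X}
    (hG : IsContraction G p) {A : Set X} (hA : ∀ x ∈ A, ∀ u, G (x, u) ∈ A) (hp : p ∈ A) (k : ℕ) :
    relCycles ℝ A k ≤ relBoundaries ℝ A k := by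
  intro z hz
  rw [mem_relBoundaries]
  cases k with
  | zero =>
    refine ⟨cone hG 0 z, _, single_mem_chainsIn (σ := ContinuousMap.const _ p) ?_ (augmentation z),
      ?_⟩
    · rintro _ ⟨t, rfl⟩
      exact hp
    · rw [boundary_cone_zero, sub_add_cancel]
  | succ k =>
    exact ⟨cone hG (k + 1) z, _, cone_mem_chainsIn hG hA hz, by rw [boundary_cone, sub_add_cancel]⟩

/-- Positive degree homology of a contractible space vanishes. -/
lemma relCycles_empty_le_relBoundaries {G : C(X × unitInterval, X)} {p : X}
    (hG : IsContraction G p) (k : ℕ) :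
    relCycles ℝ (∅ : Set X) (k + 1) ≤ relBoundaries ℝ (∅ : Set X) (k + 1) := by
  intro z hz
  rw [mem_relBoundaries]
  exact ⟨cone hG (k + 1) z, _, cone_mem_chainsIn hG (by simp) hz,
    by rw [boundary_cone, sub_add_cancel]⟩

end Prism

/-! ### Barycentric subdivision -/

section Subdivision

variable {X Y : Type*} [TopologicalSpace X] [TopologicalSpace Y]

/-- The barycentric subdivision of the standard simplex. -/
def sdChain : ∀ k, Chain ℝ k (stdSimplex ℝ (Fin (k + 1)))
  | 0 => Finsupp.single (ContinuousMap.id _) 1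
  | k + 1 => cone (isContraction_simplexContraction stdSimplex.barycenter) k
      (cofaceSum (fun _ => faceInclusion) k k (sdChain k))

lemma boundary_sdChain (k : ℕ) :
    boundary ℝ k _ (sdChain (k + 1)) = cofaceSum (fun _ => faceInclusion) k k (sdChain k) := by
  cases k with
  | zero =>
    rw [sdChain.eq_2, boundary_cone_zero]
    simp [cofaceSum_apply, sdChain, Fin.sum_univ_two, chainMap_single, augmentation_single]
  | succ k =>
    rw [sdChain.eq_2, boundary_cone,
      boundary_cofaceSum (E := fun k => stdSimplex ℝ (Fin (k + 1))) (fun _ => faceInclusion),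
      boundary_sdChain k, cofaceSum_cofaceSum (E := fun k => stdSimplex ℝ (Fin (k + 1)))
        (fun k i j h => faceInclusion_comp h), map_zero, sub_zero]

lemma exists_sdHomotopyChain : ∃ T : ∀ k, Chain ℝ (k + 1) (stdSimplex ℝ (Fin (k + 1))),
    boundary ℝ 0 _ (T 0) = sdChain 0 - Finsupp.single (ContinuousMap.id _) 1 ∧
      ∀ k, boundary ℝ (k + 1) _ (T (k + 1)) =
        sdChain (k + 1) - Finsupp.single (ContinuousMap.id _) 1 -
          cofaceSum (fun _ => faceInclusion) (k + 1) k (T k) := by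
  refine exists_model_homotopy (E := fun k => stdSimplex ℝ (Fin (k + 1)))
    (d := fun _ => faceInclusion) (fun k i j h => faceInclusion_comp h)
    (fun k => isContraction_simplexContraction stdSimplex.barycenter)
    (fun k => Finsupp.single (ContinuousMap.id _) 1) sdChain (fun k => ?_) boundary_sdChain rfl
  rw [boundary_single, cofaceSum_apply]
  refine Finset.sum_congr rfl fun i _ => ?_
  rw [chainMap_single]
  rfl

/-- The natural operator on chains given by a family of model chains. -/
def modelOp (m k : ℕ) (a : Chain ℝ m (stdSimplex ℝ (Fin (k + 1)))) :
    Chain ℝ k X →ₗ[ℝ] Chain ℝ m X :=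
  Finsupp.linearCombination ℝ fun σ => chainMap ℝ m σ a

lemma modelOp_single {m k : ℕ} (a : Chain ℝ m (stdSimplex ℝ (Fin (k + 1))))
    (σ : SingularSimplex k X) : modelOp m k a (Finsupp.single σ 1) = chainMap ℝ m σ a := by
  simp [modelOp]

lemma modelOp_mem_chainsIn {m k : ℕ} (a : Chain ℝ m (stdSimplex ℝ (Fin (k + 1)))) {A : Set X}
    {c : Chain ℝ k X} (hc : c ∈ chainsIn ℝ k A) : modelOp m k a c ∈ chainsIn ℝ m A := by
  suffices h : chainsIn ℝ k A ≤ (chainsIn ℝ m A).comap (modelOp m k a) from h hc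
  refine chainsIn_le fun σ hσ => ?_
  rw [Submodule.mem_comap, modelOp_single]
  exact chainMap_range_mem_chainsIn hσ _

/-- The barycentric subdivision operator. -/
def sd (k : ℕ) : Chain ℝ k X →ₗ[ℝ] Chain ℝ k X := modelOp k k (sdChain k)

/-- The natural chain homotopy between the identity and the barycentric subdivision. -/
def sdHomotopy (k : ℕ) : Chain ℝ k X →ₗ[ℝ] Chain ℝ (k + 1) X :=
  modelOp (k + 1) k (exists_sdHomotopyChain.choose k)

lemma modelOp_cofaceSum {m k : ℕ} (a : Chain ℝ m (stdSimplex ℝ (Fin (k + 1))))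
    (σ : SingularSimplex (k + 1) X) :
    chainMap ℝ m σ (cofaceSum (fun _ => faceInclusion) m k a) =
      modelOp m k a (boundary ℝ k X (Finsupp.single σ 1)) := by
  rw [boundary_single, map_sum, cofaceSum_apply, map_sum]
  refine Finset.sum_congr rfl fun i _ => ?_
  rw [map_smul, map_smul, modelOp_single, chainMap_comp]
  rfl

lemma linearMap_ext_single {k m : ℕ} {f g : Chain ℝ k X →ₗ[ℝ] Chain ℝ m Y}
    (h : ∀ σ, f (Finsupp.single σ 1) = g (Finsupp.single σ 1)) (c : Chain ℝ k X) : f c = g c :=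
  LinearMap.congr_fun (Finsupp.lhom_ext' fun σ => LinearMap.ext_ring (h σ)) c

lemma boundary_sd {k : ℕ} (c : Chain ℝ (k + 1) X) :
    boundary ℝ k X (sd (k + 1) c) = sd k (boundary ℝ k X c) := by
  refine linearMap_ext_single (f := boundary ℝ k X ∘ₗ sd (k + 1))
    (g := sd k ∘ₗ boundary ℝ k X) (fun σ => ?_) c
  simp only [LinearMap.comp_apply, sd, modelOp_single, boundary_chainMap, boundary_sdChain,
    modelOp_cofaceSum]

lemma boundary_sdHomotopy_zero (c : Chain ℝ 0 X) :
    boundary ℝ 0 X (sdHomotopy 0 c) = sd 0 c - c := by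
  refine linearMap_ext_single (f := boundary ℝ 0 X ∘ₗ sdHomotopy 0)
    (g := sd 0 - LinearMap.id) (fun σ => ?_) c
  simp only [LinearMap.comp_apply, sd, sdHomotopy, modelOp_single, boundary_chainMap,
    exists_sdHomotopyChain.choose_spec.1, LinearMap.sub_apply, map_sub, chainMap_single,
    LinearMap.id_apply]
  rfl

lemma boundary_sdHomotopy {k : ℕ} (c : Chain ℝ (k + 1) X) :
    boundary ℝ (k + 1) X (sdHomotopy (k + 1) c) =
      sd (k + 1) c - c - sdHomotopy k (boundary ℝ k X c) := by
  refine linearMap_ext_single (f := boundary ℝ (k + 1) X ∘ₗ sdHomotopy (k + 1))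
    (g := sd (k + 1) - LinearMap.id - sdHomotopy k ∘ₗ boundary ℝ k X) (fun σ => ?_) c
  simp only [LinearMap.comp_apply, sd, sdHomotopy, modelOp_single, boundary_chainMap,
    exists_sdHomotopyChain.choose_spec.2, LinearMap.sub_apply, map_sub, chainMap_single,
    LinearMap.id_apply, modelOp_cofaceSum]
  rfl

/-- An affine self-map of the standard simplex that shrinks all diameters by the factor `r`. All
seminorms are considered, so that the property is stable under affine changes of coordinates. -/
def IsShrinking {k : ℕ} (r : ℝ) (τ : C(stdSimplex ℝ (Fin (k + 1)), stdSimplex ℝ (Fin (k + 1)))) :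
    Prop :=
  (∃ A : (Fin (k + 1) → ℝ) →ₗ[ℝ] (Fin (k + 1) → ℝ), ∀ s, (τ s).1 = A s.1) ∧
    ∀ (N : Seminorm ℝ (Fin (k + 1) → ℝ)) (D : ℝ),
      (∀ x y : stdSimplex ℝ (Fin (k + 1)), N (x.1 - y.1) ≤ D) →
        ∀ s t, N ((τ s).1 - (τ t).1) ≤ r * D

lemma IsShrinking.comp {k : ℕ} {r r' : ℝ}
    {τ ρ : C(stdSimplex ℝ (Fin (k + 1)), stdSimplex ℝ (Fin (k + 1)))} (hτ : IsShrinking r τ)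
    (hρ : IsShrinking r' ρ) : IsShrinking (r' * r) (τ.comp ρ) := by
  obtain ⟨⟨A, hA⟩, hτ⟩ := hτ
  obtain ⟨⟨B, hB⟩, hρ⟩ := hρ
  refine ⟨⟨A ∘ₗ B, fun s => ?_⟩, fun N D hD s t => ?_⟩
  · rw [ContinuousMap.comp_apply, hA, hB]
    rfl
  · have := hρ (N.comp A) (r * D) (fun x y => by
      rw [Seminorm.comp_apply, map_sub, ← hA, ← hA]
      exact hτ N D hD x y) s t
    rw [Seminorm.comp_apply, map_sub, ← hA, ← hA] at this
    rw [mul_assoc]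
    exact this

/-- The barycentre of the `k`-simplex is within `k / (k + 1)` of the diameter of every point, for
any seminorm. This is the contraction factor of barycentric subdivision. -/
lemma seminorm_barycenter_sub_le {k : ℕ} (N : Seminorm ℝ (Fin (k + 1) → ℝ)) {D : ℝ}
    (hD : ∀ x y : stdSimplex ℝ (Fin (k + 1)), N (x.1 - y.1) ≤ D)
    (y : stdSimplex ℝ (Fin (k + 1))) :
    N ((stdSimplex.barycenter : stdSimplex ℝ (Fin (k + 1))).1 - y.1) ≤ k / (k + 1) * D := by
  have hk : (0 : ℝ) < k + 1 := by positivity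
  have hv : ∀ j : Fin (k + 1), N ((stdSimplex.barycenter : stdSimplex ℝ (Fin (k + 1))).1 -
      Pi.single j 1) ≤ k / (k + 1) * D := by
    intro j
    have e : (stdSimplex.barycenter : stdSimplex ℝ (Fin (k + 1))).1 - Pi.single j 1 =
        (1 / (k + 1) : ℝ) • ∑ l ∈ Finset.univ.erase j, (Pi.single l 1 - Pi.single j 1) := by
      have h1 : ∑ l ∈ Finset.univ.erase j, ((Pi.single l 1 : Fin (k + 1) → ℝ) - Pi.single j 1) =
          ∑ l, ((Pi.single l 1 : Fin (k + 1) → ℝ) - Pi.single j 1) := by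
        rw [← Finset.add_sum_erase _ _ (Finset.mem_univ j), sub_self, zero_add]
      rw [h1, Finset.sum_sub_distrib]
      funext i
      have : (stdSimplex.barycenter : stdSimplex ℝ (Fin (k + 1))).1 i = 1 / (k + 1) := by
        have := stdSimplex.barycenter_apply (𝕜 := ℝ) i
        simp
      simp only [Pi.sub_apply, this, Pi.smul_apply, Finset.sum_apply, Finset.sum_const,
        Finset.card_univ, Fintype.card_fin, smul_eq_mul, nsmul_eq_mul]
      simp only [Pi.single_apply, Finset.sum_ite_eq, Finset.mem_univ, if_true]
      simp only [Pi.mul_apply, Pi.natCast_apply, Pi.single_apply]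
      field_simp
      push_cast
      ring
    rw [e, map_smul_eq_mul, Real.norm_of_nonneg (by positivity)]
    have h2 : N (∑ l ∈ Finset.univ.erase j, ((Pi.single l 1 : Fin (k + 1) → ℝ) - Pi.single j 1)) ≤
        ∑ l ∈ Finset.univ.erase j, D := by
      refine (Finset.le_sum_of_subadditive N (map_zero N).le (map_add_le_add N) _ _).trans
        (Finset.sum_le_sum fun l _ => ?_)
      exact hD ⟨_, single_mem_stdSimplex ℝ l⟩ ⟨_, single_mem_stdSimplex ℝ j⟩
    rw [Finset.sum_const, Finset.card_erase_of_mem (Finset.mem_univ j), Finset.card_univ,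
      Fintype.card_fin, Nat.add_sub_cancel, nsmul_eq_mul] at h2
    calc 1 / ((k : ℝ) + 1) * _ ≤ 1 / (k + 1) * (k * D) :=
          mul_le_mul_of_nonneg_left h2 (by positivity)
      _ = k / (k + 1) * D := by ring
  set b := (stdSimplex.barycenter : stdSimplex ℝ (Fin (k + 1))).1
  have e : b - y.1 = ∑ j, y.1 j • (b - Pi.single j 1) := by
    simp only [smul_sub, Finset.sum_sub_distrib, ← Finset.sum_smul, y.2.2, one_smul]
    congr 1
    funext i
    simp [Finset.sum_apply, Pi.single_apply]
  rw [e]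
  calc N (∑ j, y.1 j • (b - Pi.single j 1)) ≤ ∑ j, N (y.1 j • (b - Pi.single j 1)) :=
        Finset.le_sum_of_subadditive N (map_zero N).le (map_add_le_add N) _ _
    _ ≤ ∑ j, y.1 j * (k / (k + 1) * D) := by
        refine Finset.sum_le_sum fun j _ => ?_
        rw [map_smul_eq_mul, Real.norm_of_nonneg (y.2.1 j)]
        exact mul_le_mul_of_nonneg_left (hv j) (y.2.1 j)
    _ = k / (k + 1) * D := by rw [← Finset.sum_mul, y.2.2, one_mul]

/-- The step of the diameter estimate: the cone from the barycenter over a simplex in the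
boundary. -/
lemma isShrinking_coneSimplex {k : ℕ} (i : Fin (k + 2))
    {τ : C(stdSimplex ℝ (Fin (k + 1)), stdSimplex ℝ (Fin (k + 1)))}
    (hτ : IsShrinking (k / (k + 1)) τ) :
    IsShrinking ((k + 1 : ℕ) / ((k + 1 : ℕ) + 1))
      (coneSimplex (isContraction_simplexContraction stdSimplex.barycenter)
        ((faceInclusion i).comp τ)) := by
  obtain ⟨⟨A, hA⟩, hτ⟩ := hτ
  let b : stdSimplex ℝ (Fin (k + 2)) := stdSimplex.barycenter
  let ι : (Fin (k + 1) → ℝ) →ₗ[ℝ] (Fin (k + 2) → ℝ) := FunOnFinite.linearMap ℝ ℝ i.succAbove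
  have hι : ∀ t, (faceInclusion i t).1 = ι t.1 := fun t => rfl
  have hc : ∀ s u, (coneSimplex (isContraction_simplexContraction b)
      ((faceInclusion i).comp τ) (joinVertex k (s, u))).1 =
      (1 - (u : ℝ)) • ι (A s.1) + (u : ℝ) • b.1 := by
    intro s u
    rw [coneSimplex_joinVertex, ← hA, ← hι]
    rfl
  refine ⟨⟨ι ∘ₗ A ∘ₗ LinearMap.pi (fun j : Fin (k + 1) => LinearMap.proj j.succ) +
    (LinearMap.proj (0 : Fin (k + 2))).smulRight b.1, fun t => ?_⟩, fun N D hD => ?_⟩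
  · obtain ⟨⟨s, u⟩, rfl⟩ := joinVertex_surjective k t
    rw [hc, ← map_smul, ← map_smul]
    rfl
  · have hD0 : 0 ≤ D := (apply_nonneg N _).trans (hD b b)
    set l : ℝ := (k + 1 : ℕ) / ((k + 1 : ℕ) + 1) with hl
    have hl' : (k : ℝ) / (k + 1) ≤ l := by
      rw [hl]
      push_cast
      rw [div_le_div_iff₀ (by positivity) (by positivity)]
      nlinarith
    have key : ∀ (s s' : stdSimplex ℝ (Fin (k + 1))) (u u' : unitInterval), u' ≤ u →
        N (((1 - (u : ℝ)) • ι (A s.1) + (u : ℝ) • b.1) -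
          ((1 - (u' : ℝ)) • ι (A s'.1) + (u' : ℝ) • b.1)) ≤ l * D := by
      intro s s' u u' hu
      have hu' : (u' : ℝ) ≤ u := hu
      have e : ((1 - (u : ℝ)) • ι (A s.1) + (u : ℝ) • b.1) -
          ((1 - (u' : ℝ)) • ι (A s'.1) + (u' : ℝ) • b.1) =
          (1 - (u : ℝ)) • (ι (A s.1) - ι (A s'.1)) + ((u : ℝ) - u') • (b.1 - ι (A s'.1)) := by
        module
      have h1 : N (ι (A s.1) - ι (A s'.1)) ≤ l * D := by
        have := hτ (N.comp ι) D (fun x y => by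
          rw [Seminorm.comp_apply, map_sub, ← hι, ← hι]
          exact hD _ _) s s'
        rw [Seminorm.comp_apply, map_sub, hA, hA] at this
        exact this.trans (mul_le_mul_of_nonneg_right hl' hD0)
      have h2 : N (b.1 - ι (A s'.1)) ≤ l * D := by
        have := seminorm_barycenter_sub_le N hD (faceInclusion i (τ s'))
        rwa [hι, hA] at this
      have hlD : 0 ≤ l * D := (apply_nonneg N _).trans h1
      rw [e]
      refine (map_add_le_add N _ _).trans ?_
      rw [map_smul_eq_mul, map_smul_eq_mul, Real.norm_of_nonneg (sub_nonneg.2 u.2.2),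
        Real.norm_of_nonneg (sub_nonneg.2 hu')]
      have := u'.2.1
      have := mul_le_mul_of_nonneg_left h1 (sub_nonneg.2 u.2.2)
      have := mul_le_mul_of_nonneg_left h2 (sub_nonneg.2 hu')
      nlinarith [mul_nonneg u'.2.1 hlD]
    intro t t'
    obtain ⟨⟨s, u⟩, rfl⟩ := joinVertex_surjective k t
    obtain ⟨⟨s', u'⟩, rfl⟩ := joinVertex_surjective k t'
    rw [hc, hc]
    rcases le_total u' u with h | h
    · exact key s s' u u' h
    · rw [map_sub_rev]
      exact key s' s u' u h

lemma sdChain_mem_supported (k : ℕ) :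
    sdChain k ∈ Finsupp.supported ℝ ℝ {τ | IsShrinking ((k : ℝ) / (k + 1)) τ} := by
  induction k with
  | zero =>
    refine Finsupp.single_mem_supported ℝ 1 ⟨⟨LinearMap.id, fun s => rfl⟩, fun N D hD s t => ?_⟩
    rw [Subsingleton.elim s t]
    simp
  | succ k ih =>
    rw [sdChain.eq_2, cofaceSum_apply, map_sum]
    refine Submodule.sum_mem _ fun i _ => ?_
    rw [map_smul]
    refine Submodule.smul_mem _ _ ?_
    suffices h : Finsupp.supported ℝ ℝ {τ | IsShrinking ((k : ℝ) / (k + 1)) τ} ≤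
        (Finsupp.supported ℝ ℝ {τ | IsShrinking (((k + 1 : ℕ) : ℝ) / ((k + 1 : ℕ) + 1)) τ}).comap
          (cone (isContraction_simplexContraction stdSimplex.barycenter) k ∘ₗ
            chainMap ℝ k (faceInclusion i)) from h ih
    rw [Finsupp.supported_eq_span_single, Submodule.span_le]
    rintro _ ⟨τ, hτ, rfl⟩
    rw [SetLike.mem_coe, Submodule.mem_comap, LinearMap.comp_apply, chainMap_single, cone_single]
    exact Finsupp.single_mem_supported ℝ 1 (isShrinking_coneSimplex i hτ)

/-- The simplices of the iterated barycentric subdivisions shrink geometrically. -/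
lemma sd_iterate_mem_supported {k : ℕ} (σ : SingularSimplex k X) (m : ℕ) :
    (sd k)^[m] (Finsupp.single σ 1) ∈ Finsupp.supported ℝ ℝ
      ((fun τ => σ.comp τ) '' {τ | IsShrinking (((k : ℝ) / (k + 1)) ^ m) τ}) := by
  induction m with
  | zero =>
    refine Finsupp.single_mem_supported ℝ 1 ⟨ContinuousMap.id _,
      ⟨⟨LinearMap.id, fun s => rfl⟩, fun N D hD s t => ?_⟩, ContinuousMap.comp_id σ⟩
    rw [pow_zero, one_mul]
    exact hD s t
  | succ m ih =>
    rw [Function.iterate_succ_apply']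
    suffices h : Finsupp.supported ℝ ℝ
        ((fun τ => σ.comp τ) '' {τ | IsShrinking (((k : ℝ) / (k + 1)) ^ m) τ}) ≤
        (Finsupp.supported ℝ ℝ
          ((fun τ => σ.comp τ) '' {τ | IsShrinking (((k : ℝ) / (k + 1)) ^ (m + 1)) τ})).comap
          (sd k) from h ih
    rw [Finsupp.supported_eq_span_single, Submodule.span_le]
    rintro _ ⟨_, ⟨τ, hτ, rfl⟩, rfl⟩
    rw [SetLike.mem_coe, Submodule.mem_comap, sd, modelOp_single]
    suffices h : Finsupp.supported ℝ ℝ {τ | IsShrinking ((k : ℝ) / (k + 1)) τ} ≤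
        (Finsupp.supported ℝ ℝ
          ((fun τ => σ.comp τ) '' {τ | IsShrinking (((k : ℝ) / (k + 1)) ^ (m + 1)) τ})).comap
          (chainMap ℝ k (σ.comp τ)) from h (sdChain_mem_supported k)
    rw [Finsupp.supported_eq_span_single ℝ {τ | IsShrinking _ τ}, Submodule.span_le]
    rintro _ ⟨ρ, hρ, rfl⟩
    rw [SetLike.mem_coe, Submodule.mem_comap, chainMap_single]
    refine Finsupp.single_mem_supported ℝ 1 ⟨τ.comp ρ, ?_, rfl⟩
    rw [pow_succ']
    exact hτ.comp hρ

/-- Fine subdivisions of a chain of `U ∪ W` are sums of a chain of `U` and a chain of `W`. -/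
lemma eventually_sd_iterate_mem {U W : Set X} (hU : IsOpen U) (hW : IsOpen W) {k : ℕ}
    {c : Chain ℝ k X} (hc : c ∈ chainsIn ℝ k (U ∪ W)) :
    ∀ᶠ m in Filter.atTop, (sd k)^[m] c ∈ chainsIn ℝ k U ⊔ chainsIn ℝ k W := by
  let S : Submodule ℝ (Chain ℝ k X) :=
    { carrier := {c | ∀ᶠ m in Filter.atTop, (sd k)^[m] c ∈ chainsIn ℝ k U ⊔ chainsIn ℝ k W}
      zero_mem' := by
        refine Filter.Eventually.of_forall fun m => ?_
        rw [iterate_map_zero]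
        exact Submodule.zero_mem _
      add_mem' := by
        intro a b ha hb
        filter_upwards [ha, hb] with m h1 h2
        rw [iterate_map_add]
        exact Submodule.add_mem _ h1 h2
      smul_mem' := by
        intro r a ha
        filter_upwards [ha] with m h1
        rw [← Module.End.pow_apply, map_smul, Module.End.pow_apply]
        exact Submodule.smul_mem _ _ h1 }
  suffices h : chainsIn ℝ k (U ∪ W) ≤ S from h hc
  refine chainsIn_le fun σ hσ => ?_
  obtain ⟨δ, hδ, hcover⟩ := lebesgue_number_lemma_of_metric (s := Set.univ)
    (c := fun b : Bool => σ ⁻¹' (if b then U else W)) isCompact_univ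
    (fun b => by cases b <;> simp [hU.preimage σ.continuous, hW.preimage σ.continuous])
    (fun t _ => by
      rcases hσ ⟨t, rfl⟩ with h | h
      · exact Set.mem_iUnion.2 ⟨true, by simpa using h⟩
      · exact Set.mem_iUnion.2 ⟨false, by simpa using h⟩)
  have hlim : Filter.Tendsto (fun m : ℕ => ((k : ℝ) / (k + 1)) ^ m) Filter.atTop (𝓝 0) :=
    tendsto_pow_atTop_nhds_zero_of_lt_one (by positivity)
      ((div_lt_one (by positivity)).2 (lt_add_one _))
  change ∀ᶠ m in Filter.atTop, (sd k)^[m] (Finsupp.single σ 1) ∈ chainsIn ℝ k U ⊔ chainsIn ℝ k W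
  filter_upwards [hlim.eventually (gt_mem_nhds hδ)] with m hm
  suffices h : Finsupp.supported ℝ ℝ
      ((fun τ => σ.comp τ) '' {τ | IsShrinking (((k : ℝ) / (k + 1)) ^ m) τ}) ≤
      chainsIn ℝ k U ⊔ chainsIn ℝ k W from h (sd_iterate_mem_supported σ m)
  rw [Finsupp.supported_eq_span_single, Submodule.span_le]
  rintro _ ⟨_, ⟨τ, hτ, rfl⟩, rfl⟩
  obtain ⟨b, hb⟩ := hcover (τ (Classical.arbitrary _)) trivial
  have hr : Set.range (σ.comp τ) ⊆ if b then U else W := by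
    rintro _ ⟨t, rfl⟩
    refine hb (a := τ t) ?_
    have h1 := hτ.2 (normSeminorm ℝ _) 1 (fun x y => by
      rw [coe_normSeminorm, pi_norm_le_iff_of_nonneg zero_le_one]
      intro i
      have := x.2.1 i
      have := y.2.1 i
      have := stdSimplex.le_one x i
      have := stdSimplex.le_one y i
      rw [Real.norm_eq_abs, abs_le, Pi.sub_apply]
      constructor <;> [skip; skip] <;> change _ ≤ (_ : ℝ) <;>
        (have h0 : x.1 i = x i := rfl; have h0' : y.1 i = y i := rfl; linarith))
      t (Classical.arbitrary _)
    rw [Metric.mem_ball, Subtype.dist_eq, dist_eq_norm]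
    rw [coe_normSeminorm, mul_one] at h1
    exact h1.trans_lt hm
  cases b
  · exact Submodule.mem_sup_right (single_mem_chainsIn (by simpa using hr) 1)
  · exact Submodule.mem_sup_left (single_mem_chainsIn (by simpa using hr) 1)

/-- The subdivision theorem, in the form of a natural chain map `S`, naturally chain homotopic to
the identity, that makes a given chain small. -/
lemma exists_subdivision {U W : Set X} (hU : IsOpen U) (hW : IsOpen W) {k : ℕ}
    {c : Chain ℝ k X} (hc : c ∈ chainsIn ℝ k (U ∪ W)) :
    ∃ (S : ∀ k, Chain ℝ k X →ₗ[ℝ] Chain ℝ k X) (D : ∀ k, Chain ℝ k X →ₗ[ℝ] Chain ℝ (k + 1) X),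
      (∀ k c, boundary ℝ k X (S (k + 1) c) = S k (boundary ℝ k X c)) ∧
      (∀ c, boundary ℝ 0 X (D 0 c) = S 0 c - c) ∧
      (∀ k c, boundary ℝ (k + 1) X (D (k + 1) c) = S (k + 1) c - c - D k (boundary ℝ k X c)) ∧
      (∀ A k c, c ∈ chainsIn ℝ k A → S k c ∈ chainsIn ℝ k A) ∧
      (∀ A k c, c ∈ chainsIn ℝ k A → D k c ∈ chainsIn ℝ (k + 1) A) ∧
      S k c ∈ chainsIn ℝ k U ⊔ chainsIn ℝ k W := by
  obtain ⟨m, hm⟩ := (eventually_sd_iterate_mem hU hW hc).exists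
  suffices h : ∃ (D : ∀ k, Chain ℝ k X →ₗ[ℝ] Chain ℝ (k + 1) X),
      (∀ k c, boundary ℝ k X ((sd (k + 1) ^ m) c) = (sd k ^ m) (boundary ℝ k X c)) ∧
      (∀ c, boundary ℝ 0 X (D 0 c) = (sd 0 ^ m) c - c) ∧
      (∀ k c, boundary ℝ (k + 1) X (D (k + 1) c) =
        (sd (k + 1) ^ m) c - c - D k (boundary ℝ k X c)) ∧
      (∀ A k c, c ∈ chainsIn ℝ k A → (sd k ^ m) c ∈ chainsIn ℝ k A) ∧
      (∀ A k c, c ∈ chainsIn ℝ k A → D k c ∈ chainsIn ℝ (k + 1) A) by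
    obtain ⟨D, h1, h2, h3, h4, h5⟩ := h
    exact ⟨fun k => sd k ^ m, D, h1, h2, h3, h4, h5, by rwa [Module.End.pow_apply]⟩
  clear hm
  induction m with
  | zero => exact ⟨fun k => 0, by simp, by simp, by simp, by simp, by simp⟩
  | succ m ih =>
    obtain ⟨D, h1, h2, h3, h4, h5⟩ := ih
    refine ⟨fun k => D k + sdHomotopy k ∘ₗ (sd k ^ m), fun k c => ?_, fun c => ?_, fun k c => ?_,
      fun A k c hc => ?_, fun A k c hc => ?_⟩
    · rw [pow_succ', pow_succ', Module.End.mul_apply, Module.End.mul_apply, boundary_sd, h1]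
    · rw [pow_succ', Module.End.mul_apply, LinearMap.add_apply, map_add, h2, LinearMap.comp_apply,
        boundary_sdHomotopy_zero]
      abel
    · rw [pow_succ', Module.End.mul_apply, LinearMap.add_apply, map_add, h3, LinearMap.comp_apply,
        boundary_sdHomotopy, LinearMap.add_apply, LinearMap.comp_apply, h1]
      abel
    · rw [pow_succ', Module.End.mul_apply]
      exact modelOp_mem_chainsIn _ (h4 A k c hc)
    · exact Submodule.add_mem _ (h5 A k c hc) (modelOp_mem_chainsIn _ (h4 A k c hc))

end Subdivision

/-! ### Mayer–Vietoris and excision for local homology -/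

section LocalHomology

variable {X Y : Type*} [TopologicalSpace X] [TopologicalSpace Y]

/-- The relative homology `H_k(X, X ∖ K)` vanishes. -/
def LocalHomologyVanishes (K : Set X) (k : ℕ) : Prop :=
  relCycles ℝ Kᶜ k ≤ relBoundaries ℝ Kᶜ k

lemma mem_relCycles_succ {k : ℕ} {A : Set X} {z : Chain ℝ (k + 1) X} :
    z ∈ relCycles ℝ A (k + 1) ↔ boundary ℝ k X z ∈ chainsIn ℝ k A := Iff.rfl

/-- The union of the images of the simplices of a chain. -/
def carrier {k : ℕ} (c : Chain ℝ k X) : Set X := ⋃ σ ∈ c.support, Set.range σ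

lemma isCompact_carrier {k : ℕ} (c : Chain ℝ k X) : IsCompact (carrier c) :=
  c.support.finite_toSet.isCompact_biUnion fun σ _ => isCompact_range σ.continuous

lemma mem_chainsIn_iff_carrier {k : ℕ} {c : Chain ℝ k X} {A : Set X} :
    c ∈ chainsIn ℝ k A ↔ carrier c ⊆ A := by
  rw [chainsIn, Finsupp.mem_supported, carrier, Set.iUnion₂_subset_iff]
  rfl

/-- Exactness of the Mayer–Vietoris sequence at `H_k(X, X ∖ (A ∪ B))`. -/
lemma mem_relBoundaries_compl_union {A B : Set X} (hA : IsClosed A) (hB : IsClosed B) {k : ℕ}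
    (hAB : LocalHomologyVanishes (A ∩ B) (k + 1)) {z : Chain ℝ k X}
    (h1 : z ∈ relBoundaries ℝ Aᶜ k) (h2 : z ∈ relBoundaries ℝ Bᶜ k) :
    z ∈ relBoundaries ℝ (A ∪ B)ᶜ k := by
  obtain ⟨u, a, ha, hu⟩ := mem_relBoundaries.1 h1
  obtain ⟨v, b, hb, hv⟩ := mem_relBoundaries.1 h2
  have huv : boundary ℝ k X (u - v) = b - a := by
    rw [map_sub, sub_eq_sub_iff_add_eq_add, ← hu, hv, add_comm]
  have hsub : (A ∩ B)ᶜ = Aᶜ ∪ Bᶜ := Set.compl_inter A B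
  have hcyc : u - v ∈ relCycles ℝ (A ∩ B)ᶜ (k + 1) := by
    rw [mem_relCycles_succ, huv, hsub]
    exact Submodule.sub_mem _ (chainsIn_mono Set.subset_union_right hb)
      (chainsIn_mono Set.subset_union_left ha)
  obtain ⟨w, e, he, hwe⟩ := mem_relBoundaries.1 (hAB hcyc)
  rw [hsub] at he
  have hbe : boundary ℝ k X e = b - a := by
    rw [← huv, hwe, map_add, boundary_boundary, zero_add]
  obtain ⟨S, D, -, -, hD, -, hDA, hS⟩ := exists_subdivision hA.isOpen_compl hB.isOpen_compl he
  obtain ⟨eA, heA, eB, heB, hSe⟩ := Submodule.mem_sup.1 hS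
  have hkey : b + boundary ℝ k X (D k b) - boundary ℝ k X eB =
      a + boundary ℝ k X (D k a) + boundary ℝ k X eA := by
    have h := congr_arg (boundary ℝ k X) (hD k e)
    rw [boundary_boundary, ← hSe, hbe] at h
    simp only [map_sub, map_add, hbe] at h
    have h' : b + boundary ℝ k X (D k b) - boundary ℝ k X eB -
        (a + boundary ℝ k X (D k a) + boundary ℝ k X eA) = -0 := by
      rw [h]
      abel
    rw [← sub_eq_zero, h', neg_zero]
  refine mem_relBoundaries.2 ⟨u - D k a - eA, a + boundary ℝ k X (D k a) + boundary ℝ k X eA,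
    ?_, ?_⟩
  · rw [Set.compl_union]
    refine mem_chainsIn_inter ?_ ?_
    · exact Submodule.add_mem _ (Submodule.add_mem _ ha (boundary_mem_chainsIn (hDA _ _ _ ha)))
        (boundary_mem_chainsIn heA)
    · rw [← hkey]
      exact Submodule.sub_mem _ (Submodule.add_mem _ hb (boundary_mem_chainsIn (hDA _ _ _ hb)))
        (boundary_mem_chainsIn heB)
  · rw [hu, map_sub, map_sub]
    abel

/-- Subdivision does not change relative homology classes. -/
lemma subdivision_sub_mem {S : ∀ k, Chain ℝ k X →ₗ[ℝ] Chain ℝ k X}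
    {D : ∀ k, Chain ℝ k X →ₗ[ℝ] Chain ℝ (k + 1) X}
    (h0 : ∀ c, boundary ℝ 0 X (D 0 c) = S 0 c - c)
    (h : ∀ k c, boundary ℝ (k + 1) X (D (k + 1) c) = S (k + 1) c - c - D k (boundary ℝ k X c))
    (hDA : ∀ A k c, c ∈ chainsIn ℝ k A → D k c ∈ chainsIn ℝ (k + 1) A) {A : Set X} {k : ℕ}
    {z : Chain ℝ k X} (hz : z ∈ relCycles ℝ A k) :
    S k z - z - boundary ℝ k X (D k z) ∈ chainsIn ℝ k A := by
  cases k with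
  | zero =>
    rw [h0, sub_self]
    exact Submodule.zero_mem _
  | succ k =>
    rw [h, sub_sub_cancel]
    exact hDA _ _ _ hz

/-- Exactness of the Mayer–Vietoris sequence at `H_{k+1}(X, X ∖ (A ∩ B))`, in the case of vanishing
outer terms. -/
lemma LocalHomologyVanishes.inter {A B : Set X} (hA : IsClosed A) (hB : IsClosed B) {k : ℕ}
    (hAB : LocalHomologyVanishes (A ∪ B) k) (hvA : LocalHomologyVanishes A (k + 1))
    (hvB : LocalHomologyVanishes B (k + 1)) : LocalHomologyVanishes (A ∩ B) (k + 1) := by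
  intro z hz
  have hz' : boundary ℝ k X z ∈ chainsIn ℝ k (Aᶜ ∪ Bᶜ) := by
    rw [← Set.compl_inter]
    exact hz
  obtain ⟨S, D, hSb, hD0, hD, hSA, hDA, hS⟩ :=
    exists_subdivision hA.isOpen_compl hB.isOpen_compl hz'
  obtain ⟨eA, heA, eB, heB, hSe⟩ := Submodule.mem_sup.1 hS
  have hcyc : eA ∈ relCycles ℝ (A ∪ B)ᶜ k := by
    cases k with
    | zero => trivial
    | succ k =>
      rw [mem_relCycles_succ, Set.compl_union]
      refine mem_chainsIn_inter (boundary_mem_chainsIn heA) ?_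
      have : boundary ℝ k X eA = - boundary ℝ k X eB := by
        rw [eq_neg_iff_add_eq_zero, ← map_add, hSe, hSb, boundary_boundary, map_zero]
      rw [this]
      exact Submodule.neg_mem _ (boundary_mem_chainsIn heB)
  obtain ⟨w, q, hq, hw⟩ := mem_relBoundaries.1 (hAB hcyc)
  rw [Set.compl_union] at hq
  have hqA := chainsIn_mono Set.inter_subset_left hq
  have hqB := chainsIn_mono Set.inter_subset_right hq
  have h1 : w ∈ relBoundaries ℝ Aᶜ (k + 1) := by
    refine hvA ?_
    rw [mem_relCycles_succ, eq_sub_of_add_eq hw.symm]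
    exact Submodule.sub_mem _ heA hqA
  have h2 : S (k + 1) z - w ∈ relBoundaries ℝ Bᶜ (k + 1) := by
    refine hvB ?_
    have : boundary ℝ k X (S (k + 1) z - w) = eB + q := by
      rw [map_sub, hSb, ← hSe, eq_sub_of_add_eq hw.symm]
      abel
    rw [mem_relCycles_succ, this]
    exact Submodule.add_mem _ heB hqB
  have h3 := subdivision_sub_mem hD0 hD hDA hz
  have e : z = (S (k + 1) z - w) + w - (boundary ℝ (k + 1) X (D (k + 1) z) +
      (S (k + 1) z - z - boundary ℝ (k + 1) X (D (k + 1) z))) := by abel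
  rw [e]
  refine Submodule.sub_mem _ (Submodule.add_mem _
    (relBoundaries_mono (Set.compl_subset_compl.2 Set.inter_subset_right) h2)
    (relBoundaries_mono (Set.compl_subset_compl.2 Set.inter_subset_left) h1))
    (Submodule.add_mem _ (boundary_mem_relBoundaries _) (chainsIn_le_relBoundaries h3))

/-! #### Excision -/

lemma chainMap_injective {j : C(X, Y)} (hj : Function.Injective j) (k : ℕ) :
    Function.Injective (chainMap ℝ k j) := by
  refine Finsupp.mapDomain_injective fun σ τ h => ContinuousMap.ext fun t => hj ?_
  exact DFunLike.congr_fun h t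

lemma exists_chainMap_eq {j : C(X, Y)} (hj : Topology.IsEmbedding j) {k : ℕ} {c : Chain ℝ k Y}
    (hc : c ∈ chainsIn ℝ k (Set.range j)) : ∃ c', chainMap ℝ k j c' = c := by
  suffices h : chainsIn ℝ k (Set.range j) ≤ LinearMap.range (chainMap ℝ k j) from h hc
  refine chainsIn_le fun σ hσ => ?_
  let e := hj.toHomeomorph
  let σ' : SingularSimplex k X := ⟨fun t => e.symm ⟨σ t, hσ ⟨t, rfl⟩⟩, by fun_prop⟩
  refine ⟨Finsupp.single σ' 1, ?_⟩
  rw [chainMap_single]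
  congr 1
  ext1 t
  have : e (σ' t) = ⟨σ t, hσ ⟨t, rfl⟩⟩ := e.apply_symm_apply _
  exact congr_arg Subtype.val this

lemma mem_chainsIn_preimage {j : C(X, Y)} (hj : Function.Injective j) {k : ℕ} {c : Chain ℝ k X}
    {A : Set Y} (hc : chainMap ℝ k j c ∈ chainsIn ℝ k A) : c ∈ chainsIn ℝ k (j ⁻¹' A) := by
  classical
  rw [chainsIn, Finsupp.mem_supported] at hc ⊢
  intro σ hσ
  have hinj : Function.Injective fun σ : SingularSimplex k X => j.comp σ :=
    fun σ τ h => ContinuousMap.ext fun t => hj (DFunLike.congr_fun h t)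
  have h : j.comp σ ∈ (chainMap ℝ k j c).support := by
    rw [chainMap, Finsupp.lmapDomain_apply, Finsupp.mem_support_iff,
      Finsupp.mapDomain_apply hinj]
    exact Finsupp.mem_support_iff.1 hσ
  rintro _ ⟨t, rfl⟩
  exact hc h ⟨t, rfl⟩

lemma mem_relCycles_preimage {j : C(X, Y)} (hj : Function.Injective j) {k : ℕ} {c : Chain ℝ k X}
    {A : Set Y} (hc : chainMap ℝ k j c ∈ relCycles ℝ A k) : c ∈ relCycles ℝ (j ⁻¹' A) k := by
  cases k with
  | zero => trivial
  | succ k =>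
    rw [mem_relCycles_succ, boundary_chainMap] at hc
    exact mem_chainsIn_preimage hj hc

variable {j : C(X, Y)} {K : Set Y}

/-- Injectivity part of excision. -/
lemma mem_relBoundaries_of_chainMap (hj : Topology.IsOpenEmbedding j) (hK : IsClosed K)
    (hKj : K ⊆ Set.range j) {k : ℕ} {z : Chain ℝ k X}
    (hz : chainMap ℝ k j z ∈ relBoundaries ℝ Kᶜ k) : z ∈ relBoundaries ℝ (j ⁻¹' K)ᶜ k := by
  obtain ⟨u, a, ha, hu⟩ := mem_relBoundaries.1 hz
  have hcover : Set.range j ∪ Kᶜ = Set.univ :=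
    Set.eq_univ_of_forall fun y => (em (y ∈ K)).imp (fun h => hKj h) id
  obtain ⟨S, D, hSb, hD0, hD, hSA, hDA, hS⟩ := exists_subdivision (c := u) hj.isOpen_range
    hK.isOpen_compl (by rw [hcover, chainsIn_univ]; trivial)
  obtain ⟨v, hv, w, hw, hvw⟩ := Submodule.mem_sup.1 hS
  have hzr : chainMap ℝ k j z ∈ chainsIn ℝ k (Set.range j) :=
    chainMap_range_mem_chainsIn subset_rfl z
  have h1 := hDA _ _ _ hzr
  obtain ⟨v', hv'⟩ := exists_chainMap_eq hj.isEmbedding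
    (Submodule.sub_mem _ hv h1 : v - D k (chainMap ℝ k j z) ∈ _)
  let q := chainMap ℝ k j z - boundary ℝ k Y (v - D k (chainMap ℝ k j z))
  have hq1 : q ∈ chainsIn ℝ k (Set.range j) :=
    Submodule.sub_mem _ hzr (boundary_mem_chainsIn (Submodule.sub_mem _ hv h1))
  have hq2 : q ∈ chainsIn ℝ k Kᶜ := by
    have h3 := subdivision_sub_mem hD0 hD hDA (relBoundaries_le_relCycles hz)
    have h4 : S k (chainMap ℝ k j z) = boundary ℝ k Y v + boundary ℝ k Y w + S k a := by
      rw [hu, map_add, ← hSb, ← hvw, map_add]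
    have e : q = boundary ℝ k Y w + S k a -
        (S k (chainMap ℝ k j z) - chainMap ℝ k j z -
          boundary ℝ k Y (D k (chainMap ℝ k j z))) := by
      simp only [q, h4, map_sub]
      abel
    rw [e]
    exact Submodule.sub_mem _ (Submodule.add_mem _ (boundary_mem_chainsIn hw) (hSA _ _ _ ha)) h3
  obtain ⟨q', hq'⟩ := exists_chainMap_eq hj.isEmbedding hq1
  refine mem_relBoundaries.2 ⟨v', q', mem_chainsIn_preimage hj.injective (by rwa [hq']), ?_⟩
  apply chainMap_injective hj.injective k
  rw [map_add, ← boundary_chainMap, hv', hq']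
  simp only [q]
  abel

/-- Surjectivity part of excision. -/
lemma exists_sub_chainMap_mem_relBoundaries (hj : Topology.IsOpenEmbedding j) (hK : IsClosed K)
    (hKj : K ⊆ Set.range j) {k : ℕ} {z : Chain ℝ k Y} (hz : z ∈ relCycles ℝ Kᶜ k) :
    ∃ z' ∈ relCycles ℝ (j ⁻¹' K)ᶜ k, z - chainMap ℝ k j z' ∈ relBoundaries ℝ Kᶜ k := by
  have hcover : Set.range j ∪ Kᶜ = Set.univ :=
    Set.eq_univ_of_forall fun y => (em (y ∈ K)).imp (fun h => hKj h) id
  obtain ⟨S, D, hSb, hD0, hD, hSA, hDA, hS⟩ := exists_subdivision (c := z) hj.isOpen_range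
    hK.isOpen_compl (by rw [hcover, chainsIn_univ]; trivial)
  obtain ⟨v, hv, w, hw, hvw⟩ := Submodule.mem_sup.1 hS
  obtain ⟨v', hv'⟩ := exists_chainMap_eq hj.isEmbedding hv
  have hmem : z - chainMap ℝ k j v' ∈ relBoundaries ℝ Kᶜ k := by
    have h3 := subdivision_sub_mem hD0 hD hDA hz
    have e : z - chainMap ℝ k j v' = w - (S k z - z - boundary ℝ k Y (D k z)) -
        boundary ℝ k Y (D k z) := by
      rw [hv', ← hvw]
      abel
    rw [e]
    exact Submodule.sub_mem _ (chainsIn_le_relBoundaries (Submodule.sub_mem _ hw h3))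
      (boundary_mem_relBoundaries _)
  have hcyc : chainMap ℝ k j v' ∈ relCycles ℝ Kᶜ k := by
    have := Submodule.sub_mem _ hz (relBoundaries_le_relCycles hmem)
    rwa [sub_sub_cancel] at this
  have hv'' : v' ∈ relCycles ℝ (j ⁻¹' Kᶜ) k := mem_relCycles_preimage hj.injective hcyc
  exact ⟨v', hv'', hmem⟩

lemma LocalHomologyVanishes.of_preimage (hj : Topology.IsOpenEmbedding j) (hK : IsClosed K)
    (hKj : K ⊆ Set.range j) {k : ℕ} (h : LocalHomologyVanishes (j ⁻¹' K) k) :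
    LocalHomologyVanishes K k := by
  intro z hz
  obtain ⟨z', hz', hzz'⟩ := exists_sub_chainMap_mem_relBoundaries hj hK hKj hz
  have := chainMap_mem_relBoundaries ℝ j (B := Kᶜ) (fun x hx => hx) k (h hz')
  simpa using Submodule.add_mem _ hzz' this

lemma LocalHomologyVanishes.preimage (hj : Topology.IsOpenEmbedding j) (hK : IsClosed K)
    (hKj : K ⊆ Set.range j) {k : ℕ} (h : LocalHomologyVanishes K k) :
    LocalHomologyVanishes (j ⁻¹' K) k := fun _ hz =>
  mem_relBoundaries_of_chainMap hj hK hKj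
    (h (chainMap_mem_relCycles ℝ j (B := Kᶜ) (fun _ hx => hx) k hz))

/-! #### Local determination of top-dimensional classes -/

/-- The homology of `(X, X ∖ K)` vanishes above the degree `n`, and in the degree `n` it is
detected by the local homology groups at the points of `K`. -/
def LocallyDetermined (n : ℕ) (K : Set X) : Prop :=
  (∀ i, n < i → LocalHomologyVanishes K i) ∧
    ∀ z ∈ relCycles ℝ Kᶜ n, (∀ x ∈ K, z ∈ relBoundaries ℝ {x}ᶜ n) → z ∈ relBoundaries ℝ Kᶜ n

lemma locallyDetermined_empty (n : ℕ) : LocallyDetermined n (∅ : Set X) := by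
  have h : ∀ k, ∀ z : Chain ℝ k X, z ∈ relBoundaries ℝ (∅ : Set X)ᶜ k := fun k z =>
    chainsIn_le_relBoundaries (by rw [Set.compl_empty, chainsIn_univ]; trivial)
  exact ⟨fun i _ z _ => h i z, fun z _ _ => h n z⟩

lemma LocallyDetermined.union {n : ℕ} {A B : Set X} (hA : IsClosed A) (hB : IsClosed B)
    (h1 : LocallyDetermined n A) (h2 : LocallyDetermined n B) (h12 : LocallyDetermined n (A ∩ B)) :
    LocallyDetermined n (A ∪ B) := by
  have hA' : (A ∪ B)ᶜ ⊆ Aᶜ := Set.compl_subset_compl.2 Set.subset_union_left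
  have hB' : (A ∪ B)ᶜ ⊆ Bᶜ := Set.compl_subset_compl.2 Set.subset_union_right
  refine ⟨fun i hi z hz => ?_, fun z hz hx => ?_⟩
  · exact mem_relBoundaries_compl_union hA hB (h12.1 _ (hi.trans (Nat.lt_succ_self i)))
      (h1.1 i hi (relCycles_mono hA' hz)) (h2.1 i hi (relCycles_mono hB' hz))
  · exact mem_relBoundaries_compl_union hA hB (h12.1 _ (Nat.lt_succ_self n))
      (h1.2 z (relCycles_mono hA' hz) fun x hxA => hx x (Or.inl hxA))
      (h2.2 z (relCycles_mono hB' hz) fun x hxB => hx x (Or.inr hxB))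

lemma LocallyDetermined.preimage [T1Space Y] (hj : Topology.IsOpenEmbedding j) (hK : IsClosed K)
    (hKj : K ⊆ Set.range j) {n : ℕ} (h : LocallyDetermined n K) :
    LocallyDetermined n (j ⁻¹' K) := by
  refine ⟨fun i hi => (h.1 i hi).preimage hj hK hKj, fun z hz hx => ?_⟩
  refine mem_relBoundaries_of_chainMap hj hK hKj
    (h.2 _ (chainMap_mem_relCycles ℝ j (B := Kᶜ) (fun _ hx => hx) n hz) fun y hy => ?_)
  obtain ⟨x, rfl⟩ := hKj hy
  exact chainMap_mem_relBoundaries ℝ j (A := {x}ᶜ) (B := {j x}ᶜ)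
    (fun _ hx' h => hx' (hj.injective h)) n (hx x hy)

/-- Excision: for closed `K` inside an open subspace the property can be checked in the subspace. -/
lemma LocallyDetermined.of_preimage [T1Space Y] (hj : Topology.IsOpenEmbedding j) (hK : IsClosed K)
    (hKj : K ⊆ Set.range j) {n : ℕ} (h : LocallyDetermined n (j ⁻¹' K)) :
    LocallyDetermined n K := by
  refine ⟨fun i hi => (h.1 i hi).of_preimage hj hK hKj, fun z hz hx => ?_⟩
  obtain ⟨z', hz', hzz'⟩ := exists_sub_chainMap_mem_relBoundaries hj hK hKj hz
  have hz'' := h.2 z' hz' fun x hxK => by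
    have hsub : Kᶜ ⊆ {j x}ᶜ := Set.compl_subset_compl.2 (Set.singleton_subset_iff.2 hxK)
    have h1 := Submodule.sub_mem _ (hx (j x) hxK) (relBoundaries_mono hsub hzz')
    rw [sub_sub_cancel] at h1
    have h2 := mem_relBoundaries_of_chainMap hj isClosed_singleton
      (Set.singleton_subset_iff.2 ⟨x, rfl⟩) h1
    have h3 : j ⁻¹' {j x} = {x} := by
      ext y
      exact hj.injective.eq_iff
    rwa [h3] at h2
  have := chainMap_mem_relBoundaries ℝ j (B := Kᶜ) (fun x hx => hx) n hz''
  simpa using Submodule.add_mem _ hzz' this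

end LocalHomology

/-! ### Local homology of Euclidean space -/

section Euclidean

variable {F : Type*} [NormedAddCommGroup F] [NormedSpace ℝ F]

/-- The straight-line contraction of a vector space to the point `p`. -/
def lineContraction (p : F) : C(F × unitInterval, F) :=
  ⟨fun q => (1 - (q.2 : ℝ)) • q.1 + (q.2 : ℝ) • p, by fun_prop⟩

lemma isContraction_lineContraction (p : F) : IsContraction (lineContraction p) p :=
  ⟨fun x => by simp [lineContraction], fun x => by simp [lineContraction]⟩

lemma localHomologyVanishes_of_lineContraction {K : Set F} {p : F} (hp : p ∉ K)
    (hK : ∀ x ∉ K, ∀ u : unitInterval, (1 - (u : ℝ)) • x + (u : ℝ) • p ∉ K) (k : ℕ) :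
    LocalHomologyVanishes K k :=
  relCycles_le_relBoundaries_of_contraction (isContraction_lineContraction p) hK hp k

/-- The radial expansion homotopy with center `x`. -/
def expansion (x : F) (R : ℝ) : C(F × unitInterval, F) :=
  ⟨fun q => x + (1 + (q.2 : ℝ) * R) • (q.1 - x), by fun_prop⟩

/-- The local homology of a compact convex set injects into the local homology of a point of it:
a radial expansion pushes every compact set that misses the point off the convex set. -/
lemma mem_relBoundaries_compl_of_convex {C : Set F} (hC : IsCompact C) (hconv : Convex ℝ C) {x : F}
    (hx : x ∈ C) {k : ℕ} {z : Chain ℝ k F} (hz : z ∈ relCycles ℝ Cᶜ k)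
    (hzx : z ∈ relBoundaries ℝ {x}ᶜ k) : z ∈ relBoundaries ℝ Cᶜ k := by
  obtain ⟨u, a, ha, hua⟩ := mem_relBoundaries.1 hzx
  rw [mem_chainsIn_iff_carrier] at ha
  obtain ⟨δ, hδ, hball⟩ := Metric.isOpen_iff.1 (isCompact_carrier a).isClosed.isOpen_compl x
    (fun h => ha h rfl)
  obtain ⟨r, hr, hCr⟩ := hC.isBounded.subset_closedBall_lt 0 x
  have hR : 0 < r / δ := div_pos hr hδ
  have h0 : timeMap (expansion x (r / δ)) 0 = ContinuousMap.id F := by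
    ext y
    simp [timeMap, expansion]
  have h1 : ∀ y ∈ Cᶜ, ∀ u : unitInterval, expansion x (r / δ) (y, u) ∈ Cᶜ := by
    intro y hy u hmem
    apply hy
    set l : ℝ := 1 + (u : ℝ) * (r / δ) with hl
    have hl1 : 1 ≤ l := by
      have := mul_nonneg u.2.1 hR.le
      linarith
    have e : y = (1 - l⁻¹) • x + l⁻¹ • expansion x (r / δ) (y, u) := by
      change y = (1 - l⁻¹) • x + l⁻¹ • (x + l • (y - x))
      rw [smul_add, smul_smul, inv_mul_cancel₀ (by positivity)]
      module
    rw [e]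
    exact hconv hx hmem (sub_nonneg.2 (inv_le_one_of_one_le₀ hl1)) (by positivity) (by ring)
  have h2 := timeMap_sub_mem_relBoundaries h1 hz
  rw [h0, chainMap_id] at h2
  have h3 : chainMap ℝ k (timeMap (expansion x (r / δ)) 1) z ∈ relBoundaries ℝ Cᶜ k := by
    refine mem_relBoundaries.2 ⟨_, chainMap ℝ k (timeMap (expansion x (r / δ)) 1) a,
      chainMap_mem_chainsIn ℝ k _ (A := carrier a) ?_ (mem_chainsIn_iff_carrier.2 subset_rfl),
      by rw [hua, map_add, ← boundary_chainMap]⟩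
    intro y hy hmem
    have hy' : δ ≤ dist y x := by
      by_contra h
      exact hball (Metric.mem_ball.2 (not_le.1 h)) hy
    have h4 := hCr hmem
    rw [Metric.mem_closedBall, dist_eq_norm] at h4
    have h5 : timeMap (expansion x (r / δ)) 1 y - x = (1 + r / δ) • (y - x) := by
      simp [timeMap, expansion]
    rw [h5, norm_smul, Real.norm_of_nonneg (by positivity), ← dist_eq_norm] at h4
    have h6 : (1 + r / δ) * δ ≤ (1 + r / δ) * dist y x :=
      mul_le_mul_of_nonneg_left hy' (by positivity)
    have h7 : (1 + r / δ) * δ = δ + r := by field_simp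
    linarith
  have := Submodule.sub_mem _ h3 h2
  rwa [sub_sub_cancel] at this

variable {n : ℕ}

/-- The affine subspace of codimension `k` through `p` on which the first `k` coordinates are those
of `p`. -/
def flag (p : EuclideanSpace ℝ (Fin n)) (k : ℕ) : Set (EuclideanSpace ℝ (Fin n)) :=
  {y | ∀ i : Fin n, (i : ℕ) < k → y i = p i}

/-- One half of `flag p k`, on one side of `flag p (k + 1)`. -/
def halfFlag (p : EuclideanSpace ℝ (Fin n)) (k : Fin n) (s : ℝ) :
    Set (EuclideanSpace ℝ (Fin n)) :=
  flag p k ∩ {y | 0 ≤ s * (y k - p k)}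

lemma isClosed_flag (p : EuclideanSpace ℝ (Fin n)) (k : ℕ) : IsClosed (flag p k) := by
  simp only [flag, Set.ofPred_forall]
  refine isClosed_iInter fun i => isClosed_iInter fun _ => isClosed_eq ?_ continuous_const
  fun_prop

lemma isClosed_halfFlag (p : EuclideanSpace ℝ (Fin n)) (k : Fin n) (s : ℝ) :
    IsClosed (halfFlag p k s) :=
  (isClosed_flag p k).inter (isClosed_le continuous_const (by fun_prop))

lemma halfFlag_union (p : EuclideanSpace ℝ (Fin n)) (k : Fin n) :
    halfFlag p k 1 ∪ halfFlag p k (-1) = flag p k := by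
  ext y
  simp only [halfFlag, Set.mem_union, Set.mem_inter_iff, Set.mem_ofPred_eq]
  constructor
  · rintro (h | h) <;> exact h.1
  · intro h
    rcases le_total 0 (y k - p k) with h' | h'
    · exact Or.inl ⟨h, by linarith⟩
    · exact Or.inr ⟨h, by linarith⟩

lemma halfFlag_inter (p : EuclideanSpace ℝ (Fin n)) (k : Fin n) :
    halfFlag p k 1 ∩ halfFlag p k (-1) = flag p (k + 1) := by
  ext y
  simp only [halfFlag, Set.mem_inter_iff, Set.mem_ofPred_eq, flag]
  constructor
  · rintro ⟨⟨h1, h2⟩, -, h3⟩ i hi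
    rcases Nat.lt_succ_iff_lt_or_eq.1 hi with h | h
    · exact h1 i h
    · rw [Fin.ext h]
      linarith
  · intro h
    have h1 : ∀ i : Fin n, (i : ℕ) < k → y i = p i :=
      fun i hi => h i (hi.trans (Nat.lt_succ_self _))
    have h2 : y k = p k := h k (Nat.lt_succ_self _)
    simp only [h2, sub_self, mul_zero, le_refl, and_true]
    exact ⟨h1, h1⟩

lemma flag_eq_singleton (p : EuclideanSpace ℝ (Fin n)) : flag p n = {p} := by
  ext y
  simp only [flag, Set.mem_ofPred_eq, Set.mem_singleton_iff]
  exact ⟨fun h => PiLp.ext fun i => h i i.2, fun h i _ => by rw [h]⟩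

lemma flag_zero (p : EuclideanSpace ℝ (Fin n)) : flag p 0 = Set.univ := by
  ext y
  simp [flag]

/-- The complement of a half-flag is contracted by the straight-line homotopy to the point opposite
to its direction. -/
lemma localHomologyVanishes_halfFlag (p : EuclideanSpace ℝ (Fin n)) (k : Fin n) {s : ℝ}
    (hs : s * s = 1) (i : ℕ) : LocalHomologyVanishes (halfFlag p k s) i := by
  have hq : ∀ l : Fin n, (p - s • EuclideanSpace.single k (1 : ℝ)) l =
      p l - s * (if l = k then 1 else 0) := by
    intro l
    simp
  refine localHomologyVanishes_of_lineContraction (p := p - s • EuclideanSpace.single k (1 : ℝ))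
    ?_ ?_ i
  · rintro ⟨-, h⟩
    simp only [Set.mem_ofPred_eq, hq, if_true] at h
    nlinarith
  · rintro x hx u ⟨h1, h2⟩
    have hc : ∀ l : Fin n,
        ((1 - (u : ℝ)) • x + (u : ℝ) • (p - s • EuclideanSpace.single k (1 : ℝ))) l
        = (1 - (u : ℝ)) * x l + u * (p l - s * (if l = k then 1 else 0)) := by
      intro l
      rw [← hq]
      rfl
    simp only [Set.mem_ofPred_eq, hc, if_true] at h2
    have hu0 := u.2.1
    have hu1 : (u : ℝ) < 1 := by
      refine lt_of_le_of_ne u.2.2 fun h => ?_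
      rw [h] at h2
      nlinarith
    apply hx
    refine ⟨fun l hl => ?_, ?_⟩
    · have h3 := h1 l hl
      rw [hc, if_neg (fun h => by rw [h] at hl; exact lt_irrefl _ hl)] at h3
      have h4 : (1 - (u : ℝ)) * (x l - p l) = 0 := by linarith
      rcases mul_eq_zero.1 h4 with h5 | h5
      · linarith
      · linarith
    · have h3 : (1 - (u : ℝ)) * (s * (x k - p k)) = s * ((1 - (u : ℝ)) * x k +
          u * (p k - s * 1) - p k) + u * (s * s) := by ring
      rw [hs] at h3
      have h4 : 0 ≤ (1 - (u : ℝ)) * (s * (x k - p k)) := by linarith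
      exact nonneg_of_mul_nonneg_right h4 (sub_pos.2 hu1)

lemma localHomologyVanishes_flag (p : EuclideanSpace ℝ (Fin n)) {k : ℕ} (hk : k ≤ n) {i : ℕ}
    (hi : k < i) : LocalHomologyVanishes (flag p k) i := by
  induction k generalizing i with
  | zero =>
    obtain ⟨i, rfl⟩ := Nat.exists_eq_succ_of_ne_zero hi.ne'
    rw [LocalHomologyVanishes, flag_zero, Set.compl_univ]
    exact relCycles_empty_le_relBoundaries (isContraction_lineContraction p) i
  | succ k ih =>
    obtain ⟨i, rfl⟩ := Nat.exists_eq_succ_of_ne_zero (Nat.ne_zero_of_lt hi)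
    have := halfFlag_inter p ⟨k, hk⟩
    rw [← this]
    refine LocalHomologyVanishes.inter (isClosed_halfFlag _ _ _) (isClosed_halfFlag _ _ _) ?_
      (localHomologyVanishes_halfFlag _ _ (by norm_num) _)
      (localHomologyVanishes_halfFlag _ _ (by norm_num) _)
    rw [halfFlag_union]
    exact ih (Nat.le_of_succ_le hk) (Nat.lt_of_succ_lt_succ hi)

lemma localHomologyVanishes_point (p : EuclideanSpace ℝ (Fin n)) {i : ℕ} (hi : n < i) :
    LocalHomologyVanishes {p} i := by
  rw [← flag_eq_singleton]
  exact localHomologyVanishes_flag p le_rfl hi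

lemma not_localHomologyVanishes_flag (p : EuclideanSpace ℝ (Fin n)) {k : ℕ} (hk : k ≤ n) :
    ¬ LocalHomologyVanishes (flag p k) k := by
  induction k with
  | zero =>
    rw [flag_zero, LocalHomologyVanishes, Set.compl_univ]
    intro h
    have h1 : (Finsupp.single (ContinuousMap.const _ p) 1 : Chain ℝ 0 (EuclideanSpace ℝ (Fin n))) ∈
        relCycles ℝ ∅ 0 := trivial
    obtain ⟨u, a, ha, hua⟩ := mem_relBoundaries.1 (h h1)
    have ha0 : a = 0 := by
      rw [mem_chainsIn_iff_carrier] at ha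
      ext σ
      by_contra hσ
      exact ha (Set.mem_biUnion (Finsupp.mem_support_iff.2 hσ)
        ⟨Classical.arbitrary _, rfl⟩)
    have h2 := congr_arg augmentation hua
    rw [ha0, add_zero, augmentation_single, augmentation_boundary] at h2
    exact one_ne_zero h2
  | succ k ih =>
    intro h
    apply ih (Nat.le_of_succ_le hk)
    intro z hz
    have hk' := halfFlag_union p ⟨k, hk⟩
    rw [← hk'] at hz ⊢
    refine mem_relBoundaries_compl_union (isClosed_halfFlag _ _ _) (isClosed_halfFlag _ _ _) ?_
      (localHomologyVanishes_halfFlag _ _ (by norm_num) _ (relCycles_mono ?_ hz))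
      (localHomologyVanishes_halfFlag _ _ (by norm_num) _ (relCycles_mono ?_ hz))
    · rw [halfFlag_inter]
      exact h
    · exact Set.compl_subset_compl.2 Set.subset_union_left
    · exact Set.compl_subset_compl.2 Set.subset_union_right

lemma not_localHomologyVanishes_point (p : EuclideanSpace ℝ (Fin n)) :
    ¬ LocalHomologyVanishes {p} n := by
  rw [← flag_eq_singleton]
  exact not_localHomologyVanishes_flag p le_rfl

lemma locallyDetermined_of_convex {C : Set (EuclideanSpace ℝ (Fin n))} (hC : IsCompact C)
    (hconv : Convex ℝ C) : LocallyDetermined n C := by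
  rcases C.eq_empty_or_nonempty with rfl | ⟨x, hx⟩
  · exact locallyDetermined_empty n
  · have hsub : Cᶜ ⊆ {x}ᶜ := Set.compl_subset_compl.2 (Set.singleton_subset_iff.2 hx)
    refine ⟨fun i hi z hz => ?_, fun z hz h => ?_⟩
    · exact mem_relBoundaries_compl_of_convex hC hconv hx hz
        (localHomologyVanishes_point x hi (relCycles_mono hsub hz))
    · exact mem_relBoundaries_compl_of_convex hC hconv hx hz (h x hx)

lemma isCompact_setOf_exists_mem_list {X : Type*} [TopologicalSpace X] (l : List (Set X))
    (hl : ∀ C ∈ l, IsCompact C) : IsCompact {x | ∃ C ∈ l, x ∈ C} := by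
  have : {x | ∃ C ∈ l, x ∈ C} = ⋃ C ∈ {C | C ∈ l}, C := by
    ext x
    simp
  rw [this]
  exact (List.finite_toSet l).isCompact_biUnion hl

/-- Finite unions of compact convex sets, by induction on the number of sets. -/
lemma locallyDetermined_of_convex_list (m : ℕ) (l : List (Set (EuclideanSpace ℝ (Fin n))))
    (hm : l.length = m) (hl : ∀ C ∈ l, IsCompact C ∧ Convex ℝ C) :
    LocallyDetermined n {x | ∃ C ∈ l, x ∈ C} := by
  induction m generalizing l with
  | zero =>
    rw [List.length_eq_zero_iff] at hm
    subst hm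
    simpa using locallyDetermined_empty n
  | succ m ih =>
    obtain ⟨B, l, rfl⟩ := List.exists_of_length_succ l hm
    have hB := hl B (by simp)
    have hl' : ∀ C ∈ l, IsCompact C ∧ Convex ℝ C := fun C hC => hl C (by simp [hC])
    have hlen : l.length = m := by simpa using hm
    have e : {x | ∃ C ∈ B :: l, x ∈ C} = B ∪ {x | ∃ C ∈ l, x ∈ C} := by
      ext x
      simp
    rw [e]
    refine LocallyDetermined.union hB.1.isClosed
      (isCompact_setOf_exists_mem_list l fun C hC => (hl' C hC).1).isClosed
      (locallyDetermined_of_convex hB.1 hB.2) (ih l hlen hl') ?_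
    have e' : B ∩ {x | ∃ C ∈ l, x ∈ C} = {x | ∃ C ∈ l.map (fun C => C ∩ B), x ∈ C} := by
      ext x
      simp only [Set.mem_inter_iff, Set.mem_ofPred_eq, List.mem_map, exists_exists_and_eq_and]
      constructor
      · rintro ⟨h1, C, h2, h3⟩
        exact ⟨C, h2, h3, h1⟩
      · rintro ⟨C, h2, h3, h1⟩
        exact ⟨h1, C, h2, h3⟩
    rw [e']
    refine ih _ (by simpa using hlen) fun C hC => ?_
    obtain ⟨C', hC', rfl⟩ := List.mem_map.1 hC
    exact ⟨(hl' C' hC').1.inter hB.1, (hl' C' hC').2.inter hB.2⟩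

lemma exists_cthickening_relCycles {F : Type*} [NormedAddCommGroup F] {K : Set F}
    (hK : IsCompact K) {k : ℕ} {z : Chain ℝ k F}
    (hz : z ∈ relCycles ℝ Kᶜ k) :
    ∃ ε > 0, z ∈ relCycles ℝ (Metric.cthickening ε K)ᶜ k := by
  cases k with
  | zero => exact ⟨1, one_pos, trivial⟩
  | succ k =>
    rw [mem_relCycles_succ, mem_chainsIn_iff_carrier] at hz
    obtain ⟨ε, hε, h⟩ := hK.exists_cthickening_subset_open
      (isCompact_carrier _).isClosed.isOpen_compl (Set.subset_compl_comm.1 hz)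
    refine ⟨ε, hε, ?_⟩
    rw [mem_relCycles_succ, mem_chainsIn_iff_carrier]
    exact Set.subset_compl_comm.1 h

/-- A relative cycle of the complement of `K` is a relative cycle of the complement of a finite
union of small closed balls covering `K`, for which the convex case and Mayer–Vietoris apply. -/
lemma locallyDetermined_euclidean {K : Set (EuclideanSpace ℝ (Fin n))} (hK : IsCompact K) :
    LocallyDetermined n K := by
  have key : ∀ (i : ℕ), ∀ z ∈ relCycles ℝ Kᶜ i,
      ∃ t : Finset (EuclideanSpace ℝ (Fin n)), (t : Set _) ⊆ K ∧
        ∃ ε : ℝ, 0 < ε ∧ K ⊆ {x | ∃ C ∈ t.toList.map (fun y => Metric.closedBall y ε), x ∈ C} ∧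
        z ∈ relCycles ℝ {x | ∃ C ∈ t.toList.map (fun y => Metric.closedBall y ε), x ∈ C}ᶜ i := by
    intro i z hz
    obtain ⟨ε, hε, hzε⟩ := exists_cthickening_relCycles hK hz
    obtain ⟨t, htK, htf, hcov⟩ := hK.finite_cover_balls hε
    lift t to Finset (EuclideanSpace ℝ (Fin n)) using htf
    refine ⟨t, htK, ε, hε, fun x hx => ?_, relCycles_mono (Set.compl_subset_compl.2 ?_) hzε⟩
    · obtain ⟨y, hy, hxy⟩ := Set.mem_iUnion₂.1 (hcov hx)
      exact ⟨_, List.mem_map.2 ⟨y, by simpa using hy, rfl⟩, Metric.ball_subset_closedBall hxy⟩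
    · rintro x ⟨C, hC, hx⟩
      obtain ⟨y, hy, rfl⟩ := List.mem_map.1 hC
      exact Metric.closedBall_subset_cthickening (htK (by simpa using hy)) ε hx
  have hconv : ∀ (t : Finset (EuclideanSpace ℝ (Fin n))) (ε : ℝ),
      ∀ C ∈ t.toList.map (fun y => Metric.closedBall y ε), IsCompact C ∧ Convex ℝ C := by
    intro t ε C hC
    obtain ⟨y, hy, rfl⟩ := List.mem_map.1 hC
    exact ⟨isCompact_closedBall y ε, convex_closedBall y ε⟩
  refine ⟨fun i hi z hz => ?_, fun z hz h => ?_⟩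
  · obtain ⟨t, htK, ε, hε, hcov, hzt⟩ := key i z hz
    exact relBoundaries_mono (Set.compl_subset_compl.2 hcov)
      ((locallyDetermined_of_convex_list _ _ rfl (hconv t ε)).1 i hi hzt)
  · obtain ⟨t, htK, ε, hε, hcov, hzt⟩ := key n z hz
    refine relBoundaries_mono (Set.compl_subset_compl.2 hcov)
      ((locallyDetermined_of_convex_list _ _ rfl (hconv t ε)).2 z hzt ?_)
    rintro x ⟨C, hC, hx⟩
    obtain ⟨y, hy, rfl⟩ := List.mem_map.1 hC
    have hsub : Metric.closedBall y ε ⊆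
        {x | ∃ C ∈ t.toList.map (fun y => Metric.closedBall y ε), x ∈ C} :=
      fun w hw => ⟨_, hC, hw⟩
    have h1 := mem_relBoundaries_compl_of_convex (isCompact_closedBall y ε) (convex_closedBall y ε)
      (Metric.mem_closedBall_self hε.le)
      (relCycles_mono (Set.compl_subset_compl.2 hsub) hzt)
      (h y (htK (by simpa using hy)))
    exact relBoundaries_mono (Set.compl_subset_compl.2 (Set.singleton_subset_iff.2 hx)) h1

variable {X : Type*} [TopologicalSpace X]

/-- The inclusion of the source of a chart. -/
def sourceInclusion {Z : Type*} [TopologicalSpace Z] (e : OpenPartialHomeomorph X Z) :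
    C(e.source, X) := ⟨Subtype.val, continuous_subtype_val⟩

/-- A chart as a map on its source. -/
def sourceChart {Z : Type*} [TopologicalSpace Z] (e : OpenPartialHomeomorph X Z) :
    C(e.source, Z) := ⟨fun x => e x, e.continuousOn.domRestrict⟩

lemma isOpenEmbedding_sourceInclusion {Z : Type*} [TopologicalSpace Z]
    (e : OpenPartialHomeomorph X Z) : Topology.IsOpenEmbedding (sourceInclusion e) :=
  e.open_source.isOpenEmbedding_subtypeVal

lemma isOpenEmbedding_sourceChart {Z : Type*} [TopologicalSpace Z]
    (e : OpenPartialHomeomorph X Z) : Topology.IsOpenEmbedding (sourceChart e) :=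
  e.open_target.isOpenEmbedding_subtypeVal.comp e.toHomeomorphSourceTarget.isOpenEmbedding

lemma range_sourceInclusion {Z : Type*} [TopologicalSpace Z] (e : OpenPartialHomeomorph X Z) :
    Set.range (sourceInclusion e) = e.source := Subtype.range_coe

lemma locallyDetermined_of_chart [T2Space X]
    (e : OpenPartialHomeomorph X (EuclideanSpace ℝ (Fin n))) {K : Set X} (hK : IsCompact K)
    (hKe : K ⊆ e.source) : LocallyDetermined n K := by
  rw [← range_sourceInclusion] at hKe
  refine LocallyDetermined.of_preimage (isOpenEmbedding_sourceInclusion e) hK.isClosed hKe ?_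
  have hc : IsCompact (sourceInclusion e ⁻¹' K) :=
    (isOpenEmbedding_sourceInclusion e).isInducing.isCompact_preimage' hK hKe
  have hc' := hc.image (sourceChart e).continuous
  have := (locallyDetermined_euclidean hc').preimage (isOpenEmbedding_sourceChart e) hc'.isClosed
    (Set.image_subset_range _ _)
  rwa [Set.preimage_image_eq _ (isOpenEmbedding_sourceChart e).injective] at this

/-- Top-dimensional classes of a manifold relative to the complement of a compact set are
determined by their local restrictions. -/
lemma locallyDetermined_of_isCompact [T2Space X] [LocallyCompactSpace X] {K : Set X}
    (hK : IsCompact K)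
    (hchart : ∀ x ∈ K, ∃ e : OpenPartialHomeomorph X (EuclideanSpace ℝ (Fin n)), x ∈ e.source) :
    LocallyDetermined n K := by
  have key : ∃ L, IsCompact L ∧ K ⊆ L ∧ ∀ K' ⊆ L, IsCompact K' → LocallyDetermined n K' := by
    refine hK.induction_on (p := fun s => ∃ L, IsCompact L ∧ s ⊆ L ∧
      ∀ K' ⊆ L, IsCompact K' → LocallyDetermined n K') ?_ ?_ ?_ ?_
    · refine ⟨∅, isCompact_empty, subset_rfl, fun K' hK' _ => ?_⟩
      rw [Set.subset_empty_iff.1 hK']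
      exact locallyDetermined_empty n
    · rintro s t hst ⟨L, h1, h2, h3⟩
      exact ⟨L, h1, hst.trans h2, h3⟩
    · rintro s t ⟨L, h1, h2, h3⟩ ⟨L', h1', h2', h3'⟩
      refine ⟨L ∪ L', h1.union h1', Set.union_subset_union h2 h2', fun K' hK' hc => ?_⟩
      have e : K' = (K' ∩ L) ∪ (K' ∩ L') := by
        rw [← Set.inter_union_distrib_left, Set.inter_eq_left.2 hK']
      have hc1 := hc.inter h1
      have hc2 := hc.inter h1'
      rw [e]
      exact LocallyDetermined.union hc1.isClosed hc2.isClosed (h3 _ Set.inter_subset_right hc1)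
        (h3' _ Set.inter_subset_right hc2)
        (h3 _ (Set.inter_subset_left.trans Set.inter_subset_right) (hc1.inter hc2))
    · intro x hx
      obtain ⟨e, he⟩ := hchart x hx
      obtain ⟨L, hL, hxL, hLe⟩ := exists_compact_subset e.open_source he
      exact ⟨interior L, mem_nhdsWithin_of_mem_nhds (isOpen_interior.mem_nhds hxL), L, hL,
        interior_subset, fun K' hK' hc => locallyDetermined_of_chart e hc (hK'.trans hLe)⟩
  obtain ⟨L, -, h2, h3⟩ := key
  exact h3 K h2 hK

end Euclidean

/-! ### Invariance of the boundary -/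

section HalfSpace

variable {m : ℕ}

/-- The point of the half-space obtained from `y` by moving the first coordinate by `a`, and
stopping at the boundary. -/
def halfShift (y : EuclideanSpace ℝ (Fin (m + 1))) (a : ℝ) : HalfSpace (m + 1) :=
  ⟨y + (max 0 (y 0 + a) - y 0) • EuclideanSpace.single 0 (1 : ℝ), by
    intro i hi
    obtain rfl : i = 0 := Fin.ext hi
    simp⟩

lemma halfShift_zero_coord (y : EuclideanSpace ℝ (Fin (m + 1))) (a : ℝ) :
    (halfShift y a).1 0 = max 0 (y 0 + a) := by
  simp [halfShift]

lemma halfShift_val (y : EuclideanSpace ℝ (Fin (m + 1))) (a : ℝ) : (halfShift y a).1 =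
    y + (max 0 (y 0 + a) - y 0) • EuclideanSpace.single 0 (1 : ℝ) := rfl

lemma continuous_halfShift :
    Continuous fun q : EuclideanSpace ℝ (Fin (m + 1)) × ℝ => halfShift q.1 q.2 := by
  refine Continuous.subtype_mk ?_ _
  fun_prop

lemma HalfSpace.zero_le (y : HalfSpace (m + 1)) : 0 ≤ y.1 0 := y.2 0 rfl

lemma halfShift_eq_self {y : HalfSpace (m + 1)} {a : ℝ} (h : max 0 (y.1 0 + a) = y.1 0) :
    halfShift y.1 a = y := by
  refine Subtype.ext ?_
  rw [halfShift_val, h, sub_self, zero_smul, add_zero]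

lemma dist_halfShift_le (y : HalfSpace (m + 1)) (a : ℝ) : dist (halfShift y.1 a) y ≤ |a| := by
  rw [Subtype.dist_eq, dist_eq_norm, halfShift_val, add_sub_cancel_left, norm_smul,
    PiLp.norm_single, norm_one, mul_one, Real.norm_eq_abs]
  have := HalfSpace.zero_le y
  rcases max_cases 0 (y.1 0 + a) with ⟨h, h'⟩ | ⟨h, h'⟩ <;> rw [h]
  · rw [zero_sub, abs_neg, abs_of_nonneg this]
    exact le_trans (by linarith) (neg_le_abs a)
  · rw [add_sub_cancel_left]

/-- The open half-space as a chart with values in Euclidean space. -/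
def openHalfSpaceChart (m : ℕ) :
    OpenPartialHomeomorph (HalfSpace (m + 1)) (EuclideanSpace ℝ (Fin (m + 1))) where
  toFun := Subtype.val
  invFun y := halfShift y 0
  source := {y | 0 < y.1 0}
  target := {y | 0 < y 0}
  map_source' _ hy := hy
  map_target' y hy := by
    change 0 < (halfShift y 0).1 0
    rw [halfShift_zero_coord, add_zero]
    exact lt_max_of_lt_right hy
  left_inv' y _ := halfShift_eq_self (by rw [add_zero, max_eq_right (HalfSpace.zero_le y)])
  right_inv' y hy := by
    rw [halfShift_val, add_zero, max_eq_right (le_of_lt hy), sub_self, zero_smul, add_zero]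
  open_source := isOpen_lt continuous_const (by fun_prop)
  open_target := isOpen_lt continuous_const (by fun_prop)
  continuousOn_toFun := continuous_subtype_val.continuousOn
  continuousOn_invFun := (continuous_halfShift.comp (by fun_prop :
    Continuous fun y : EuclideanSpace ℝ (Fin (m + 1)) => (y, (0 : ℝ)))).continuousOn

variable {V : Type*} [TopologicalSpace V]

lemma mem_manifoldInterior_of_pos {e : OpenPartialHomeomorph V (HalfSpace (m + 1))} {x : V}
    (hx : x ∈ e.source) (h : 0 < (e x).1 0) : x ∈ manifoldInterior (m + 1) V :=
  ⟨e.trans (openHalfSpaceChart m), by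
    rw [OpenPartialHomeomorph.trans_source]
    exact ⟨hx, h⟩⟩

lemma eq_zero_of_mem_manifoldBoundary {e : OpenPartialHomeomorph V (HalfSpace (m + 1))} {x : V}
    (hx : x ∈ e.source) (h : x ∈ manifoldBoundary (m + 1) V) : (e x).1 0 = 0 := by
  by_contra h0
  exact h (mem_manifoldInterior_of_pos hx ((HalfSpace.zero_le _).lt_of_ne (Ne.symm h0)))

lemma isOpen_manifoldInterior (n : ℕ) : IsOpen (manifoldInterior n V) := by
  rw [isOpen_iff_mem_nhds]
  rintro x ⟨e, he⟩
  exact Filter.mem_of_superset (e.open_source.mem_nhds he) fun y hy => ⟨e, hy⟩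

lemma isClosed_manifoldBoundary (n : ℕ) : IsClosed (manifoldBoundary n V) :=
  (isOpen_manifoldInterior n).isClosed_compl

lemma manifoldBoundary_zero (hV : IsManifoldWithBoundary 0 V) : manifoldBoundary 0 V = ∅ := by
  rw [manifoldBoundary, Set.compl_empty_iff]
  refine Set.eq_univ_of_forall fun x => ?_
  obtain ⟨e, he⟩ := hV.chart x
  let i : HalfSpace 0 ≃ₜ EuclideanSpace ℝ (Fin 0) :=
    { toFun := Subtype.val
      invFun := fun y => ⟨y, fun i => i.elim0⟩
      left_inv := fun _ => rfl
      right_inv := fun _ => rfl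
      continuous_toFun := continuous_subtype_val
      continuous_invFun := continuous_id.subtype_mk _ }
  exact ⟨e.transHomeomorph i, he⟩

/-- Local homology at a point can be computed in a chart. -/
lemma localHomologyVanishes_chart_iff {X Z : Type*} [TopologicalSpace X] [TopologicalSpace Z]
    [T1Space X] [T1Space Z] (e : OpenPartialHomeomorph X Z) {x : X} (hx : x ∈ e.source) (k : ℕ) :
    LocalHomologyVanishes {e x} k ↔ LocalHomologyVanishes {x} k := by
  have h1 : sourceInclusion e ⁻¹' {x} = {⟨x, hx⟩} := by
    ext y
    exact ⟨fun h => Subtype.ext h, fun h => congr_arg Subtype.val h⟩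
  have h2 : sourceChart e ⁻¹' {e x} = {⟨x, hx⟩} := by
    ext y
    exact (isOpenEmbedding_sourceChart e).injective.eq_iff (b := ⟨x, hx⟩)
  have r1 : {x} ⊆ Set.range (sourceInclusion e) := Set.singleton_subset_iff.2 ⟨⟨x, hx⟩, rfl⟩
  have r2 : {e x} ⊆ Set.range (sourceChart e) := Set.singleton_subset_iff.2 ⟨⟨x, hx⟩, rfl⟩
  constructor
  · intro h
    refine LocalHomologyVanishes.of_preimage (isOpenEmbedding_sourceInclusion e)
      isClosed_singleton r1 ?_
    rw [h1, ← h2]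
    exact h.preimage (isOpenEmbedding_sourceChart e) isClosed_singleton r2
  · intro h
    refine LocalHomologyVanishes.of_preimage (isOpenEmbedding_sourceChart e)
      isClosed_singleton r2 ?_
    rw [h2, ← h1]
    exact h.preimage (isOpenEmbedding_sourceInclusion e) isClosed_singleton r1

/-- The local homology of the half-space at a boundary point vanishes: both the half-space and the
complement of the point are star-shaped. -/
lemma localHomologyVanishes_halfSpace {q : HalfSpace (m + 1)} (hq : q.1 0 = 0) (k : ℕ) :
    LocalHomologyVanishes {q} k := by
  let p : HalfSpace (m + 1) := halfShift q.1 1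
  have hp : p.1 0 = 1 := by
    simp only [p, halfShift_zero_coord, hq]
    norm_num
  let G : C(HalfSpace (m + 1) × unitInterval, HalfSpace (m + 1)) :=
    ⟨fun y => ⟨(1 - (y.2 : ℝ)) • y.1.1 + (y.2 : ℝ) • p.1, fun i hi => by
      have h1 := mul_nonneg (sub_nonneg.2 y.2.2.2) (y.1.2 i hi)
      have h2 := mul_nonneg y.2.2.1 (p.2 i hi)
      simpa using add_nonneg h1 h2⟩, by
      refine Continuous.subtype_mk ?_ _
      fun_prop⟩
  have hG : IsContraction G p :=
    ⟨fun x => Subtype.ext (by simp [G]), fun x => Subtype.ext (by simp [G])⟩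
  refine relCycles_le_relBoundaries_of_contraction hG (A := {q}ᶜ) ?_ ?_ k
  · intro y hy u h
    have h0 : (G (y, u)).1 0 = 0 := by
      rw [Set.mem_singleton_iff.1 h, hq]
    have h1 : (G (y, u)).1 0 = (1 - (u : ℝ)) * y.1 0 + u * p.1 0 := rfl
    have h2 := mul_nonneg (sub_nonneg.2 u.2.2) (HalfSpace.zero_le y)
    have h3 : u = 0 := Subtype.ext (by
      rw [hp] at h1
      exact le_antisymm (by simp; linarith) u.2.1)
    rw [h3, hG.zero] at h
    exact hy h
  · intro h
    rw [Set.mem_singleton_iff.1 h, hq] at hp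
    exact zero_ne_one hp

/-- Invariance of the boundary. -/
lemma mem_manifoldBoundary_of_eq_zero [T2Space V]
    {e : OpenPartialHomeomorph V (HalfSpace (m + 1))} {x : V} (hx : x ∈ e.source)
    (h : (e x).1 0 = 0) : x ∈ manifoldBoundary (m + 1) V := by
  rintro ⟨e', hx'⟩
  refine not_localHomologyVanishes_point (e' x) ?_
  rw [localHomologyVanishes_chart_iff e' hx', ← localHomologyVanishes_chart_iff e hx]
  exact localHomologyVanishes_halfSpace h _

end HalfSpace

/-! ### Pushing a manifold into its interior and a collar into the boundary -/

section Push

/-- A family of self-maps of the target of a chart, which is the identity outside a compact subset,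
extends by the identity. -/
lemma exists_glue {X Z W : Type*} [TopologicalSpace X] [TopologicalSpace Z] [TopologicalSpace W]
    [T2Space X] (e : OpenPartialHomeomorph X Z) {Q : Set Z} (hQ : IsCompact Q) (hQe : Q ⊆ e.target)
    (h : C(Z × W, Z)) (hid : ∀ y ∉ Q, ∀ w, h (y, w) = y) (ht : ∀ y ∈ Q, ∀ w, h (y, w) ∈ e.target) :
    ∃ g : C(X × W, X), (∀ x ∈ e.source, ∀ w, g (x, w) = e.symm (h (e x, w))) ∧
      ∀ x, (x ∈ e.source → e x ∉ Q) → ∀ w, g (x, w) = x := by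
  classical
  let f : X × W → X := fun q => if q.1 ∈ e.source then e.symm (h (e q.1, q.2)) else q.1
  have hf1 : ∀ x ∈ e.source, ∀ w, f (x, w) = e.symm (h (e x, w)) := fun x hx w => if_pos hx
  have hf2 : ∀ x, (x ∈ e.source → e x ∉ Q) → ∀ w, f (x, w) = x := by
    intro x hx w
    by_cases hxe : x ∈ e.source
    · rw [hf1 x hxe, hid _ (hx hxe), e.left_inv hxe]
    · exact if_neg hxe
  have hQ' : IsClosed (e.symm '' Q) := (hQ.image_of_continuousOn
    (e.continuousOn_symm.mono hQe)).isClosed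
  have hmem : ∀ x ∉ e.symm '' Q, x ∈ e.source → e x ∉ Q := fun x hx hxe hxQ =>
    hx ⟨e x, hxQ, e.left_inv hxe⟩
  refine ⟨⟨f, continuous_iff_continuousAt.2 ?_⟩, hf1, hf2⟩
  rintro ⟨x, w⟩
  by_cases hx : x ∈ e.source
  · have hev : f =ᶠ[𝓝 (x, w)] fun q => e.symm (h (e q.1, q.2)) := by
      filter_upwards [continuousAt_fst.preimage_mem_nhds (e.open_source.mem_nhds hx)] with q hq
      exact hf1 q.1 hq q.2
    refine ContinuousAt.congr ?_ hev.symm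
    have h1 : ContinuousAt (fun q : X × W => h (e q.1, q.2)) (x, w) :=
      h.continuous.continuousAt.comp
        (((e.continuousAt hx).comp continuousAt_fst).prodMk continuousAt_snd)
    have h2 : h (e x, w) ∈ e.target := by
      by_cases hxQ : e x ∈ Q
      · exact ht _ hxQ w
      · rw [hid _ hxQ]
        exact e.map_source hx
    exact ContinuousAt.comp (g := e.symm) (e.continuousAt_symm h2) h1
  · have hxQ : x ∉ e.symm '' Q := by
      rintro ⟨y, hy, rfl⟩
      exact hx (e.map_target (hQe hy))
    have hev : f =ᶠ[𝓝 (x, w)] Prod.fst := by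
      filter_upwards [continuousAt_fst.preimage_mem_nhds (hQ'.isOpen_compl.mem_nhds hxQ)] with q hq
      exact hf2 q.1 (hmem _ hq) q.2
    exact continuousAt_fst.congr hev.symm

instance properSpace_halfSpace (n : ℕ) : ProperSpace (HalfSpace n) := by
  have : IsClosed {x : EuclideanSpace ℝ (Fin n) | ∀ i : Fin n, (i : ℕ) = 0 → 0 ≤ x i} := by
    simp only [Set.ofPred_forall]
    refine isClosed_iInter fun i => isClosed_iInter fun _ => isClosed_le continuous_const ?_
    fun_prop
  exact ⟨fun x r => this.isClosedEmbedding_subtypeVal.isCompact_preimage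
    (isCompact_closedBall x.1 r)⟩

variable {m : ℕ} {V : Type*} [TopologicalSpace V] [T2Space V]

/-- The local push at a boundary point `p`: in a half-space chart around `p`, the first coordinate
is moved by `a s ρ`, for a bump function `ρ`. -/
lemma exists_chart_push (a : ℝ) (ha : |a| ≤ 1) {e : OpenPartialHomeomorph V (HalfSpace (m + 1))}
    {p : V} (hp : p ∈ e.source) :
    ∃ (ε : ℝ) (ρ : HalfSpace (m + 1) → ℝ) (g : C(V × unitInterval, V)), 0 < ε ∧
      (∀ y, 0 ≤ ρ y) ∧ (∀ y, dist y (e p) ≤ ε → ρ y = ε) ∧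
      (∀ x s, x ∉ e.source → g (x, s) = x) ∧
      (∀ x (s : unitInterval), x ∈ e.source → halfShift (e x).1 (a * s * ρ (e x)) ∈ e.target ∧
        g (x, s) = e.symm (halfShift (e x).1 (a * s * ρ (e x)))) := by
  obtain ⟨r, hr, hball⟩ := Metric.isOpen_iff.1 e.open_target (e p) (e.map_source hp)
  let ε := r / 4
  have hε : 0 < ε := by positivity
  let ρ : HalfSpace (m + 1) → ℝ := fun y => max 0 (min ε (2 * ε - dist y (e p)))
  have hρ0 : ∀ y, 0 ≤ ρ y := fun y => le_max_left _ _
  have hρε : ∀ y, ρ y ≤ ε := fun y => max_le hε.le (min_le_left _ _)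
  have hρc : Continuous ρ := by fun_prop
  let h : C(HalfSpace (m + 1) × unitInterval, HalfSpace (m + 1)) :=
    ⟨fun q => halfShift q.1.1 (a * q.2 * ρ q.1), continuous_halfShift.comp
      (f := fun q : HalfSpace (m + 1) × unitInterval => (q.1.1, a * q.2 * ρ q.1))
      (Continuous.prodMk (by fun_prop) (by fun_prop))⟩
  have hout : ∀ y ∉ Metric.closedBall (e p) (2 * ε), ∀ s, h (y, s) = y := by
    intro y hy s
    have h1 : ρ y = 0 := by
      rw [Metric.mem_closedBall, not_le] at hy
      exact max_eq_left (min_le_of_right_le (by linarith))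
    change halfShift y.1 (a * s * ρ y) = y
    rw [h1, mul_zero]
    exact halfShift_eq_self (by rw [add_zero, max_eq_right (HalfSpace.zero_le y)])
  have hin : ∀ y ∈ Metric.closedBall (e p) (2 * ε), ∀ s, h (y, s) ∈ e.target := by
    intro y hy s
    apply hball
    have h1 : dist (h (y, s)) y ≤ |a * s * ρ y| := dist_halfShift_le y _
    have h2 : |a * s * ρ y| ≤ ε := by
      rw [abs_mul, abs_mul, abs_of_nonneg s.2.1, abs_of_nonneg (hρ0 y)]
      calc |a| * s * ρ y ≤ 1 * 1 * ε :=
            mul_le_mul (mul_le_mul ha s.2.2 s.2.1 zero_le_one) (hρε y) (hρ0 y) (by norm_num)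
        _ = ε := by ring
    have h3 := dist_triangle (h (y, s)) y (e p)
    rw [Metric.mem_closedBall] at hy
    rw [Metric.mem_ball]
    have : 4 * ε = r := by simp only [ε]; ring
    linarith
  have hsub : Metric.closedBall (e p) (2 * ε) ⊆ e.target := by
    refine (Metric.closedBall_subset_ball ?_).trans hball
    simp only [ε]
    linarith
  obtain ⟨g, hg1, hg2⟩ := exists_glue e (isCompact_closedBall _ _) hsub h hout hin
  refine ⟨ε, ρ, g, hε, hρ0, fun y hy => ?_, fun x s hx => hg2 x (fun h => absurd h hx) s,
    fun x s hx => ⟨?_, hg1 x hx s⟩⟩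
  · have : min ε (2 * ε - dist y (e p)) = ε := min_eq_left (by linarith)
    simp only [ρ, this, max_eq_right hε.le]
  · by_cases hxQ : e x ∈ Metric.closedBall (e p) (2 * ε)
    · exact hin _ hxQ s
    · change h (e x, s) ∈ e.target
      rw [hout _ hxQ]
      exact e.map_source hx

/-- Composition of homotopies of self-maps that start at the identity. -/
def pushComp {V : Type*} [TopologicalSpace V] (G H : C(V × unitInterval, V)) :
    C(V × unitInterval, V) := ⟨fun q => G (H q, q.2), by fun_prop⟩

variable {n : ℕ} [CompactSpace V]

/-- A manifold can be pushed into its interior. -/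
lemma exists_inward_push (hV : IsManifoldWithBoundary n V) :
    ∃ H : C(V × unitInterval, V), (∀ x, H (x, 0) = x) ∧
      (∀ x s, H (x, s) = x ∨ H (x, s) ∈ manifoldInterior n V) ∧
      ∀ x, H (x, 1) ∈ manifoldInterior n V := by
  rcases n with _ | m
  · refine ⟨⟨Prod.fst, continuous_fst⟩, fun _ => rfl, fun _ _ => Or.inl rfl, fun x => ?_⟩
    have := manifoldBoundary_zero hV
    rw [manifoldBoundary, Set.compl_empty_iff] at this
    rw [this]
    trivial
  suffices h : ∃ H : C(V × unitInterval, V), (∀ x, H (x, 0) = x) ∧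
      (∀ x s, H (x, s) = x ∨ H (x, s) ∈ manifoldInterior (m + 1) V) ∧
      ∀ x ∈ manifoldBoundary (m + 1) V, H (x, 1) ∈ manifoldInterior (m + 1) V by
    obtain ⟨H, h0, h1, h2⟩ := h
    refine ⟨H, h0, h1, fun x => ?_⟩
    by_cases hx : x ∈ manifoldInterior (m + 1) V
    · rcases h1 x 1 with h | h
      · rwa [h]
      · exact h
    · exact h2 x hx
  refine (isClosed_manifoldBoundary (V := V) (m + 1)).isCompact.induction_on
    (p := fun S => ∃ H : C(V × unitInterval, V), (∀ x, H (x, 0) = x) ∧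
      (∀ x s, H (x, s) = x ∨ H (x, s) ∈ manifoldInterior (m + 1) V) ∧
      ∀ x ∈ S, H (x, 1) ∈ manifoldInterior (m + 1) V) ?_ ?_ ?_ ?_
  · exact ⟨⟨Prod.fst, continuous_fst⟩, fun _ => rfl, fun _ _ => Or.inl rfl, by simp⟩
  · rintro S T hST ⟨H, h0, h1, h2⟩
    exact ⟨H, h0, h1, fun x hx => h2 x (hST hx)⟩
  · rintro S T ⟨H, h0, h1, h2⟩ ⟨G, g0, g1, g2⟩
    have key : ∀ x s, H (x, s) ∈ manifoldInterior (m + 1) V →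
        G (H (x, s), s) ∈ manifoldInterior (m + 1) V := by
      intro x s h
      rcases g1 (H (x, s)) s with h' | h'
      · rwa [h']
      · exact h'
    refine ⟨pushComp G H, fun x => ?_, fun x s => ?_, fun x hx => ?_⟩
    · change G (H (x, 0), 0) = x
      rw [h0, g0]
    · change G (H (x, s), s) = x ∨ G (H (x, s), s) ∈ _
      rcases h1 x s with h | h
      · rw [h]
        exact g1 x s
      · exact Or.inr (key x s h)
    · change G (H (x, 1), 1) ∈ _
      rcases hx with hx | hx
      · exact key x 1 (h2 x hx)
      · rcases h1 x 1 with h | h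
        · rw [h]
          exact g2 x hx
        · exact key x 1 h
  · intro p hp
    obtain ⟨e, he⟩ := hV.chart p
    obtain ⟨ε, ρ, g, hε, hρ0, hρε, hg1, hg2⟩ := exists_chart_push 1 (by simp) he
    have hpos : ∀ x s, x ∈ e.source → 0 < (s : unitInterval).1 * ρ (e x) →
        g (x, s) ∈ manifoldInterior (m + 1) V := by
      intro x s hx h
      obtain ⟨h1, h2⟩ := hg2 x s hx
      rw [h2]
      refine mem_manifoldInterior_of_pos (e := e) (e.map_target h1) ?_
      rw [e.right_inv h1, halfShift_zero_coord]
      refine lt_max_of_lt_right ?_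
      have := HalfSpace.zero_le (e x)
      linarith
    have hself : ∀ x (s : unitInterval), x ∈ e.source → (s : ℝ) * ρ (e x) = 0 → g (x, s) = x := by
      intro x s hx h
      rw [(hg2 x s hx).2, one_mul, h, halfShift_eq_self, e.left_inv hx]
      rw [add_zero, max_eq_right (HalfSpace.zero_le _)]
    refine ⟨_, mem_nhdsWithin_of_mem_nhds ((e.continuousAt he).preimage_mem_nhds
      (Metric.closedBall_mem_nhds _ hε) |> Filter.inter_mem (e.open_source.mem_nhds he)), g,
      fun x => ?_, fun x s => ?_, fun x hx => ?_⟩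
    · by_cases hx : x ∈ e.source
      · exact hself x 0 hx (by simp)
      · exact hg1 x 0 hx
    · by_cases hx : x ∈ e.source
      · rcases (mul_nonneg s.2.1 (hρ0 (e x))).eq_or_lt with h | h
        · exact Or.inl (hself x s hx h.symm)
        · exact Or.inr (hpos x s hx h)
      · exact Or.inl (hg1 x s hx)
    · refine hpos x 1 hx.1 ?_
      rw [hρε _ hx.2]
      simpa using hε

/-- A neighbourhood of the boundary of a manifold can be pushed into the boundary, relative to the
boundary. -/
lemma exists_outward_push (hV : IsManifoldWithBoundary n V) :
    ∃ H : C(V × unitInterval, V), (∀ x, H (x, 0) = x) ∧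
      (∀ x ∈ manifoldBoundary n V, ∀ s, H (x, s) = x) ∧
      ∃ N, IsOpen N ∧ manifoldBoundary n V ⊆ N ∧ ∀ x ∈ N, H (x, 1) ∈ manifoldBoundary n V := by
  rcases n with _ | m
  · refine ⟨⟨Prod.fst, continuous_fst⟩, fun _ => rfl, fun _ _ _ => rfl, ∅, isOpen_empty, ?_,
      by simp⟩
    rw [manifoldBoundary_zero hV]
  suffices h : ∃ H : C(V × unitInterval, V), (∀ x, H (x, 0) = x) ∧
      (∀ x ∈ manifoldBoundary (m + 1) V, ∀ s, H (x, s) = x) ∧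
      ∀ x ∈ manifoldBoundary (m + 1) V, x ∈ manifoldBoundary (m + 1) V →
        ∀ᶠ y in 𝓝 x, H (y, 1) ∈ manifoldBoundary (m + 1) V by
    obtain ⟨H, h0, h1, h2⟩ := h
    refine ⟨H, h0, h1, interior {y | H (y, 1) ∈ manifoldBoundary (m + 1) V}, isOpen_interior,
      fun x hx => mem_interior_iff_mem_nhds.2 (h2 x hx hx), fun x hx => ?_⟩
    exact interior_subset (s := {y | H (y, 1) ∈ manifoldBoundary (m + 1) V}) hx
  refine (isClosed_manifoldBoundary (V := V) (m + 1)).isCompact.induction_on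
    (p := fun S => ∃ H : C(V × unitInterval, V), (∀ x, H (x, 0) = x) ∧
      (∀ x ∈ manifoldBoundary (m + 1) V, ∀ s, H (x, s) = x) ∧
      ∀ x ∈ S, x ∈ manifoldBoundary (m + 1) V →
        ∀ᶠ y in 𝓝 x, H (y, 1) ∈ manifoldBoundary (m + 1) V) ?_ ?_ ?_ ?_
  · exact ⟨⟨Prod.fst, continuous_fst⟩, fun _ => rfl, fun _ _ _ => rfl, by simp⟩
  · rintro S T hST ⟨H, h0, h1, h2⟩
    exact ⟨H, h0, h1, fun x hx => h2 x (hST hx)⟩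
  · rintro S T ⟨H, h0, h1, h2⟩ ⟨G, g0, g1, g2⟩
    refine ⟨pushComp G H, fun x => ?_, fun x hx s => ?_, fun x hx hxb => ?_⟩
    · change G (H (x, 0), 0) = x
      rw [h0, g0]
    · change G (H (x, s), s) = x
      rw [h1 x hx, g1 x hx]
    · change ∀ᶠ y in 𝓝 x, G (H (y, 1), 1) ∈ _
      rcases hx with hx | hx
      · filter_upwards [h2 x hx hxb] with y hy
        rwa [g1 _ hy]
      · have hc : Filter.Tendsto (fun y => H (y, 1)) (𝓝 x) (𝓝 x) := by
          have : ContinuousAt (fun y => H (y, 1)) x := by fun_prop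
          rw [ContinuousAt, h1 x hxb] at this
          exact this
        exact hc.eventually (g2 x hx hxb)
  · intro p hp
    obtain ⟨e, he⟩ := hV.chart p
    obtain ⟨ε, ρ, g, hε, hρ0, hρε, hg1, hg2⟩ := exists_chart_push (-1) (by simp) he
    refine ⟨e.source ∩ e ⁻¹' Metric.ball (e p) ε, mem_nhdsWithin_of_mem_nhds (Filter.inter_mem
      (e.open_source.mem_nhds he) ((e.continuousAt he).preimage_mem_nhds
        (Metric.ball_mem_nhds _ hε))), g, fun x => ?_, fun x hx s => ?_, fun x hx _ => ?_⟩
    · by_cases hx : x ∈ e.source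
      · rw [(hg2 x 0 hx).2, halfShift_eq_self, e.left_inv hx]
        simp [HalfSpace.zero_le]
      · exact hg1 x 0 hx
    · by_cases hxe : x ∈ e.source
      · rw [(hg2 x s hxe).2, halfShift_eq_self, e.left_inv hxe]
        rw [eq_zero_of_mem_manifoldBoundary hxe hx]
        have := mul_nonneg s.2.1 (hρ0 (e x))
        exact max_eq_left (by linarith)
      · exact hg1 x s hxe
    · have hopen : IsOpen (e.source ∩ e ⁻¹' Metric.ball (e p) ε) :=
        e.isOpen_inter_preimage Metric.isOpen_ball
      filter_upwards [hopen.mem_nhds hx] with y hy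
      obtain ⟨h1, h2⟩ := hg2 y 1 hy.1
      rw [h2]
      refine mem_manifoldBoundary_of_eq_zero (e := e) (e.map_target h1) ?_
      have hd : dist (e y) (e p) < ε := hy.2
      rw [e.right_inv h1, halfShift_zero_coord, hρε _ hd.le]
      refine max_eq_left ?_
      have h3 : |(e y).1 0 - (e p).1 0| ≤ dist (e y) (e p) := by
        rw [Subtype.dist_eq, dist_eq_norm]
        exact PiLp.norm_apply_le ((e y).1 - (e p).1) 0
      rw [eq_zero_of_mem_manifoldBoundary he hp, sub_zero] at h3
      have h4 := le_abs_self ((e y).1 0)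
      simp
      linarith

end Push

/-! ### Locally finite chains and their truncations -/

section LocallyFinite

variable {X Y : Type*} [TopologicalSpace X] [TopologicalSpace Y]

lemma l1Norm_add_le {k : ℕ} (c d : SingularSimplex k X → ℝ) :
    l1Norm (c + d) ≤ l1Norm c + l1Norm d := by
  rw [l1Norm, l1Norm, l1Norm, ← ENNReal.tsum_add]
  exact ENNReal.tsum_le_tsum fun σ => enorm_add_le _ _

lemma l1Norm_single {k : ℕ} (σ : SingularSimplex k X) (a : ℝ) :
    l1Norm (Finsupp.single σ a) = ‖a‖ₑ := by
  rw [l1Norm, tsum_eq_single σ fun τ hτ => by rw [Finsupp.single_eq_of_ne hτ, enorm_zero],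
    Finsupp.single_eq_same]

lemma l1Norm_eq_sum {k : ℕ} (c : Chain ℝ k X) : l1Norm c = ∑ σ ∈ c.support, ‖c σ‖ₑ :=
  tsum_eq_sum fun σ hσ => by rw [Finsupp.notMem_support_iff.1 hσ, enorm_zero]

lemma l1Norm_lt_top {k : ℕ} (c : Chain ℝ k X) : l1Norm c < ⊤ := by
  rw [l1Norm_eq_sum]
  exact ENNReal.sum_lt_top.2 fun σ _ => enorm_lt_top

lemma l1Norm_sum_le {k : ℕ} {ι : Type*} (s : Finset ι) (g : ι → Chain ℝ k X) :
    l1Norm (∑ i ∈ s, g i : Chain ℝ k X) ≤ ∑ i ∈ s, l1Norm (g i) := by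
  classical
  induction s using Finset.induction_on with
  | empty => simp [l1Norm]
  | insert i s hi ih =>
    rw [Finset.sum_insert hi, Finset.sum_insert hi, Finsupp.coe_add]
    exact (l1Norm_add_le _ _).trans (add_le_add_right ih _)

lemma l1Norm_mapDomain_le {k m : ℕ} (f : SingularSimplex k X → SingularSimplex m Y)
    (c : Chain ℝ k X) : l1Norm (Finsupp.mapDomain f c) ≤ l1Norm c := by
  rw [l1Norm_eq_sum c, Finsupp.mapDomain, Finsupp.sum]
  refine (l1Norm_sum_le _ _).trans (Finset.sum_le_sum fun σ _ => ?_)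
  rw [l1Norm_single]

lemma l1Norm_chainMap_le {k : ℕ} (f : C(X, Y)) (c : Chain ℝ k X) :
    l1Norm (chainMap ℝ k f c) ≤ l1Norm c :=
  l1Norm_mapDomain_le _ c

open Classical in
lemma truncate_apply {k : ℕ} {c : SingularSimplex k X → ℝ} (hc : IsLocallyFiniteChain c)
    {K : Set X} (hK : IsCompact K) (σ : SingularSimplex k X) :
    hc.truncate hK σ = if (Set.range σ ∩ K).Nonempty then c σ else 0 := by
  rw [IsLocallyFiniteChain.truncate, Finsupp.ofSupportFinite_coe]

lemma truncate_of_nonempty {k : ℕ} {c : SingularSimplex k X → ℝ} (hc : IsLocallyFiniteChain c)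
    {K : Set X} (hK : IsCompact K) {σ : SingularSimplex k X} (h : (Set.range σ ∩ K).Nonempty) :
    hc.truncate hK σ = c σ := by
  classical
  rw [truncate_apply, if_pos h]

lemma truncate_of_subset {k : ℕ} {c : SingularSimplex k X → ℝ} (hc : IsLocallyFiniteChain c)
    {K : Set X} (hK : IsCompact K) {σ : SingularSimplex k X} (h : Set.range σ ⊆ Kᶜ) :
    hc.truncate hK σ = 0 := by
  classical
  rw [truncate_apply, if_neg]
  rintro ⟨x, hx, hxK⟩
  exact h hx hxK

lemma range_subset_compl_iff {k : ℕ} {K : Set X} {σ : SingularSimplex k X} :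
    ¬ (Set.range σ ∩ K).Nonempty ↔ Set.range σ ⊆ Kᶜ := by
  rw [Set.not_nonempty_iff_eq_empty, ← Set.disjoint_iff_inter_eq_empty,
    Set.subset_compl_iff_disjoint_right]

lemma mem_chainsIn_compl {k : ℕ} {K : Set X} {w : Chain ℝ k X}
    (h : ∀ σ : SingularSimplex k X, (Set.range σ ∩ K).Nonempty → w σ = 0) :
    w ∈ chainsIn ℝ k Kᶜ := by
  rw [chainsIn, Finsupp.mem_supported]
  intro σ hσ
  rw [Set.mem_ofPred_eq, ← range_subset_compl_iff]
  exact fun hne => Finsupp.mem_support_iff.1 hσ (h σ hne)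

lemma l1Norm_truncate_le {k : ℕ} {c : SingularSimplex k X → ℝ} (hc : IsLocallyFiniteChain c)
    {K : Set X} (hK : IsCompact K) : l1Norm (hc.truncate hK) ≤ l1Norm c := by
  classical
  refine ENNReal.tsum_le_tsum fun σ => ?_
  rw [truncate_apply]
  split_ifs
  · exact le_rfl
  · simp

lemma truncate_sub_mem {k : ℕ} {c : SingularSimplex k X → ℝ} (hc : IsLocallyFiniteChain c)
    {K K' : Set X} (hK : IsCompact K) (hK' : IsCompact K') (h : K ⊆ K') :
    hc.truncate hK' - hc.truncate hK ∈ chainsIn ℝ k Kᶜ := by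
  refine mem_chainsIn_compl fun σ hσ => ?_
  rw [Finsupp.sub_apply, truncate_of_nonempty hc hK hσ,
    truncate_of_nonempty hc hK' (hσ.mono (Set.inter_subset_inter_right _ h)), sub_self]

/-- The boundary of a finite chain, regarded as a locally finite chain. -/
lemma lfBoundary_coe {k : ℕ} (w : Chain ℝ (k + 1) X) :
    lfBoundary (w : SingularSimplex (k + 1) X → ℝ) = boundary ℝ k X w := by
  classical
  funext τ
  rw [lfBoundary, boundary, LinearMap.sum_apply, Finsupp.finsetSum_apply]
  refine Finset.sum_congr rfl fun i _ => ?_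
  rw [LinearMap.smul_apply, Finsupp.smul_apply, smul_eq_mul, Finsupp.lmapDomain_apply,
    Finsupp.mapDomain, Finsupp.sum, Finsupp.finsetSum_apply]
  congr 1
  have h1 : ∑ᶠ σ : {σ : SingularSimplex (k + 1) X // face i σ = τ}, w σ.1 =
      ∑ᶠ σ ∈ {σ : SingularSimplex (k + 1) X | face i σ = τ}, w σ :=
    finsum_set_coe_eq_finsum_mem (f := fun σ => w σ) {σ : SingularSimplex (k + 1) X | face i σ = τ}
  rw [h1, finsum_mem_eq_sum_of_inter_support_eq (t := w.support.filter fun σ => face i σ = τ),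
    Finset.sum_filter]
  · refine Finset.sum_congr rfl fun σ _ => ?_
    rw [Finsupp.single_apply]
  · ext σ
    simp only [Set.mem_inter_iff, Set.mem_ofPred_eq, Function.mem_support, Finset.coe_filter,
      Finsupp.mem_support_iff]
    tauto

lemma lfBoundary_congr {k : ℕ} {c d : SingularSimplex (k + 1) X → ℝ} {τ : SingularSimplex k X}
    (h : ∀ σ : SingularSimplex (k + 1) X, Set.range τ ⊆ Set.range σ → c σ = d σ) :
    lfBoundary c τ = lfBoundary d τ := by
  rw [lfBoundary, lfBoundary]
  refine Finset.sum_congr rfl fun i _ => ?_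
  congr 1
  refine finsum_congr fun σ => h σ.1 ?_
  conv_lhs => rw [← σ.2]
  exact range_face_subset i σ.1

lemma lfBoundary_add {k : ℕ} {c d : SingularSimplex (k + 1) X → ℝ} (hc : IsLocallyFiniteChain c)
    (hd : IsLocallyFiniteChain d) : lfBoundary (c + d) = lfBoundary c + lfBoundary d := by
  funext τ
  rw [Pi.add_apply, lfBoundary, lfBoundary, lfBoundary, ← Finset.sum_add_distrib]
  refine Finset.sum_congr rfl fun i _ => ?_
  rw [← mul_add, ← finsum_add_distrib (hc.finite_support i τ) (hd.finite_support i τ)]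
  rfl

lemma isLocallyFiniteChain_coe {k : ℕ} (w : Chain ℝ k X) :
    IsLocallyFiniteChain (w : SingularSimplex k X → ℝ) := fun _ _ =>
  w.support.finite_toSet.subset fun _ hσ => Finsupp.mem_support_iff.2 hσ.1

lemma IsLocallyFiniteChain.add {k : ℕ} {c d : SingularSimplex k X → ℝ}
    (hc : IsLocallyFiniteChain c) (hd : IsLocallyFiniteChain d) : IsLocallyFiniteChain (c + d) := by
  intro K hK
  refine ((hc K hK).union (hd K hK)).subset fun σ hσ => ?_
  by_cases h : c σ = 0
  · refine Or.inr ⟨fun h' => hσ.1 ?_, hσ.2⟩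
    rw [Pi.add_apply, h, h', add_zero]
  · exact Or.inl ⟨h, hσ.2⟩

/-- The truncation of a locally finite cycle to `K` is a cycle relative to the complement of
`K`. -/
lemma truncate_mem_relCycles {k : ℕ} {c : SingularSimplex k X → ℝ} (hc : IsLocallyFiniteCycle c)
    {K : Set X} (hK : IsCompact K) :
    hc.isLocallyFiniteChain.truncate hK ∈ relCycles ℝ Kᶜ k := by
  cases k with
  | zero => trivial
  | succ k =>
    rw [mem_relCycles_succ]
    refine mem_chainsIn_compl fun τ hτ => ?_
    rw [← lfBoundary_coe, lfBoundary_congr (d := c), hc.2, Pi.zero_apply]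
    intro σ hσ
    exact truncate_of_nonempty _ hK (hτ.mono (Set.inter_subset_inter_left _ hσ))

lemma Represents.add {k : ℕ} {A : Set X} {c d : Chain ℝ k X} {α : RelHomology ℝ A k}
    (hc : Represents c α) (hd : d ∈ relBoundaries ℝ A k) : Represents (c + d) α := by
  obtain ⟨h, rfl⟩ := hc
  refine ⟨Submodule.add_mem _ h (relBoundaries_le_relCycles hd), ?_⟩
  rw [RelHomology.mk, Submodule.Quotient.eq]
  change c + d - c ∈ relBoundaries ℝ A k
  rwa [add_sub_cancel_left]

lemma Represents.sub_mem {k : ℕ} {A : Set X} {c d : Chain ℝ k X} {α : RelHomology ℝ A k}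
    (hc : Represents c α) (hd : Represents d α) : c - d ∈ relBoundaries ℝ A k := by
  obtain ⟨h, rfl⟩ := hc
  obtain ⟨h', e⟩ := hd
  exact (Submodule.Quotient.eq ((relBoundaries ℝ A k).submoduleOf (relCycles ℝ A k))).1 e.symm

lemma Represents.map {k : ℕ} {A : Set X} {c : Chain ℝ k X} {α : RelHomology ℝ A k}
    (hc : Represents c α) (f : C(X, Y)) {B : Set Y} (hf : Set.MapsTo f A B) :
    Represents (chainMap ℝ k f c) (RelHomology.map ℝ f hf k α) := by
  obtain ⟨h, rfl⟩ := hc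
  exact ⟨chainMap_mem_relCycles ℝ f hf k h, rfl⟩

lemma Represents.restrict {k : ℕ} {A B : Set X} {c : Chain ℝ k X} {α : RelHomology ℝ A k}
    (hc : Represents c α) (h : A ⊆ B) : Represents c (RelHomology.restrict ℝ h k α) := by
  have := hc.map (ContinuousMap.id X) (B := B) fun _ hx => h hx
  rwa [chainMap_id] at this

/-- Locally finite fundamental cycles may be changed by finite cycles that are homologically
trivial at every point. -/
lemma IsLFFundamentalCycle.add {m : ℕ} {o : ManifoldOrientation (m + 1) X}
    {c : SingularSimplex (m + 1) X → ℝ} (hc : IsLFFundamentalCycle o c) {d : Chain ℝ (m + 1) X}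
    (hd : boundary ℝ m X d = 0) (hdx : ∀ x : X, d ∈ relBoundaries ℝ {x}ᶜ (m + 1)) :
    IsLFFundamentalCycle o (c + d) := by
  obtain ⟨hcyc, hrep⟩ := hc
  have hlf := hcyc.isLocallyFiniteChain.add (isLocallyFiniteChain_coe d)
  have hcyc' : IsLocallyFiniteCycle (c + ⇑d) := by
    refine ⟨hlf, ?_⟩
    rw [lfBoundary_add hcyc.isLocallyFiniteChain (isLocallyFiniteChain_coe d), hcyc.2,
      lfBoundary_coe, hd, Finsupp.coe_zero, add_zero]
  refine ⟨hcyc', fun x => ?_⟩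
  have hx : IsCompact ({x} : Set X) := isCompact_singleton
  have e : hcyc'.isLocallyFiniteChain.truncate hx - (hcyc.isLocallyFiniteChain.truncate hx + d) ∈
      chainsIn ℝ (m + 1) ({x} : Set X)ᶜ := by
    refine mem_chainsIn_compl fun σ hσ => ?_
    rw [Finsupp.sub_apply, Finsupp.add_apply, truncate_of_nonempty _ hx hσ,
      truncate_of_nonempty _ hx hσ, Pi.add_apply, sub_self]
  have := (hrep x).add (Submodule.add_mem _ (hdx x) (chainsIn_le_relBoundaries e))
  convert this using 1
  abel

end LocallyFinite

/-! ### From locally finite cycles to relative cycles -/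

section RelativeCycle

variable {n : ℕ} {V : Type*} [TopologicalSpace V]

lemma isCompact_preimage_interior {L : Set V} (hL : IsCompact L) (h : L ⊆ manifoldInterior n V) :
    IsCompact (interiorInclusion n V ⁻¹' L) :=
  ((isOpen_manifoldInterior n).isOpenEmbedding_subtypeVal.isInducing.isCompact_preimage' hL
    (by rwa [Subtype.range_coe]))

/-- An outward push: a homotopy of the identity relative to the boundary, which moves the
complement of the compact subset `L` of the interior into the boundary. -/
structure IsOutwardPush (n : ℕ) (H : C(V × unitInterval, V)) (L : Set V) : Prop where
  zero : ∀ x, H (x, 0) = x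
  boundary : ∀ x ∈ manifoldBoundary n V, ∀ s, H (x, s) = x
  isCompact : IsCompact L
  subset : L ⊆ manifoldInterior n V
  one : ∀ x ∉ L, H (x, 1) ∈ manifoldBoundary n V

variable {H : C(V × unitInterval, V)} {L : Set V}

lemma IsOutwardPush.timeMap_zero (hH : IsOutwardPush n H L) :
    timeMap H 0 = ContinuousMap.id V := ContinuousMap.ext hH.zero

lemma IsOutwardPush.isCompact_preimage (hH : IsOutwardPush n H L) :
    IsCompact (interiorInclusion n V ⁻¹' L) := isCompact_preimage_interior hH.isCompact hH.subset

/-- The relative cycle of `(V, ∂V)` obtained from a locally finite cycle of the interior. -/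
def IsOutwardPush.pushedCycle (hH : IsOutwardPush n H L)
    {c : SingularSimplex n (manifoldInterior n V) → ℝ} (hc : IsLocallyFiniteChain c) :
    Chain ℝ n V :=
  chainMap ℝ n ((timeMap H 1).comp (interiorInclusion n V)) (hc.truncate hH.isCompact_preimage)

lemma IsOutwardPush.mapsTo (hH : IsOutwardPush n H L) :
    Set.MapsTo ((timeMap H 1).comp (interiorInclusion n V)) (interiorInclusion n V ⁻¹' L)ᶜ
      (manifoldBoundary n V) := fun x hx => hH.one x hx

lemma IsOutwardPush.pushedCycle_mem (hH : IsOutwardPush n H L)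
    {c : SingularSimplex n (manifoldInterior n V) → ℝ} (hc : IsLocallyFiniteCycle c) :
    hH.pushedCycle hc.isLocallyFiniteChain ∈ relCycles ℝ (manifoldBoundary n V) n :=
  chainMap_mem_relCycles ℝ _ hH.mapsTo n (truncate_mem_relCycles hc _)

/-- The pushed cycle has the local classes of the original one: the homotopy tracks through a point
start in a compact subset of the interior. -/
lemma IsOutwardPush.pushedCycle_sub_mem [CompactSpace V] [T2Space V] (hH : IsOutwardPush n H L)
    {c : SingularSimplex n (manifoldInterior n V) → ℝ} (hc : IsLocallyFiniteCycle c)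
    (x : manifoldInterior n V) :
    hH.pushedCycle hc.isLocallyFiniteChain - chainMap ℝ n (interiorInclusion n V)
      (hc.isLocallyFiniteChain.truncate (isCompact_singleton (x := x))) ∈
      relBoundaries ℝ {(x : V)}ᶜ n := by
  let T : Set V := Prod.fst '' (H ⁻¹' {(x : V)})
  have hT : IsCompact T :=
    (isClosed_singleton.preimage H.continuous).isCompact.image continuous_fst
  have hTi : T ⊆ manifoldInterior n V := by
    rintro _ ⟨⟨y, s⟩, hy, rfl⟩
    by_contra h
    have h1 : y = x := by
      rw [← hH.boundary y h s]
      exact hy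
    exact h (h1 ▸ x.2)
  have hK' : IsCompact (interiorInclusion n V ⁻¹' L ∪ interiorInclusion n V ⁻¹' T ∪ {x}) :=
    (hH.isCompact_preimage.union (isCompact_preimage_interior hT hTi)).union isCompact_singleton
  set w := hc.isLocallyFiniteChain.truncate hK' with hw
  have h1 := truncate_mem_relCycles hc hK'
  have h2 : chainMap ℝ n (interiorInclusion n V) w ∈ relCycles ℝ Tᶜ n :=
    chainMap_mem_relCycles ℝ _ (B := Tᶜ)
      (show Set.MapsTo (interiorInclusion n V)
        (interiorInclusion n V ⁻¹' L ∪ interiorInclusion n V ⁻¹' T ∪ {x})ᶜ Tᶜ from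
        fun _ hy hyT => hy (Or.inl (Or.inr hyT))) n h1
  have h3 := timeMap_sub_mem_relBoundaries (F := H) (A := Tᶜ) (B := {(x : V)}ᶜ)
    (fun y hy s h => hy ⟨(y, s), h, rfl⟩) h2
  rw [hH.timeMap_zero, chainMap_id, chainMap_comp] at h3
  have h4 : chainMap ℝ n ((timeMap H 1).comp (interiorInclusion n V)) w -
      hH.pushedCycle hc.isLocallyFiniteChain ∈ chainsIn ℝ n {(x : V)}ᶜ := by
    rw [IsOutwardPush.pushedCycle, ← map_sub]
    refine chainMap_mem_chainsIn ℝ n _ (fun y hy => manifoldBoundary_subset x (hH.mapsTo hy))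
      (truncate_sub_mem _ _ _ ?_)
    exact fun y hy => Or.inl (Or.inl hy)
  have h5 : chainMap ℝ n (interiorInclusion n V) w - chainMap ℝ n (interiorInclusion n V)
      (hc.isLocallyFiniteChain.truncate (isCompact_singleton (x := x))) ∈
      chainsIn ℝ n {(x : V)}ᶜ := by
    rw [← map_sub]
    exact chainMap_mem_chainsIn ℝ n _ (mapsTo_interiorInclusion x)
      (truncate_sub_mem _ _ _ (fun y hy => Or.inr hy))
  have := Submodule.add_mem _ (Submodule.sub_mem _ h3 (chainsIn_le_relBoundaries h4))
    (chainsIn_le_relBoundaries h5)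
  convert this using 1
  abel

/-- A relative cycle that is trivial at every interior point is a relative boundary: the relative
fundamental class is unique. -/
lemma IsOutwardPush.mem_relBoundaries [CompactSpace V] [T2Space V] (hH : IsOutwardPush n H L)
    {z : Chain ℝ n V} (hz : z ∈ relCycles ℝ (manifoldBoundary n V) n)
    (hx : ∀ x : manifoldInterior n V, z ∈ relBoundaries ℝ {(x : V)}ᶜ n) :
    z ∈ relBoundaries ℝ (manifoldBoundary n V) n := by
  have h1 : z ∈ relBoundaries ℝ Lᶜ n :=
    (locallyDetermined_of_isCompact hH.isCompact fun x hxL => hH.subset hxL).2 z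
      (relCycles_mono (Set.compl_subset_compl.2 hH.subset) hz)
      fun x hxL => hx ⟨x, hH.subset hxL⟩
  have h2 := chainMap_mem_relBoundaries ℝ (timeMap H 1) (B := manifoldBoundary n V)
    (fun x hx => hH.one x hx) n h1
  have h3 := timeMap_sub_mem_relBoundaries (F := H) (A := manifoldBoundary n V)
    (B := manifoldBoundary n V) (fun x hx s => by rwa [hH.boundary x hx s]) hz
  rw [hH.timeMap_zero, chainMap_id] at h3
  have := Submodule.sub_mem _ h2 h3
  rwa [sub_sub_cancel] at this

lemma exists_isOutwardPush [CompactSpace V] (hV : IsManifoldWithBoundary n V) :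
    ∃ (H : C(V × unitInterval, V)) (L : Set V), IsOutwardPush n H L := by
  have := hV.t2
  obtain ⟨H, h0, h1, N, hN, hNb, h2⟩ := exists_outward_push hV
  refine ⟨H, Nᶜ, h0, h1, hN.isClosed_compl.isCompact, ?_, fun x hx => h2 x (not_not.1 hx)⟩
  rw [manifoldBoundary] at hNb
  exact Set.compl_subset_comm.1 hNb

variable {o : ManifoldOrientation n (manifoldInterior n V)}

/-- The class of the pushed cycle is the relative fundamental class. -/
lemma IsOutwardPush.isRelFundamentalClass [CompactSpace V] [T2Space V] (hH : IsOutwardPush n H L)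
    {c : SingularSimplex n (manifoldInterior n V) → ℝ} (hc : IsLFFundamentalCycle o c) :
    IsRelFundamentalClass o (RelHomology.mk ⟨_, hH.pushedCycle_mem hc.1⟩) := by
  obtain ⟨hcyc, hrep⟩ := hc
  intro x
  have h1 := (hrep x).map (interiorInclusion n V) (mapsTo_interiorInclusion x)
  have h2 := h1.add (hH.pushedCycle_sub_mem hcyc x)
  rw [add_sub_cancel] at h2
  have h3 : Represents (hH.pushedCycle hcyc.isLocallyFiniteChain)
      (RelHomology.mk ⟨_, hH.pushedCycle_mem hcyc⟩) := ⟨_, rfl⟩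
  obtain ⟨_, e1⟩ := h3.restrict (manifoldBoundary_subset x)
  obtain ⟨_, e2⟩ := h2
  rw [← e1, ← e2]

lemma IsOutwardPush.sub_pushedCycle_mem [CompactSpace V] [T2Space V] (hH : IsOutwardPush n H L)
    {c : SingularSimplex n (manifoldInterior n V) → ℝ} (hc : IsLFFundamentalCycle o c)
    {α : RelHomology ℝ (manifoldBoundary n V) n} (hα : IsRelFundamentalClass o α)
    {z : Chain ℝ n V} (hz : Represents z α) :
    z - hH.pushedCycle hc.1.isLocallyFiniteChain ∈ relBoundaries ℝ (manifoldBoundary n V) n := by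
  refine hH.mem_relBoundaries (Submodule.sub_mem _ hz.1 (hH.pushedCycle_mem hc.1)) fun x => ?_
  have h1 := hz.restrict (manifoldBoundary_subset x)
  have h3 : Represents (hH.pushedCycle hc.1.isLocallyFiniteChain)
      (RelHomology.mk ⟨_, hH.pushedCycle_mem hc.1⟩) := ⟨_, rfl⟩
  have h2 := h3.restrict (manifoldBoundary_subset x)
  rw [hH.isRelFundamentalClass hc x, ← hα x] at h2
  exact h1.sub_mem h2

/-- Truncating and pushing outwards does not increase norms. -/
lemma relVolume_le_lfVolume [CompactSpace V] (hV : IsManifoldWithBoundary n V) :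
    relVolume o ≤ lfVolume o := by
  have := hV.t2
  obtain ⟨H, L, hH⟩ := exists_isOutwardPush hV
  refine le_iInf₂ fun c hc => ?_
  refine (iInf₂_le _ (hH.isRelFundamentalClass hc)).trans ?_
  refine (iInf₂_le (hH.pushedCycle hc.1.isLocallyFiniteChain) ⟨_, rfl⟩).trans ?_
  exact (l1Norm_chainMap_le _ _).trans (l1Norm_truncate_le _ _)

end RelativeCycle

/-! ### Pairing bounded cochains with summable chains -/

section Pairing

variable {X Y : Type*} [TopologicalSpace X] [TopologicalSpace Y]

lemma hasSum_of_eq {β : Type*} {f g : β → ℝ} {a : ℝ} (h : HasSum f a) (e : ∀ b, g b = f b) :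
    HasSum g a := by
  rwa [funext e]

/-- The evaluation of a cochain on finite chains. -/
def ev {k : ℕ} (f : SingularSimplex k X → ℝ) : Chain ℝ k X →ₗ[ℝ] ℝ :=
  Finsupp.linearCombination ℝ f

lemma ev_single {k : ℕ} (f : SingularSimplex k X → ℝ) (σ : SingularSimplex k X) (a : ℝ) :
    ev f (Finsupp.single σ a) = a * f σ := by
  simp [ev]

lemma coboundary_apply {k : ℕ} (f : SingularSimplex k X → ℝ) (σ : SingularSimplex (k + 1) X) :
    coboundary k X f σ = ∑ i : Fin (k + 2), (-1 : ℝ) ^ (i : ℕ) * f (face i σ) := rfl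

lemma ev_boundary {k : ℕ} (f : SingularSimplex k X → ℝ) (c : Chain ℝ (k + 1) X) :
    ev f (boundary ℝ k X c) = ev (coboundary k X f) c := by
  refine LinearMap.congr_fun (f := ev f ∘ₗ boundary ℝ k X) (Finsupp.lhom_ext fun σ a => ?_) c
  rw [LinearMap.comp_apply, boundary_single, map_sum, ev_single, coboundary_apply, Finset.mul_sum]
  refine Finset.sum_congr rfl fun i _ => ?_
  rw [map_smul, ev_single, smul_eq_mul]
  ring

lemma ev_chainMap {k : ℕ} (f : SingularSimplex k Y → ℝ) (g : C(X, Y)) (c : Chain ℝ k X) :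
    ev f (chainMap ℝ k g c) = ev (fun σ => f (g.comp σ)) c := by
  refine LinearMap.congr_fun (f := ev f ∘ₗ chainMap ℝ k g) (Finsupp.lhom_ext fun σ a => ?_) c
  rw [LinearMap.comp_apply, chainMap_single, ev_single, ev_single]

lemma l1Norm_toReal {k : ℕ} (c : SingularSimplex k X → ℝ) : (l1Norm c).toReal = ∑' σ, |c σ| := by
  rw [l1Norm, ENNReal.tsum_toReal_eq fun _ => enorm_ne_top]
  simp

lemma summable_abs {k : ℕ} {c : SingularSimplex k X → ℝ} (hc : l1Norm c < ⊤) :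
    Summable fun σ => |c σ| := by
  have := ENNReal.summable_toReal hc.ne
  simpa using this

lemma summable_mul {k : ℕ} {c : SingularSimplex k X → ℝ} (hc : l1Norm c < ⊤)
    {f : SingularSimplex k X → ℝ} {C : ℝ} (hf : ∀ σ, |f σ| ≤ C) :
    Summable fun σ => f σ * c σ := by
  refine Summable.of_norm_bounded ((summable_abs hc).mul_left C) fun σ => ?_
  rw [Real.norm_eq_abs, abs_mul]
  exact mul_le_mul_of_nonneg_right (hf σ) (abs_nonneg _)

lemma ev_eq_tsum {k : ℕ} (f : SingularSimplex k X → ℝ) (c : Chain ℝ k X) :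
    ev f c = ∑' σ, f σ * c σ := by
  rw [ev, Finsupp.linearCombination_apply, Finsupp.sum,
    tsum_eq_sum (s := c.support) fun σ hσ => by rw [Finsupp.notMem_support_iff.1 hσ, mul_zero]]
  exact Finset.sum_congr rfl fun σ _ => mul_comm _ _

lemma abs_ev_le {k : ℕ} {f : SingularSimplex k X → ℝ} {C : ℝ} (hf : ∀ σ, |f σ| ≤ C)
    (c : Chain ℝ k X) : |ev f c| ≤ C * (l1Norm c).toReal := by
  rw [ev_eq_tsum, l1Norm_toReal, ← tsum_mul_left]
  refine tsum_of_norm_bounded (f := fun σ => f σ * c σ)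
    ((summable_abs (l1Norm_lt_top c)).mul_left C).hasSum fun σ => ?_
  rw [Real.norm_eq_abs, abs_mul]
  exact mul_le_mul_of_nonneg_right (hf σ) (abs_nonneg _)

/-- Coboundaries of bounded cochains vanish on summable locally finite cycles. -/
lemma tsum_coboundary_mul {k : ℕ} {c : SingularSimplex (k + 1) X → ℝ}
    (hc : IsLocallyFiniteChain c) (hb : lfBoundary c = 0) (hfin : l1Norm c < ⊤)
    {h : SingularSimplex k X → ℝ} {C : ℝ} (hh : ∀ τ, |h τ| ≤ C) :
    ∑' σ, coboundary k X h σ * c σ = 0 := by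
  have hs : ∀ i : Fin (k + 2), Summable fun σ : SingularSimplex (k + 1) X => h (face i σ) * c σ :=
    fun i => summable_mul hfin fun σ => hh (face i σ)
  have h1 : HasSum (fun σ => coboundary k X h σ * c σ)
      (∑ i : Fin (k + 2), (-1 : ℝ) ^ (i : ℕ) * ∑' σ, h (face i σ) * c σ) := by
    have := hasSum_sum (s := Finset.univ) fun (i : Fin (k + 2)) _ =>
      (hs i).hasSum.mul_left ((-1 : ℝ) ^ (i : ℕ))
    refine hasSum_of_eq this fun σ => ?_
    rw [coboundary_apply, Finset.sum_mul]
    exact Finset.sum_congr rfl fun i _ => mul_assoc _ _ _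
  have h2 : HasSum (fun τ => h τ * lfBoundary c τ)
      (∑ i : Fin (k + 2), (-1 : ℝ) ^ (i : ℕ) * ∑' σ, h (face i σ) * c σ) := by
    have := hasSum_sum (s := Finset.univ) fun (i : Fin (k + 2)) _ =>
      ((hs i).hasSum.tsum_fiberwise (face i)).mul_left ((-1 : ℝ) ^ (i : ℕ))
    refine hasSum_of_eq this fun τ => ?_
    rw [lfBoundary, Finset.mul_sum]
    refine Finset.sum_congr rfl fun i _ => ?_
    rw [mul_left_comm]
    congr 1
    have e : ∀ σ : face i ⁻¹' {τ}, h (face i σ.1) * c σ.1 = h τ * c σ.1 := fun σ => by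
      rw [show face i σ.1 = τ from σ.2]
    rw [tsum_congr e, tsum_mul_left]
    congr 1
    exact (tsum_eq_finsum (L := SummationFilter.unconditional
      {σ : SingularSimplex (k + 1) X // face i σ = τ}) (hc.finite_support i τ)).symm
  rw [h1.tsum_eq]
  simpa [hb] using h2.tsum_eq.symm

/-- Homotopic maps pull bounded cocycles back to cocycles which differ by the coboundary of a
bounded cochain. -/
lemma exists_coboundary_eq_sub {k : ℕ} {f : SingularSimplex (k + 1) Y → ℝ} {C : ℝ}
    (hf : ∀ σ, |f σ| ≤ C) (hcoc : coboundary (k + 1) Y f = 0) (F : C(X × unitInterval, Y)) :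
    ∃ h : SingularSimplex k X → ℝ, (∃ D : ℝ, ∀ τ, |h τ| ≤ D) ∧ ∀ σ, coboundary k X h σ =
      f ((timeMap F 1).comp σ) - f ((timeMap F 0).comp σ) := by
  refine ⟨fun τ => ev f (prism (homotopyFamily F) k (Finsupp.single τ 1)),
    ⟨|C| * (l1Norm (prismChain k)).toReal, fun τ => ?_⟩, fun σ => ?_⟩
  · beta_reduce
    rw [prism_single, one_smul]
    refine (abs_ev_le (fun σ => (hf σ).trans (le_abs_self C)) _).trans
      (mul_le_mul_of_nonneg_left ?_ (abs_nonneg C))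
    exact ENNReal.toReal_mono (l1Norm_lt_top _).ne (l1Norm_chainMap_le _ _)
  · have h1 := congrArg (ev f) (boundary_prism (naturalHomotopy_homotopyFamily F)
      (Finsupp.single σ 1))
    rw [ev_boundary, hcoc, map_sub, map_sub, homotopyAt_single, homotopyAt_single, ev_single,
      ev_single, one_mul, one_mul, boundary_single, map_sum, map_sum] at h1
    have h2 : ev (0 : SingularSimplex (k + 2) Y → ℝ)
        (prism (homotopyFamily F) (k + 1) (Finsupp.single σ 1)) = 0 := by
      rw [ev_eq_tsum]
      simp
    rw [h2] at h1
    rw [coboundary_apply]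
    have h3 : ∑ i : Fin (k + 2), (-1 : ℝ) ^ (i : ℕ) *
        ev f (prism (homotopyFamily F) k (Finsupp.single (face i σ) 1)) =
        ∑ i : Fin (k + 2), ev f (prism (homotopyFamily F) k
          ((-1 : ℝ) ^ (i : ℕ) • Finsupp.single (face i σ) 1)) :=
      Finset.sum_congr rfl fun i _ => by rw [map_smul, map_smul, smul_eq_mul]
    rw [h3]
    exact (sub_eq_zero.1 h1.symm).symm

end Pairing

/-! ### The duality principle -/

section Duality

variable {X : Type*} [TopologicalSpace X]

/-- The Banach space of summable chains. -/
abbrev SummableChain (k : ℕ) (X : Type*) [TopologicalSpace X] : Type _ :=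
  lp (fun _ : SingularSimplex k X => ℝ) 1

lemma l1Norm_coe {k : ℕ} (c : SummableChain k X) : l1Norm (c : SingularSimplex k X → ℝ) =
    ENNReal.ofReal ‖c‖ := by
  have h1 : ‖c‖ = ∑' σ, |c σ| := by
    rw [lp.norm_eq_tsum_rpow (by simp)]
    simp
  have h2 := (memℓp_gen_iff (by simp)).1 c.2
  simp only [ENNReal.toReal_one, Real.rpow_one, Real.norm_eq_abs] at h2
  rw [h1, ENNReal.ofReal_tsum_of_nonneg (fun _ => abs_nonneg _) h2, l1Norm]
  exact tsum_congr fun σ => Real.enorm_eq_ofReal_abs _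

open Classical in
/-- Finite chains as summable chains. -/
def toSummable (k : ℕ) (X : Type*) [TopologicalSpace X] : Chain ℝ k X →ₗ[ℝ] SummableChain k X :=
  Finsupp.lsum ℝ fun σ => (lp.singleContinuousLinearMap ℝ (fun _ => ℝ) 1 σ).toLinearMap

open Classical in
lemma toSummable_single {k : ℕ} (σ : SingularSimplex k X) (a : ℝ) :
    toSummable k X (Finsupp.single σ a) = lp.single (E := fun _ => ℝ) 1 σ a := by
  simp [toSummable]

lemma toSummable_coe {k : ℕ} (c : Chain ℝ k X) :
    (toSummable k X c : SingularSimplex k X → ℝ) = c := by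
  classical
  induction c using Finsupp.induction_linear with
  | zero => rw [map_zero, lp.coeFn_zero, Finsupp.coe_zero]
  | add f g hf hg => rw [map_add, lp.coeFn_add, hf, hg, Finsupp.coe_add]
  | single σ a =>
    rw [toSummable_single]
    funext τ
    rw [lp.single_apply, Finsupp.single_apply, Pi.single_apply]
    simp only [eq_comm]

/-- The Hahn–Banach theorem: if all cocycles bounded by one take values at most `r` on the summable
chain `c`, then finite boundaries can be added to `c` to bring its norm arbitrarily close
to `r`. -/
lemma exists_l1Norm_add_boundary_lt {k : ℕ} {c : SingularSimplex k X → ℝ} (hc : l1Norm c < ⊤)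
    {r r' : ℝ} (hr : r < r')
    (h : ∀ f : SingularSimplex k X → ℝ, (∀ σ, |f σ| ≤ 1) → coboundary k X f = 0 →
      |∑' σ, f σ * c σ| ≤ r) :
    ∃ b : Chain ℝ (k + 1) X, l1Norm (c + ⇑(boundary ℝ k X b)) < ENNReal.ofReal r' := by
  classical
  let S : Submodule ℝ (SummableChain k X) := LinearMap.range (toSummable k X ∘ₗ boundary ℝ k X)
  have hmem : Memℓp (E := fun _ : SingularSimplex k X => ℝ) c 1 := by
    refine (memℓp_gen_iff (by simp)).2 ?_
    simpa using summable_abs hc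
  let c' : SummableChain k X := ⟨c, hmem⟩
  obtain ⟨g, hg, hgc⟩ := exists_dual_vector'' ℝ (Submodule.Quotient.mk c' : SummableChain k X ⧸ S)
  let G : SummableChain k X →ₗ[ℝ] ℝ := g.toLinearMap ∘ₗ S.mkQ
  have hG : ∀ x, |G x| ≤ ‖x‖ := fun x =>
    (g.le_of_opNorm_le hg _).trans ((one_mul _).trans_le (Submodule.Quotient.norm_mk_le S x))
  have hGc : Continuous G := AddMonoidHomClass.continuous_of_bound G 1 fun x => by
    rw [one_mul]
    exact hG x
  let f : SingularSimplex k X → ℝ := fun σ => G (lp.single 1 σ (1 : ℝ))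
  have hGf : ∀ σ (a : ℝ), G (lp.single 1 σ a) = f σ * a := fun σ a => by
    rw [mul_comm, ← smul_eq_mul, ← map_smul, ← lp.single_smul, smul_eq_mul, mul_one]
  have hGe : ∀ w : Chain ℝ k X, G (toSummable k X w) = ev f w := fun w => by
    refine LinearMap.congr_fun (f := G ∘ₗ toSummable k X) (Finsupp.lhom_ext fun σ a => ?_) w
    rw [LinearMap.comp_apply, toSummable_single, hGf, ev_single, mul_comm]
  have h1 : ∀ σ, |f σ| ≤ 1 := fun σ => (hG _).trans_eq (by
    rw [lp.norm_single zero_lt_one, norm_one])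
  have h2 : coboundary k X f = 0 := by
    funext σ
    have e := ev_boundary f (Finsupp.single σ 1)
    rw [ev_single, one_mul, ← hGe] at e
    rw [← e]
    have : S.mkQ (toSummable k X (boundary ℝ k X (Finsupp.single σ 1))) = 0 :=
      (Submodule.Quotient.mk_eq_zero S).2 ⟨_, rfl⟩
    change g (S.mkQ _) = 0
    rw [this, map_zero]
  have h3 : ∑' σ, f σ * c σ = ‖(Submodule.Quotient.mk c' : SummableChain k X ⧸ S)‖ := by
    have := (lp.hasSum_single ENNReal.one_ne_top c').map G hGc
    exact (HasSum.tsum_eq (hasSum_of_eq this fun σ => (hGf σ _).symm)).trans hgc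
  have h4 := h f h1 h2
  rw [h3, abs_of_nonneg (norm_nonneg _)] at h4
  obtain ⟨y, hy, hyn⟩ := Submodule.Quotient.norm_mk_lt
    (Submodule.Quotient.mk c' : SummableChain k X ⧸ S) (sub_pos.2 hr)
  obtain ⟨b, hb⟩ := (Submodule.Quotient.eq S).1 hy
  refine ⟨b, ?_⟩
  have e : (y : SingularSimplex k X → ℝ) = c + boundary ℝ k X b := by
    have : y = c' + toSummable k X (boundary ℝ k X b) := by
      rw [← sub_eq_iff_eq_add']
      exact hb.symm
    rw [this, lp.coeFn_add, toSummable_coe]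
  rw [← e, l1Norm_coe]
  exact (ENNReal.ofReal_lt_ofReal_iff_of_nonneg (norm_nonneg _)).2 (by linarith)

end Duality

/-! ### Removing the boundary does not decrease the simplicial volume -/

section BoundedClasses

variable {X Y : Type*} [TopologicalSpace X] [TopologicalSpace Y]

/-- Bounded cocycles can be replaced by relative ones, almost without increasing the norm. -/
lemma InducesIsometricIso.exists_relative {A : Set X} {k : ℕ} (hiso : InducesIsometricIso A k)
    {f : SingularSimplex k X → ℝ} (hf : ∀ σ, |f σ| ≤ 1) (hcoc : coboundary k X f = 0) {r : ℝ}
    (hr : 1 < r) : ∃ f' ∈ boundedCocycles A k, (∀ σ, |f' σ| ≤ r) ∧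
      f - f' ∈ boundedCoboundaries (∅ : Set X) k := by
  have hmem : f ∈ boundedCocycles (∅ : Set X) k :=
    ⟨⟨⟨1, hf⟩, fun σ hσ => ((Set.range_nonempty σ).ne_empty (Set.subset_empty_iff.1 hσ)).elim⟩,
      hcoc⟩
  obtain ⟨β, hβ⟩ := hiso.1.2 (Submodule.Quotient.mk ⟨f, hmem⟩)
  have h1 : β.seminorm < ENNReal.ofReal r := by
    have h2 : linftyNorm f ≤ 1 := iSup_le fun σ => by
      rw [Real.enorm_eq_ofReal_abs, ENNReal.ofReal_le_one]
      exact hf σ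
    rw [← hiso.2 β, hβ]
    have h3 : BoundedCohomology.seminorm (Submodule.Quotient.mk ⟨f, hmem⟩) ≤ linftyNorm f := by
      rw [BoundedCohomology.seminorm]
      exact iInf₂_le_of_le ⟨f, hmem⟩ rfl le_rfl
    exact h3.trans_lt (h2.trans_lt (ENNReal.one_lt_ofReal.2 hr))
  rw [BoundedCohomology.seminorm] at h1
  simp only [iInf_lt_iff] at h1
  obtain ⟨f', hf', hn⟩ := h1
  refine ⟨f', f'.2, fun σ => ?_, ?_⟩
  · have := (le_iSup (fun σ => ‖f'.1 σ‖ₑ) σ).trans hn.le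
    rw [Real.enorm_eq_ofReal_abs] at this
    exact (ENNReal.ofReal_le_ofReal_iff (zero_le_one.trans hr.le)).1 this
  · rw [← hf'] at hβ
    exact (Submodule.Quotient.eq
      ((boundedCoboundaries (∅ : Set X) k).submoduleOf (boundedCocycles ∅ k))).1 hβ.symm

end BoundedClasses

section Inequality

variable {m : ℕ} {V : Type*} [TopologicalSpace V]
  {o : ManifoldOrientation (m + 1) (manifoldInterior (m + 1) V)}

/-- Bounded cocycles of the interior take values on locally finite fundamental cycles that are
bounded by the norm of any relative fundamental cycle: up to bounded coboundaries they extend to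
relative cocycles. -/
lemma abs_tsum_mul_le [CompactSpace V] (hV : IsManifoldWithBoundary (m + 1) V)
    (hiso : InducesIsometricIso (manifoldBoundary (m + 1) V) (m + 1))
    {c : SingularSimplex (m + 1) (manifoldInterior (m + 1) V) → ℝ} (hc : IsLFFundamentalCycle o c)
    (hfin : l1Norm c < ⊤) {α : RelHomology ℝ (manifoldBoundary (m + 1) V) (m + 1)}
    (hα : IsRelFundamentalClass o α) {z : Chain ℝ (m + 1) V} (hz : Represents z α)
    {f : SingularSimplex (m + 1) (manifoldInterior (m + 1) V) → ℝ} (hf : ∀ σ, |f σ| ≤ 1)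
    (hcoc : coboundary (m + 1) _ f = 0) :
    |∑' σ, f σ * c σ| ≤ (l1Norm z).toReal := by
  have := hV.t2
  set ι := interiorInclusion (m + 1) V
  have hlf := hc.1.isLocallyFiniteChain
  have hb : lfBoundary c = 0 := hc.1.2
  obtain ⟨P, hP0, hPs, hP1⟩ := exists_inward_push hV
  obtain ⟨H, L, hH⟩ := exists_isOutwardPush hV
  let J : C(V, manifoldInterior (m + 1) V) := ⟨fun v => ⟨P (v, 1), hP1 v⟩, by fun_prop⟩
  let F : C(manifoldInterior (m + 1) V × unitInterval, manifoldInterior (m + 1) V) :=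
    ⟨fun q => ⟨P (q.1, q.2), by
      rcases hPs q.1 q.2 with h | h
      · rw [h]
        exact q.1.2
      · exact h⟩, by fun_prop⟩
  have hF0 : timeMap F 0 = ContinuousMap.id _ :=
    ContinuousMap.ext fun x => Subtype.ext (hP0 x)
  let G : C(manifoldInterior (m + 1) V × unitInterval, V) := H.comp (ι.prodMap (ContinuousMap.id _))
  have hG0 : timeMap G 0 = ι := ContinuousMap.ext fun x => hH.zero x
  -- replacing a bounded cochain by one that differs by the coboundary of a bounded cochain
  have key : ∀ {a b : SingularSimplex (m + 1) (manifoldInterior (m + 1) V) → ℝ} {A B : ℝ},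
      (∀ σ, |a σ| ≤ A) → (∀ σ, |b σ| ≤ B) →
      (∃ h : SingularSimplex m (manifoldInterior (m + 1) V) → ℝ, (∃ D : ℝ, ∀ τ, |h τ| ≤ D) ∧
        ∀ σ, coboundary m _ h σ = a σ - b σ) → ∑' σ, a σ * c σ = ∑' σ, b σ * c σ := by
    rintro a b A B ha hb' ⟨h, ⟨D, hD⟩, hh⟩
    rw [← sub_eq_zero, ← (summable_mul hfin ha).tsum_sub (summable_mul hfin hb'),
      ← tsum_coboundary_mul hlf hb hfin hD]
    exact tsum_congr fun σ => by rw [hh, sub_mul]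
  refine le_of_forall_gt_imp_ge_of_dense fun R hR => ?_
  obtain ⟨r, hr, hrR⟩ : ∃ r : ℝ, 1 < r ∧ r * (l1Norm z).toReal ≤ R := by
    set N := (l1Norm z).toReal
    have hN : 0 ≤ N := ENNReal.toReal_nonneg
    refine ⟨1 + (R - N) / (N + 1),
      by linarith [div_pos (sub_pos.2 hR) (by linarith : 0 < N + 1)], ?_⟩
    have : (R - N) / (N + 1) * N ≤ R - N := by
      rw [div_mul_eq_mul_div, div_le_iff₀ (by linarith)]
      nlinarith
    linarith
  have hJcoc : coboundary (m + 1) V (fun σ => f (J.comp σ)) = 0 := by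
    funext σ
    exact congrFun hcoc (J.comp σ)
  obtain ⟨f', hf', hf'r, h, hhb, hh⟩ :=
    hiso.exists_relative (f := fun σ => f (J.comp σ)) (fun σ => hf _) hJcoc hr
  have e1 : ∑' σ, f ((J.comp ι).comp σ) * c σ = ∑' σ, f σ * c σ := by
    refine key (fun σ => hf _) hf ?_
    have := exists_coboundary_eq_sub hf hcoc F
    rw [hF0] at this
    exact this
  have e2 : ∑' σ, f ((J.comp ι).comp σ) * c σ = ∑' σ, f' (ι.comp σ) * c σ := by
    refine key (fun σ => hf _) (fun σ => hf'r _) ⟨fun τ => h (ι.comp τ), ?_, fun σ => ?_⟩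
    · exact hhb.1.imp fun D hD τ => hD _
    · exact congrFun hh (ι.comp σ)
  have e3 : ∑' σ, f' ((timeMap G 1).comp σ) * c σ = ∑' σ, f' (ι.comp σ) * c σ := by
    refine key (fun σ => hf'r _) (fun σ => hf'r _) ?_
    have := exists_coboundary_eq_sub hf'r hf'.2 G
    rwa [hG0] at this
  have e4 : ev f' (hH.pushedCycle hlf) = ∑' σ, f' ((timeMap G 1).comp σ) * c σ := by
    rw [IsOutwardPush.pushedCycle, ev_chainMap, ev_eq_tsum]
    refine tsum_congr fun σ => ?_
    by_cases hσ : (Set.range σ ∩ ι ⁻¹' L).Nonempty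
    · rw [truncate_of_nonempty _ _ hσ]
      rfl
    · have h0 : f' ((timeMap G 1).comp σ) = 0 := by
        refine hf'.1.2 _ ?_
        rintro _ ⟨t, rfl⟩
        exact hH.one _ (range_subset_compl_iff.1 hσ ⟨t, rfl⟩)
      rw [h0, zero_mul, truncate_of_subset _ _ (range_subset_compl_iff.1 hσ), mul_zero]
  have e5 : ev f' z = ev f' (hH.pushedCycle hlf) := by
    rw [← sub_eq_zero, ← map_sub]
    obtain ⟨u, a, ha, hua⟩ := mem_relBoundaries.1 (hH.sub_pushedCycle_mem hc hα hz)
    rw [hua, map_add, ev_boundary, show coboundary (m + 1) V f' = 0 from hf'.2, ev_eq_tsum,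
      ev_eq_tsum]
    have : ∀ σ, f' σ * a σ = 0 := fun σ => by
      by_cases hσ : σ ∈ a.support
      · rw [hf'.1.2 σ (ha hσ), zero_mul]
      · rw [Finsupp.notMem_support_iff.1 hσ, mul_zero]
    simp [this]
  rw [← e1, e2, ← e3, ← e4, ← e5]
  exact (abs_ev_le hf'r z).trans hrR

/-- Adding a finite boundary makes a locally finite fundamental cycle almost as small as the
relative simplicial volume. -/
lemma exists_add_boundary_lt [CompactSpace V] (hV : IsManifoldWithBoundary (m + 1) V)
    (hiso : InducesIsometricIso (manifoldBoundary (m + 1) V) (m + 1))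
    {c : SingularSimplex (m + 1) (manifoldInterior (m + 1) V) → ℝ} (hc : IsLFFundamentalCycle o c)
    (hfin : l1Norm c < ⊤) {r : ℝ≥0∞} (hr : relVolume o < r) :
    ∃ b : Chain ℝ (m + 2) (manifoldInterior (m + 1) V),
      l1Norm (c + ⇑(boundary ℝ (m + 1) _ b)) < r := by
  simp only [relVolume, RelHomology.seminorm, iInf_lt_iff] at hr
  obtain ⟨α, hα, z, hz, hzr⟩ := hr
  obtain ⟨r', h1, h2⟩ := exists_between hzr
  have hr' : r' ≠ ⊤ := (h2.trans_le le_top).ne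
  obtain ⟨b, hb⟩ := exists_l1Norm_add_boundary_lt hfin
    ((ENNReal.toReal_lt_toReal (l1Norm_lt_top z).ne hr').2 h1)
    fun f hf hcoc => abs_tsum_mul_le hV hiso hc hfin hα hz hf hcoc
  exact ⟨b, hb.trans (by rwa [ENNReal.ofReal_toReal hr'])⟩

lemma IsLFFundamentalCycle.add_boundary {X : Type*} [TopologicalSpace X]
    {o : ManifoldOrientation (m + 1) X}
    {c : SingularSimplex (m + 1) X → ℝ} (hc : IsLFFundamentalCycle o c) (b : Chain ℝ (m + 2) X) :
    IsLFFundamentalCycle o (c + boundary ℝ (m + 1) X b) :=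
  hc.add (boundary_boundary b) fun _ => boundary_mem_relBoundaries b

lemma lfVolume_le_relVolume_succ [CompactSpace V] (hV : IsManifoldWithBoundary (m + 1) V)
    (hiso : InducesIsometricIso (manifoldBoundary (m + 1) V) (m + 1)) (hfin : lfVolume o < ⊤) :
    lfVolume o ≤ relVolume o := by
  obtain ⟨c, hc, hcf⟩ : ∃ c, IsLFFundamentalCycle o c ∧ l1Norm c < ⊤ := by
    simpa only [lfVolume, iInf_lt_iff, exists_prop] using hfin
  refine le_of_forall_gt fun r hr => ?_
  obtain ⟨b, hb⟩ := exists_add_boundary_lt hV hiso hc hcf hr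
  exact (iInf₂_le _ (hc.add_boundary b)).trans_lt hb

end Inequality

/-! ### Bernstein polynomials on simplices -/

section Bernstein

variable {k : ℕ} {E : Type*} [NormedAddCommGroup E] [NormedSpace ℝ E]

/-- The empirical distribution of a sample of `N + 1` vertices, as a point of the simplex. -/
def empirical {N : ℕ} (v : Fin (N + 1) → Fin (k + 1)) : stdSimplex ℝ (Fin (k + 1)) :=
  ⟨fun i => (∑ j, if v j = i then 1 else 0) / (N + 1),
    fun i => by positivity, by
      rw [← Finset.sum_div, Finset.sum_comm]
      simp [Nat.cast_add_one_ne_zero N]⟩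

/-- The `N`-th Bernstein polynomial of a function on the simplex: the expectation of the function
at the empirical distribution of `N + 1` independent random vertices with distribution `x`. -/
def bernsteinFun (N : ℕ) (h : C(stdSimplex ℝ (Fin (k + 1)), E)) (x : Fin (k + 1) → ℝ) : E :=
  ∑ v : Fin (N + 1) → Fin (k + 1), (∏ j, x (v j)) • h (empirical v)

lemma contDiff_bernsteinFun (N : ℕ) (h : C(stdSimplex ℝ (Fin (k + 1)), E)) :
    ContDiff ℝ 1 (bernsteinFun N h) := by
  unfold bernsteinFun
  fun_prop

/-- The Bernstein polynomial as a continuous function on the simplex. -/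
def bernstein (N : ℕ) (h : C(stdSimplex ℝ (Fin (k + 1)), E)) : C(stdSimplex ℝ (Fin (k + 1)), E) :=
  ⟨fun t => bernsteinFun N h t.1,
    (contDiff_bernsteinFun N h).continuous.comp continuous_subtype_val⟩

lemma bernstein_apply (N : ℕ) (h : C(stdSimplex ℝ (Fin (k + 1)), E))
    (t : stdSimplex ℝ (Fin (k + 1))) :
    bernstein N h t = ∑ v : Fin (N + 1) → Fin (k + 1), (∏ j, t (v j)) • h (empirical v) := rfl

lemma faceInclusion_empirical {N : ℕ} (i : Fin (k + 2)) (v : Fin (N + 1) → Fin (k + 1)) :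
    faceInclusion i (empirical v) = empirical fun j => i.succAbove (v j) := by
  ext l
  induction l using i.succAboveCases with
  | x =>
    rw [faceInclusion_apply_self]
    change 0 = (∑ j, if i.succAbove (v j) = i then (1 : ℝ) else 0) / (N + 1)
    simp [Fin.succAbove_ne]
  | p l =>
    rw [faceInclusion_apply_succAbove]
    change (∑ j, if v j = l then (1 : ℝ) else 0) / (N + 1) =
      (∑ j, if i.succAbove (v j) = i.succAbove l then (1 : ℝ) else 0) / (N + 1)
    simp

/-- Bernstein polynomials are compatible with the restriction to faces. -/
lemma bernstein_comp_faceInclusion (N : ℕ) (h : C(stdSimplex ℝ (Fin (k + 2)), E))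
    (i : Fin (k + 2)) :
    (bernstein N h).comp (faceInclusion i) = bernstein N (h.comp (faceInclusion i)) := by
  ext t
  rw [ContinuousMap.comp_apply, bernstein_apply, bernstein_apply]
  symm
  refine Finset.sum_of_injOn (fun v j => i.succAbove (v j)) ?_ (fun _ _ => Finset.mem_univ _) ?_ ?_
  · intro v _ v' _ hv
    funext j
    exact Fin.succAbove_right_injective (congrFun hv j)
  · intro v _ hv
    obtain ⟨j, hj⟩ : ∃ j, v j = i := by
      by_contra! hne
      choose v' hv' using fun j => Fin.exists_succAbove_eq (hne j)
      exact hv ⟨v', Finset.mem_coe.2 (Finset.mem_univ _), funext hv'⟩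
    rw [Finset.prod_eq_zero (Finset.mem_univ j), zero_smul]
    rw [hj, faceInclusion_apply_self]
  · intro v _
    simp only [faceInclusion_apply_succAbove, ContinuousMap.comp_apply, faceInclusion_empirical]

lemma sum_prod_apply_eq_one {N : ℕ} (t : stdSimplex ℝ (Fin (k + 1))) :
    ∑ v : Fin (N + 1) → Fin (k + 1), ∏ j, t (v j) = 1 := by
  have := Fintype.prod_sum (fun (_ : Fin (N + 1)) (a : Fin (k + 1)) => t a)
  rw [← this]
  have h1 : ∑ a, t a = 1 := t.2.2
  simp [h1]

lemma prod_apply_nonneg {N : ℕ} (t : stdSimplex ℝ (Fin (k + 1))) (v : Fin (N + 1) → Fin (k + 1)) :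
    0 ≤ ∏ j, t (v j) := Finset.prod_nonneg fun j _ => t.2.1 (v j)

/-- The variance of the empirical distribution. -/
lemma sum_prod_mul_sq_le {N : ℕ} (t : stdSimplex ℝ (Fin (k + 1))) (i : Fin (k + 1)) :
    ∑ v : Fin (N + 1) → Fin (k + 1), (∏ j, t (v j)) * (empirical v i - t i) ^ 2 ≤
      1 / (N + 1) := by
  set φ : Fin (k + 1) → ℝ := fun a => (if a = i then 1 else 0) - t i with hφ
  have ht1 : ∑ a, t a = 1 := t.2.2
  have hti : 0 ≤ t i ∧ t i ≤ 1 :=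
    ⟨t.2.1 i, ht1 ▸ Finset.single_le_sum (fun a _ => t.2.1 a) (Finset.mem_univ i)⟩
  have hmean : ∑ a, t a * φ a = 0 := by
    simp only [hφ, mul_sub, Finset.sum_sub_distrib, ← Finset.sum_mul, ht1]
    simp
  have hφ1 : ∀ a, φ a * φ a ≤ 1 := fun a => by
    simp only [hφ]
    split_ifs <;> nlinarith
  have e1 : ∀ v : Fin (N + 1) → Fin (k + 1), (empirical v i - t i) ^ 2 =
      (1 / (N + 1)) ^ 2 * ∑ j, ∑ l, φ (v j) * φ (v l) := fun v => by
    have : empirical v i - t i = 1 / (N + 1) * ∑ j, φ (v j) := by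
      change (∑ j, if v j = i then (1 : ℝ) else 0) / (N + 1) - t i = _
      simp only [hφ, Finset.sum_sub_distrib, Finset.sum_const, Finset.card_univ, Fintype.card_fin,
        nsmul_eq_mul]
      push_cast
      field_simp
    rw [this, mul_pow, sq (∑ j, φ (v j)), Finset.sum_mul_sum]
  have e2 : ∀ j l : Fin (N + 1), ∑ v : Fin (N + 1) → Fin (k + 1),
      (∏ p, t (v p)) * (φ (v j) * φ (v l)) ≤ if l = j then 1 else 0 := by
    intro j l
    split_ifs with hjl
    · rw [hjl, ← sum_prod_apply_eq_one (N := N) t]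
      exact Finset.sum_le_sum fun v _ =>
        mul_le_of_le_one_right (prod_apply_nonneg t v) (hφ1 _)
    -- distinct vertices of the sample are independent
    · have := Fintype.prod_sum (fun (p : Fin (N + 1)) (a : Fin (k + 1)) =>
        t a * ((if p = j then φ a else 1) * (if p = l then φ a else 1)))
      rw [Finset.prod_eq_zero (Finset.mem_univ j)] at this
      · refine (Eq.trans (Finset.sum_congr rfl fun v _ => ?_) this.symm).le
        rw [Finset.prod_mul_distrib, Finset.prod_mul_distrib]
        simp
      · simp [Ne.symm hjl, hmean]
  calc ∑ v : Fin (N + 1) → Fin (k + 1), (∏ j, t (v j)) * (empirical v i - t i) ^ 2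
      = (1 / (N + 1)) ^ 2 * ∑ j, ∑ l, ∑ v : Fin (N + 1) → Fin (k + 1),
          (∏ p, t (v p)) * (φ (v j) * φ (v l)) := by
        simp only [e1, Finset.mul_sum]
        rw [Finset.sum_comm]
        refine Finset.sum_congr rfl fun j _ => ?_
        rw [Finset.sum_comm]
        refine Finset.sum_congr rfl fun l _ => Finset.sum_congr rfl fun v _ => ?_
        ring
    _ ≤ (1 / (N + 1)) ^ 2 * ∑ j : Fin (N + 1), ∑ l : Fin (N + 1), if l = j then 1 else 0 := by
        gcongr with j _ l _
        exact e2 j l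
    _ = 1 / (N + 1) := by
        simp
        field_simp

/-- Bernstein polynomials converge uniformly. -/
lemma tendsto_bernstein (h : C(stdSimplex ℝ (Fin (k + 1)), E)) :
    Filter.Tendsto (fun N => bernstein N h) Filter.atTop (𝓝 h) := by
  rw [ContinuousMap.tendsto_iff_tendstoUniformly, Metric.tendstoUniformly_iff]
  intro ε hε
  obtain ⟨δ, hδ, hu⟩ := Metric.uniformContinuous_iff.1
    (CompactSpace.uniformContinuous_of_continuous h.continuous) (ε / 2) (half_pos hε)
  set B := 2 * ‖h‖ / δ ^ 2 with hB
  have hB0 : 0 ≤ B := by positivity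
  have key : ∀ u t : stdSimplex ℝ (Fin (k + 1)),
      ‖h u - h t‖ ≤ ε / 2 + B * ∑ i, (u i - t i) ^ 2 := by
    intro u t
    have hs : 0 ≤ ∑ i, (u i - t i) ^ 2 := Finset.sum_nonneg fun i _ => sq_nonneg _
    rcases lt_or_ge (dist u t) δ with hd | hd
    · rw [← dist_eq_norm]
      nlinarith [hu hd, mul_nonneg hB0 hs]
    · have h1 : δ ^ 2 ≤ ∑ i, (u i - t i) ^ 2 := by
        by_contra! hlt
        refine hd.not_gt ((dist_pi_lt_iff hδ).2 fun i => ?_)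
        rw [Real.dist_eq]
        refine abs_lt_of_sq_lt_sq ?_ hδ.le
        exact (Finset.single_le_sum (f := fun i => (u i - t i) ^ 2) (fun i _ => sq_nonneg _)
          (Finset.mem_univ i)).trans_lt hlt
      have h2 : ‖h u - h t‖ ≤ 2 * ‖h‖ := by
        have := norm_sub_le (h u) (h t)
        linarith [h.norm_coe_le_norm u, h.norm_coe_le_norm t]
      have h3 : 2 * ‖h‖ = B * δ ^ 2 := by
        rw [hB]
        field_simp
      nlinarith [mul_le_mul_of_nonneg_left h1 hB0]
  have hlim : Filter.Tendsto (fun N : ℕ => B * ((k + 1) * (1 / ((N : ℝ) + 1)))) Filter.atTop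
      (𝓝 (B * ((k + 1) * 0))) :=
    (tendsto_one_div_add_atTop_nhds_zero_nat.const_mul _).const_mul _
  rw [mul_zero, mul_zero] at hlim
  filter_upwards [hlim.eventually (gt_mem_nhds (half_pos hε))] with N hN t
  have e : bernstein N h t - h t = ∑ v : Fin (N + 1) → Fin (k + 1),
      (∏ j, t (v j)) • (h (empirical v) - h t) := by
    simp only [smul_sub, Finset.sum_sub_distrib, ← Finset.sum_smul, sum_prod_apply_eq_one,
      one_smul, bernstein_apply]
  rw [dist_comm, dist_eq_norm, e]
  calc ‖∑ v : Fin (N + 1) → Fin (k + 1), (∏ j, t (v j)) • (h (empirical v) - h t)‖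
      ≤ ∑ v : Fin (N + 1) → Fin (k + 1), (∏ j, t (v j)) *
          (ε / 2 + B * ∑ i, (empirical v i - t i) ^ 2) := by
        refine norm_sum_le_of_le _ fun v _ => ?_
        rw [norm_smul, Real.norm_of_nonneg (prod_apply_nonneg t v)]
        exact mul_le_mul_of_nonneg_left (key _ _) (prod_apply_nonneg t v)
    _ = ε / 2 + B * ∑ i, ∑ v : Fin (N + 1) → Fin (k + 1),
          (∏ j, t (v j)) * (empirical v i - t i) ^ 2 := by
        simp only [mul_add, Finset.sum_add_distrib, ← Finset.sum_mul, sum_prod_apply_eq_one,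
          one_mul]
        congr 1
        rw [Finset.sum_comm, Finset.mul_sum]
        refine Finset.sum_congr rfl fun v _ => ?_
        rw [← Finset.mul_sum]
        ring
    _ ≤ ε / 2 + B * ∑ i : Fin (k + 1), 1 / ((N : ℝ) + 1) := by
        gcongr with i
        exact sum_prod_mul_sq_le t i
    _ < ε := by
        rw [Finset.sum_const, Finset.card_univ, Fintype.card_fin, nsmul_eq_mul]
        push_cast
        linarith

end Bernstein

/-! ### Locally Lipschitz maps -/

section LipschitzNear

variable {S Y : Type*} [PseudoEMetricSpace S]

/-- The map `f` is Lipschitz in a neighbourhood of `t`, with respect to the distance function `d`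
on the target. -/
def LipschitzNear (d : Y → Y → ℝ≥0∞) (f : S → Y) (t : S) : Prop :=
  ∃ C : NNReal, ∀ᶠ p : S × S in 𝓝 (t, t), d (f p.1) (f p.2) ≤ C * edist p.1 p.2

lemma eventually_nhds_diag {q : S → Prop} {t : S} (h : ∀ᶠ s in 𝓝 t, q s) :
    ∀ᶠ p : S × S in 𝓝 (t, t), q p.1 ∧ q p.2 := by
  rw [nhds_prod_eq]
  exact h.prod_mk h

lemma LipschitzNear.congr {d : Y → Y → ℝ≥0∞} {f g : S → Y} {t : S} (hf : LipschitzNear d f t)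
    (h : ∀ᶠ s in 𝓝 t, g s = f s) : LipschitzNear d g t := by
  obtain ⟨C, hC⟩ := hf
  refine ⟨C, ?_⟩
  filter_upwards [hC, eventually_nhds_diag h] with p hp hq
  rwa [hq.1, hq.2]

/-- Composition with a map that is Lipschitz on a set that contains all nearby values. -/
lemma LipschitzNear.postcomp {Z : Type*} {d : Y → Y → ℝ≥0∞} {d' : Z → Z → ℝ≥0∞} {f : S → Y} {t : S}
    (hf : LipschitzNear d f t) {A : Set Y} (hA : ∀ᶠ s in 𝓝 t, f s ∈ A) {g : Y → Z} {K : NNReal}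
    (hg : ∀ x ∈ A, ∀ y ∈ A, d' (g x) (g y) ≤ K * d x y) :
    LipschitzNear d' (fun s => g (f s)) t := by
  obtain ⟨C, hC⟩ := hf
  refine ⟨K * C, ?_⟩
  filter_upwards [hC, eventually_nhds_diag hA] with p hp hq
  refine (hg _ hq.1 _ hq.2).trans ?_
  rw [ENNReal.coe_mul, mul_assoc]
  gcongr

lemma LipschitzNear.prodMk {E F : Type*} [PseudoEMetricSpace E] [PseudoEMetricSpace F] {f : S → E}
    {g : S → F} {t : S} (hf : LipschitzNear edist f t) (hg : LipschitzNear edist g t) :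
    LipschitzNear edist (fun s => (f s, g s)) t := by
  obtain ⟨C, hC⟩ := hf
  obtain ⟨D, hD⟩ := hg
  refine ⟨max C D, ?_⟩
  filter_upwards [hC, hD] with p hp hq
  rw [Prod.edist_eq]
  refine max_le (hp.trans ?_) (hq.trans ?_)
  · gcongr
    exact le_max_left _ _
  · gcongr
    exact le_max_right _ _

/-- Continuously differentiable maps preserve the local Lipschitz property. -/
lemma LipschitzNear.contDiff_comp {E F : Type*} [NormedAddCommGroup E] [NormedSpace ℝ E]
    [NormedAddCommGroup F] [NormedSpace ℝ F] {g : E → F} (hg : ContDiff ℝ 1 g) {f : S → E} {t : S}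
    (hf : LipschitzNear edist f t) (hc : ContinuousAt f t) :
    LipschitzNear edist (fun s => g (f s)) t := by
  obtain ⟨K, u, hu, hK⟩ := (hg.contDiffAt (x := f t)).exists_lipschitzOnWith
  exact hf.postcomp (hc.eventually hu) fun x hx y hy => hK hx hy

/-- Bernstein polynomials are locally Lipschitz. -/
lemma lipschitzNear_bernstein {k : ℕ} {E : Type*} [NormedAddCommGroup E] [NormedSpace ℝ E] (N : ℕ)
    (h : C(stdSimplex ℝ (Fin (k + 1)), E)) (t : stdSimplex ℝ (Fin (k + 1))) :
    LipschitzNear edist (bernstein N h) t := by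
  have h1 : LipschitzNear edist (fun s : stdSimplex ℝ (Fin (k + 1)) => s.1) t :=
    ⟨1, Filter.Eventually.of_forall fun p => by rw [ENNReal.coe_one, one_mul]; rfl⟩
  exact h1.contDiff_comp (contDiff_bernsteinFun N h) continuous_subtype_val.continuousAt

/-- On a simplex, locally Lipschitz maps are Lipschitz: the simplex is compact and convex. -/
lemma lipConst_lt_top {M : Type*} [TopologicalSpace M] {d : M → M → ℝ≥0∞} (h0 : ∀ x, d x x = 0)
    (htri : ∀ x y z, d x z ≤ d x y + d y z) {k : ℕ} {σ : SingularSimplex k M}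
    (h : ∀ t, LipschitzNear d σ t) : lipConst d σ < ⊤ := by
  have h1 : ∀ t : stdSimplex ℝ (Fin (k + 1)), ∃ C : NNReal, ∃ r > 0, ∀ s ∈ Metric.ball t r,
      ∀ s' ∈ Metric.ball t r, d (σ s) (σ s') ≤ C * edist s s' := by
    intro t
    obtain ⟨C, hC⟩ := h t
    obtain ⟨r, hr, hb⟩ := Metric.eventually_nhds_iff_ball.1 hC
    refine ⟨C, r, hr, fun s hs s' hs' => hb (s, s') ?_⟩
    rw [← ball_prod_same]
    exact ⟨hs, hs'⟩
  choose C r hr hC using h1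
  obtain ⟨T, hT⟩ := isCompact_univ.elim_finite_subcover (fun t => Metric.ball t (r t))
    (fun t => Metric.isOpen_ball) fun t _ => Set.mem_iUnion.2 ⟨t, Metric.mem_ball_self (hr t)⟩
  set C' : NNReal := T.sup C
  obtain ⟨δ, hδ, hL⟩ := lebesgue_number_lemma_of_metric (c := fun t : T => Metric.ball t.1 (r t))
    isCompact_univ (fun t => Metric.isOpen_ball) (by
      intro t ht
      simpa using hT ht)
  have h2 : ∀ s s' : stdSimplex ℝ (Fin (k + 1)), dist s s' < δ →
      d (σ s) (σ s') ≤ C' * edist s s' := by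
    intro s s' hs
    obtain ⟨t, ht⟩ := hL s (Set.mem_univ s)
    refine (hC t.1 s (ht (Metric.mem_ball_self hδ)) s' (ht (Metric.mem_ball'.2 hs))).trans ?_
    gcongr
    exact Finset.le_sup t.2
  have h3 : ∀ s s' : stdSimplex ℝ (Fin (k + 1)), d (σ s) (σ s') ≤ C' * edist s s' := by
    intro s s'
    obtain ⟨N, hN⟩ := exists_nat_gt (dist s s' / δ)
    have hN0 : (0 : ℝ) < N := lt_of_le_of_lt (by positivity) hN
    -- the points that divide the segment from `s` to `s'` into `N` equal parts
    have hp : ∀ i : ℕ, i ≤ N → AffineMap.lineMap s.1 s'.1 ((i : ℝ) / N) ∈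
        stdSimplex ℝ (Fin (k + 1)) := fun i hi =>
      (convex_stdSimplex ℝ _).lineMap_mem s.2 s'.2 ⟨by positivity,
        (div_le_one hN0).2 (Nat.cast_le.2 hi)⟩
    have hstep : ∀ (i : ℕ) (hi : i + 1 ≤ N),
        edist (⟨_, hp i (by omega)⟩ : stdSimplex ℝ (Fin (k + 1)))
        ⟨_, hp (i + 1) hi⟩ = ENNReal.ofReal (1 / N) * edist s s' := by
      intro i hi
      rw [edist_dist, edist_dist, ← ENNReal.ofReal_mul (by positivity), Subtype.dist_eq,
        dist_lineMap_lineMap, Real.dist_eq, Subtype.dist_eq]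
      congr 2
      rw [← sub_div, abs_div, Nat.abs_cast]
      congr 1
      push_cast
      rw [sub_add_cancel_left, abs_neg, abs_one]
    have hind : ∀ (i : ℕ) (hi : i ≤ N), d (σ s) (σ ⟨_, hp i hi⟩) ≤
        i * (C' * (ENNReal.ofReal (1 / N) * edist s s')) := by
      intro i
      induction i with
      | zero =>
        intro hi
        have : (⟨_, hp 0 hi⟩ : stdSimplex ℝ (Fin (k + 1))) = s := by
          ext1
          simp
        rw [this, h0]
        exact zero_le
      | succ i ih =>
        intro hi
        refine (htri _ (σ ⟨_, hp i (by omega)⟩) _).trans ?_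
        have e : ((i + 1 : ℕ) : ℝ≥0∞) * (C' * (ENNReal.ofReal (1 / N) * edist s s')) =
            i * (C' * (ENNReal.ofReal (1 / N) * edist s s')) +
              C' * (ENNReal.ofReal (1 / N) * edist s s') := by
          push_cast
          ring
        rw [e]
        refine add_le_add (ih (by omega)) ?_
        rw [← hstep i hi]
        refine h2 _ _ ?_
        have := hstep i hi
        rw [edist_dist, edist_dist, ← ENNReal.ofReal_mul (by positivity),
          ENNReal.ofReal_eq_ofReal_iff dist_nonneg (by positivity)] at this
        rw [this, one_div_mul_eq_div, div_lt_iff₀ hN0]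
        rwa [div_lt_iff₀ hδ, mul_comm] at hN
    have := hind N le_rfl
    have e : (⟨_, hp N le_rfl⟩ : stdSimplex ℝ (Fin (k + 1))) = s' := by
      ext1
      simp [div_self hN0.ne']
    rw [e] at this
    refine this.trans_eq ?_
    rw [mul_left_comm, ← mul_assoc (N : ℝ≥0∞), ← ENNReal.ofReal_natCast,
      ← ENNReal.ofReal_mul hN0.le,
      mul_one_div_cancel hN0.ne', ENNReal.ofReal_one, one_mul]
  refine lt_of_le_of_lt (sInf_le fun s t => (h3 s t).trans ?_) (ENNReal.coe_lt_top (r := C'))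
  gcongr
  exact PiLp.lipschitzWith_ofLp 2 _ (WithLp.toLp 2 s.1) (WithLp.toLp 2 t.1) |>.trans_eq (one_mul _)

/-- Lipschitz simplices are locally Lipschitz. -/
lemma lipschitzNear_of_lipConst {M : Type*} [TopologicalSpace M] {d : M → M → ℝ≥0∞} {k : ℕ}
    {σ : SingularSimplex k M} (h : lipConst d σ < ⊤) (t : stdSimplex ℝ (Fin (k + 1))) :
    LipschitzNear d σ t := by
  obtain ⟨L, hL, hLt⟩ := sInf_lt_iff.1 h
  lift L to NNReal using hLt.ne
  have hlip := PiLp.antilipschitzWith_ofLp 2 (fun _ : Fin (k + 1) => ℝ)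
  obtain ⟨K, hK⟩ : ∃ K, AntilipschitzWith K
    (WithLp.ofLp : EuclideanSpace ℝ (Fin (k + 1)) → Fin (k + 1) → ℝ) := ⟨_, hlip⟩
  refine ⟨L * K, Filter.Eventually.of_forall fun p => (hL p.1 p.2).trans ?_⟩
  rw [ENNReal.coe_mul, mul_assoc]
  gcongr
  exact hK (WithLp.toLp 2 p.1.1) (WithLp.toLp 2 p.2.1)

end LipschitzNear

/-! ### Deformations of singular simplices -/

section Deformation

variable {X : Type*} [TopologicalSpace X]

/-- A deformation supported in `L`: a self-map of the singular `(k + 1)`-simplices which fixes those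
that avoid `L`, preserves the boundaries of chains whose boundary avoids `L`, and acts on relative
cycles within their homology class, for every subspace that avoids `L`. -/
structure IsDeformation (L : Set X) (k : ℕ)
    (T : SingularSimplex (k + 1) X → SingularSimplex (k + 1) X) : Prop where
  fixed : ∀ σ : SingularSimplex (k + 1) X, Set.range σ ⊆ Lᶜ → T σ = σ
  boundary_eq : ∀ z : Chain ℝ (k + 1) X, boundary ℝ k X z ∈ chainsIn ℝ k Lᶜ →
    boundary ℝ k X (Finsupp.mapDomain T z) = boundary ℝ k X z
  homologous : ∀ A ⊆ Lᶜ, ∀ z ∈ relCycles ℝ A (k + 1),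
    Finsupp.mapDomain T z - z ∈ relBoundaries ℝ A (k + 1)

lemma mapDomain_eq_self {k : ℕ} {A : Set X} {T : SingularSimplex k X → SingularSimplex k X}
    (hT : ∀ σ : SingularSimplex k X, Set.range σ ⊆ A → T σ = σ) {z : Chain ℝ k X}
    (hz : z ∈ chainsIn ℝ k A) : Finsupp.mapDomain T z = z :=
  (Finsupp.mapDomain_congr fun σ hσ => hT σ (hz hσ)).trans Finsupp.mapDomain_id

lemma IsDeformation.id (L : Set X) (k : ℕ) : IsDeformation L k _root_.id where
  fixed _ _ := rfl
  boundary_eq z _ := by rw [Finsupp.mapDomain_id]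
  homologous A _ z _ := by
    rw [Finsupp.mapDomain_id, sub_self]
    exact Submodule.zero_mem _

lemma IsDeformation.comp {L L' : Set X} {k : ℕ}
    {T T' : SingularSimplex (k + 1) X → SingularSimplex (k + 1) X}
    (hT : IsDeformation L k T) (hT' : IsDeformation L' k T') :
    IsDeformation (L ∪ L') k (T' ∘ T) where
  fixed σ hσ := by
    rw [Set.compl_union, Set.subset_inter_iff] at hσ
    rw [Function.comp_apply, hT.fixed σ hσ.1, hT'.fixed σ hσ.2]
  boundary_eq z hz := by
    have h1 := hT.boundary_eq z
      (chainsIn_mono (Set.compl_subset_compl.2 Set.subset_union_left) hz)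
    have h2 := chainsIn_mono (Set.compl_subset_compl.2 Set.subset_union_right) hz
    rw [Finsupp.mapDomain_comp, hT'.boundary_eq _ (by rwa [h1]), h1]
  homologous A hA z hz := by
    rw [Set.compl_union, Set.subset_inter_iff] at hA
    have h1 := hT.homologous A hA.1 z hz
    have h2 : Finsupp.mapDomain T z ∈ relCycles ℝ A (k + 1) := by
      have := Submodule.add_mem _ (relBoundaries_le_relCycles h1) hz
      rwa [sub_add_cancel] at this
    have := Submodule.add_mem _ (hT'.homologous A hA.2 _ h2) h1
    rwa [← Finsupp.mapDomain_comp, sub_add_sub_cancel] at this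

lemma isDeformation_of_naturalHomotopy {L : Set X}
    {H : ∀ k, SingularSimplex k X → C(stdSimplex ℝ (Fin (k + 1)) × unitInterval, X)}
    (hH : NaturalHomotopy H) (h0 : ∀ k (σ : SingularSimplex k X) t, H k σ (t, 0) = σ t)
    (hL : ∀ k (σ : SingularSimplex k X) t, σ t ∉ L → ∀ u, H k σ (t, u) = σ t) (k : ℕ) :
    IsDeformation L k fun σ => (H (k + 1) σ).comp (atHeight (k + 1) 1) where
  fixed σ hσ := ContinuousMap.ext fun t => hL _ σ t (hσ ⟨t, rfl⟩) 1
  boundary_eq z hz := (homotopyAt_boundary hH 1 z).trans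
    (mapDomain_eq_self (fun σ hσ => ContinuousMap.ext fun t => hL _ σ t (hσ ⟨t, rfl⟩) 1) hz)
  homologous A hA z hz := by
    have h1 := homotopyAt_sub_mem_relBoundaries hH (A := A) (B := A) (fun k σ hσ => ?_) hz
    · have h2 : homotopyAt H 0 (k + 1) z = z :=
        (Finsupp.mapDomain_congr fun σ _ => ContinuousMap.ext fun t => h0 (k + 1) σ t).trans
          Finsupp.mapDomain_id
      rwa [h2] at h1
    · rintro _ ⟨⟨t, u⟩, rfl⟩
      rw [hL k σ t (hA (hσ ⟨t, rfl⟩))]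
      exact hσ ⟨t, rfl⟩

end Deformation

/-! ### Smoothing singular simplices -/

section Smoothing

variable {X : Type*} [TopologicalSpace X]

/-- The finitely many given simplices can be made locally Lipschitz over `O`, without moving them
far, by a deformation supported in `L` that does not destroy the local Lipschitz property. -/
def CanSmooth (d : X → X → ℝ≥0∞) (k : ℕ) (O L : Set X) : Prop :=
  ∀ (F : Finset (SingularSimplex (k + 1) X))
    (U : SingularSimplex (k + 1) X → Set (SingularSimplex (k + 1) X)),
    (∀ σ ∈ F, U σ ∈ 𝓝 σ) → ∃ T, IsDeformation L k T ∧ (∀ σ ∈ F, T σ ∈ U σ) ∧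
      (∀ σ ∈ F, ∀ t, σ t ∈ O → LipschitzNear d (T σ) t) ∧
      ∀ (σ : SingularSimplex (k + 1) X) t, LipschitzNear d σ t → LipschitzNear d (T σ) t

variable {E : Type*} [NormedAddCommGroup E] [InnerProductSpace ℝ E] [FiniteDimensional ℝ E]

/-- The chart `e` is bi-Lipschitz with respect to the distance function `d`. -/
def IsBiLipschitz (d : X → X → ℝ≥0∞) (e : OpenPartialHomeomorph X E) : Prop :=
  ∃ C : NNReal, ∀ x ∈ e.source, ∀ y ∈ e.source,
    d x y ≤ C * edist (e x) (e y) ∧ edist (e x) (e y) ≤ C * d x y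

/-- Smoothing in a chart: near the given point, simplices are moved to their Bernstein
polynomials. -/
lemma exists_canSmooth_of_chart [T2Space X] [NormalSpace X] {d : X → X → ℝ≥0∞}
    {e : OpenPartialHomeomorph X E} (he : IsBiLipschitz d e) {x : X} (hx : x ∈ e.source) (k : ℕ) :
    ∃ O L, IsOpen O ∧ x ∈ O ∧ IsCompact L ∧ CanSmooth d k O L := by
  obtain ⟨C, hC⟩ := he
  obtain ⟨R, hR, hRt⟩ : ∃ R > 0, Metric.closedBall (e x) (4 * R) ⊆ e.target := by
    obtain ⟨r, hr, h⟩ := Metric.nhds_basis_closedBall.mem_iff.1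
      (e.open_target.mem_nhds (e.map_source hx))
    exact ⟨r / 4, by positivity, by rwa [mul_div_cancel₀ _ (by norm_num)]⟩
  let ρ : ContDiffBump (e x) := ⟨R, 2 * R, hR, by linarith⟩
  let ψ : ContDiffBump (0 : E) := ⟨R / 2, R, by positivity, by linarith⟩
  let Φ : E × E → E := fun q => q.1 + ρ q.1 • (ψ q.2 • q.2)
  have hΦ : ContDiff ℝ 1 Φ := by
    have h1 : ContDiff ℝ 1 ρ := ρ.contDiff
    have h2 : ContDiff ℝ 1 ψ := ψ.contDiff
    fun_prop
  have hψ : ∀ w : E, ‖ψ w • w‖ ≤ R := by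
    intro w
    rw [norm_smul, Real.norm_of_nonneg ψ.nonneg]
    rcases le_or_gt R ‖w‖ with h | h
    · rw [ψ.zero_of_le_dist (by rwa [dist_zero_right]), zero_mul]
      exact hR.le
    · exact (mul_le_of_le_one_left (norm_nonneg _) ψ.le_one).trans h.le
  have hΦd : ∀ y w, dist (Φ (y, w)) y ≤ R := by
    intro y w
    rw [dist_eq_norm, add_sub_cancel_left, norm_smul, Real.norm_of_nonneg ρ.nonneg]
    exact (mul_le_of_le_one_left (norm_nonneg _) ρ.le_one).trans (hψ w)
  have hΦt : ∀ y ∈ Metric.closedBall (e x) (3 * R), ∀ w, Φ (y, w) ∈ e.target := by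
    intro y hy w
    refine hRt ?_
    rw [Metric.mem_closedBall] at hy ⊢
    linarith [dist_triangle (Φ (y, w)) y (e x), hΦd y w]
  have h23 : Metric.closedBall (e x) (2 * R) ⊆ Metric.closedBall (e x) (3 * R) :=
    Metric.closedBall_subset_closedBall (by linarith)
  have h3t : Metric.closedBall (e x) (3 * R) ⊆ e.target :=
    (Metric.closedBall_subset_closedBall (by linarith)).trans hRt
  obtain ⟨g, hg1, hg2⟩ := exists_glue e (isCompact_closedBall (e x) (2 * R)) (h23.trans h3t)
    (⟨Φ, hΦ.continuous⟩ : C(E × E, E)) (fun y hy w => by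
      change y + ρ y • (ψ w • w) = y
      rw [ρ.zero_of_le_dist (not_le.1 hy).le, zero_smul, add_zero])
    (fun y hy w => hΦt y (h23 hy) w)
  have hg1 : ∀ z ∈ e.source, ∀ w, g (z, w) = e.symm (Φ (e z, w)) := hg1
  have hg0 : ∀ z, g (z, 0) = z := by
    intro z
    by_cases hz : z ∈ e.source
    · rw [hg1 z hz]
      simp only [Φ, smul_zero, add_zero]
      exact e.left_inv hz
    · exact hg2 z (fun h => absurd h hz) 0
  -- a globally defined continuous function that agrees with the chart where points are moved
  obtain ⟨θ, hθ⟩ : ∃ θ : C(X, E), ∀ z ∈ e.source, e z ∈ Metric.closedBall (e x) (3 * R) →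
      θ z = e z := by
    have hs : IsClosed (e.symm '' Metric.closedBall (e x) (3 * R)) :=
      ((isCompact_closedBall _ _).image_of_continuousOn (e.continuousOn_symm.mono h3t)).isClosed
    have hse : e.symm '' Metric.closedBall (e x) (3 * R) ⊆ e.source := by
      rintro _ ⟨y, hy, rfl⟩
      exact e.map_target (h3t hy)
    obtain ⟨θ, hθ⟩ := ContinuousMap.exists_restrict_eq hs
      (⟨fun z => e z.1, (e.continuousOn.mono hse).domRestrict⟩ :
        C(e.symm '' Metric.closedBall (e x) (3 * R), E))
    exact ⟨θ, fun z hz hz3 => DFunLike.congr_fun hθ ⟨z, ⟨e z, hz3, e.left_inv hz⟩⟩⟩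
  let D : ℕ → ∀ k, SingularSimplex k X → C(stdSimplex ℝ (Fin (k + 1)), E) := fun N k σ =>
    bernstein N (θ.comp σ) - θ.comp σ
  let H : ℕ → ∀ k, SingularSimplex k X → C(stdSimplex ℝ (Fin (k + 1)) × unitInterval, X) :=
    fun N k σ => ⟨fun q => g (σ q.1, (q.2 : ℝ) • D N k σ q.1), by fun_prop⟩
  have hH : ∀ N, NaturalHomotopy (H N) := by
    intro N k i σ
    have : D N k (face i σ) = (D N (k + 1) σ).comp (faceInclusion i) := by
      change bernstein N ((θ.comp σ).comp (faceInclusion i)) - _ = _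
      rw [← bernstein_comp_faceInclusion]
      rfl
    ext1 q
    change g (σ (faceInclusion i q.1), (q.2 : ℝ) • D N k (face i σ) q.1) = _
    rw [this]
    rfl
  let L : Set X := e.symm '' Metric.closedBall (e x) (2 * R)
  have hLc : IsCompact L :=
    (isCompact_closedBall _ _).image_of_continuousOn (e.continuousOn_symm.mono (h23.trans h3t))
  have hgL : ∀ z ∉ L, ∀ w, g (z, w) = z := fun z hz w =>
    hg2 z (fun hzs hzQ => hz ⟨e z, hzQ, e.left_inv hzs⟩) w
  let T : ℕ → SingularSimplex (k + 1) X → SingularSimplex (k + 1) X := fun N σ =>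
    (H N (k + 1) σ).comp (atHeight (k + 1) 1)
  have hT : ∀ N, IsDeformation L k (T N) := fun N => isDeformation_of_naturalHomotopy (hH N)
    (fun k σ t => by
      change g (σ t, ((0 : unitInterval) : ℝ) • D N k σ t) = σ t
      rw [Set.Icc.coe_zero, zero_smul, hg0])
    (fun k σ t ht u => hgL _ ht _) k
  have hTa : ∀ N σ t, T N σ t = g (σ t, D N (k + 1) σ t) := fun N σ t => by
    change g (σ t, ((1 : unitInterval) : ℝ) • D N (k + 1) σ t) = _
    rw [Set.Icc.coe_one, one_smul]
  have hD : ∀ σ : SingularSimplex (k + 1) X,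
      Filter.Tendsto (fun N => D N (k + 1) σ) Filter.atTop (𝓝 0) := by
    intro σ
    have := (tendsto_bernstein (θ.comp σ)).sub_const (θ.comp σ)
    rwa [sub_self] at this
  have hTlim : ∀ σ, Filter.Tendsto (fun N => T N σ) Filter.atTop (𝓝 σ) := by
    intro σ
    let Ψ : C(stdSimplex ℝ (Fin (k + 1 + 1)), E) → SingularSimplex (k + 1) X :=
      fun w => ⟨fun t => g (σ t, w t), by fun_prop⟩
    have hΨ : Continuous Ψ := by
      refine ContinuousMap.continuous_of_continuous_uncurry _ ?_
      change Continuous fun q :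
        C(stdSimplex ℝ (Fin (k + 1 + 1)), E) × stdSimplex ℝ (Fin (k + 1 + 1)) =>
        g (σ q.2, q.1 q.2)
      fun_prop
    have h1 := (hΨ.tendsto 0).comp (hD σ)
    have h2 : Ψ 0 = σ := ContinuousMap.ext fun t => hg0 (σ t)
    rw [h2] at h1
    refine h1.congr fun N => ContinuousMap.ext fun t => (hTa N σ t).symm
  -- the local Lipschitz property can be checked in the chart
  have key : ∀ N (σ : SingularSimplex (k + 1) X) t, σ t ∈ e.source →
      e (σ t) ∈ Metric.ball (e x) (3 * R) →
      LipschitzNear edist (fun s => Φ (e (σ s), bernstein N (θ.comp σ) s - e (σ s))) t →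
      LipschitzNear d (T N σ) t := by
    intro N σ t ht htR hlip
    have hO := (e.isOpen_inter_preimage (Metric.isOpen_ball (x := e x) (ε := 3 * R))).preimage
      σ.continuous
    have hev : ∀ᶠ s in 𝓝 t, σ s ∈ e.source ∧ e (σ s) ∈ Metric.ball (e x) (3 * R) :=
      hO.mem_nhds ⟨ht, htR⟩
    have h1 := hlip.postcomp (d' := d) (A := e.target) (g := e.symm) (K := C) ?_ ?_
    · refine h1.congr ?_
      filter_upwards [hev] with s hs
      rw [hTa, hg1 _ hs.1]
      change e.symm (Φ (e (σ s), bernstein N (θ.comp σ) s - θ (σ s))) = _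
      rw [hθ _ hs.1 (Metric.ball_subset_closedBall hs.2)]
    · filter_upwards [hev] with s hs
      exact hΦt _ (Metric.ball_subset_closedBall hs.2) _
    · intro y hy y' hy'
      have := (hC _ (e.map_target hy) _ (e.map_target hy')).1
      rwa [e.right_inv hy, e.right_inv hy'] at this
  have hcont : ∀ (σ : SingularSimplex (k + 1) X) t, σ t ∈ e.source →
      ContinuousAt (fun s => e (σ s)) t := fun σ t ht =>
    (e.continuousAt ht).comp σ.continuous.continuousAt
  refine ⟨e.source ∩ e ⁻¹' Metric.ball (e x) R, L, e.isOpen_inter_preimage Metric.isOpen_ball,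
    ⟨hx, Metric.mem_ball_self hR⟩, hLc, fun F U hU => ?_⟩
  have hev1 : ∀ᶠ N in Filter.atTop, ∀ σ ∈ F, T N σ ∈ U σ :=
    (Filter.eventually_all_finset F).2 fun σ hσ => (hTlim σ).eventually (hU σ hσ)
  have hev2 : ∀ᶠ N in Filter.atTop, ∀ σ ∈ F, ‖D N (k + 1) σ‖ < R / 2 :=
    (Filter.eventually_all_finset F).2 fun σ hσ => by
      have := (hD σ).norm
      rw [norm_zero] at this
      exact this.eventually (gt_mem_nhds (by positivity))
  obtain ⟨N, hN1, hN2⟩ := (hev1.and hev2).exists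
  refine ⟨T N, hT N, hN1, fun σ hσ t ht => ?_, fun σ t ht => ?_⟩
  · refine key N σ t ht.1 (Metric.ball_subset_ball (by linarith) ht.2) ?_
    refine (lipschitzNear_bernstein N (θ.comp σ) t).congr ?_
    have hO := (e.isOpen_inter_preimage (Metric.isOpen_ball (x := e x) (ε := R))).preimage
      σ.continuous
    filter_upwards [hO.mem_nhds ht] with s hs
    have hs1 : e (σ s) ∈ Metric.closedBall (e x) R := Metric.ball_subset_closedBall hs.2
    have hs2 : bernstein N (θ.comp σ) s - e (σ s) ∈ Metric.closedBall (0 : E) (R / 2) := by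
      rw [mem_closedBall_zero_iff, ← hθ (σ s) hs.1
        (Metric.closedBall_subset_closedBall (by linarith) hs1)]
      exact ((D N (k + 1) σ).norm_coe_le_norm s).trans (hN2 σ hσ).le
    simp only [Φ]
    rw [ρ.one_of_mem_closedBall hs1, ψ.one_of_mem_closedBall hs2, one_smul, one_smul,
      add_sub_cancel]
  · by_cases htL : σ t ∈ L
    · obtain ⟨y, hy, hyt⟩ := htL
      have hts : σ t ∈ e.source := hyt ▸ e.map_target (h3t (h23 hy))
      have hey : e (σ t) = y := by rw [← hyt, e.right_inv (h3t (h23 hy))]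
      refine key N σ t hts ?_ ?_
      · rw [hey]
        exact Metric.closedBall_subset_ball (by linarith) hy
      · have h1 : LipschitzNear edist (fun s => e (σ s)) t :=
          ht.postcomp ((e.open_source.preimage σ.continuous).mem_nhds hts)
            fun y hy y' hy' => (hC y hy y' hy').2
        have h2 := (h1.prodMk (lipschitzNear_bernstein N (θ.comp σ) t)).contDiff_comp
          (g := fun q => Φ (q.1, q.2 - q.1)) (hΦ.comp (by fun_prop))
          ((hcont σ t hts).prodMk (bernstein N (θ.comp σ)).continuous.continuousAt)
        exact h2
    · refine ht.congr ?_
      filter_upwards [(hLc.isClosed.isOpen_compl.preimage σ.continuous).mem_nhds htL] with s hs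
      rw [hTa, hgL _ hs]

/-- Smoothing over a neighbourhood of a compact set. -/
lemma exists_canSmooth_of_isCompact [T2Space X] [LocallyCompactSpace X] [NormalSpace X]
    {d : X → X → ℝ≥0∞}
    (hd : ∀ x : X, ∃ e : OpenPartialHomeomorph X E, x ∈ e.source ∧ IsBiLipschitz d e) (k : ℕ)
    {K : Set X} (hK : IsCompact K) : ∃ O L, K ⊆ O ∧ IsCompact L ∧ CanSmooth d k O L := by
  suffices h : ∃ K' O L, K ⊆ K' ∧ IsCompact K' ∧ IsOpen O ∧ K' ⊆ O ∧ IsCompact L ∧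
      CanSmooth d k O L by
    obtain ⟨K', O, L, h1, -, -, h2, h3, h4⟩ := h
    exact ⟨O, L, h1.trans h2, h3, h4⟩
  refine hK.induction_on (p := fun K => ∃ K' O L, K ⊆ K' ∧ IsCompact K' ∧ IsOpen O ∧ K' ⊆ O ∧
    IsCompact L ∧ CanSmooth d k O L) ?_ ?_ ?_ ?_
  · refine ⟨∅, ∅, ∅, subset_rfl, isCompact_empty, isOpen_empty, subset_rfl, isCompact_empty,
      fun F U hU => ⟨id, .id _ _, fun σ hσ => mem_of_mem_nhds (hU σ hσ), fun σ _ t ht => ht.elim,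
        fun σ t ht => ht⟩⟩
  · rintro s t hst ⟨K', O, L, h1, h2⟩
    exact ⟨K', O, L, hst.trans h1, h2⟩
  · rintro s t ⟨K₁, O₁, L₁, hs, hK₁, hO₁, hKO₁, hL₁, h₁⟩ ⟨K₂, O₂, L₂, ht, hK₂, hO₂, hKO₂, hL₂, h₂⟩
    obtain ⟨K', hK', hKK', hKO'⟩ := exists_compact_between hK₂ hO₂ hKO₂
    refine ⟨K₁ ∪ K₂, O₁ ∪ interior K', L₁ ∪ L₂, Set.union_subset_union hs ht, hK₁.union hK₂,
      hO₁.union isOpen_interior, Set.union_subset_union hKO₁ hKK', hL₁.union hL₂,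
      fun F U hU => ?_⟩
    obtain ⟨T, hT, hTU, hTO, hTd⟩ := h₁ F (fun σ => interior (U σ) ∩
        {τ | Set.MapsTo τ (σ ⁻¹' K') O₂}) fun σ hσ =>
      Filter.inter_mem (interior_mem_nhds.2 (hU σ hσ))
        ((ContinuousMap.isOpen_setOfPred_mapsTo (hK'.isClosed.preimage σ.continuous).isCompact
          hO₂).mem_nhds fun t ht => hKO' ht)
    classical
    obtain ⟨T', hT', hTU', hTO', hTd'⟩ := h₂ (F.image T)
      (fun τ => ⋂ σ ∈ F.filter fun σ => T σ = τ, interior (U σ)) fun τ hτ => by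
        refine (Filter.biInter_finset_mem _).2 fun σ hσ => ?_
        rw [Finset.mem_filter] at hσ
        exact isOpen_interior.mem_nhds (hσ.2 ▸ (hTU σ hσ.1).1)
    refine ⟨T' ∘ T, hT.comp hT', fun σ hσ => ?_, fun σ hσ t ht => ?_, fun σ t ht => ?_⟩
    · have := hTU' (T σ) (Finset.mem_image_of_mem T hσ)
      exact interior_subset (Set.mem_iInter₂.1 this σ (Finset.mem_filter.2 ⟨hσ, rfl⟩))
    · rcases ht with ht | ht
      · exact hTd' _ t (hTO σ hσ t ht)
      · exact hTO' _ (Finset.mem_image_of_mem T hσ) t ((hTU σ hσ).2 (interior_subset ht : σ t ∈ K'))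
    · exact hTd' _ t (hTd σ t ht)
  · intro x hx
    obtain ⟨e, hxe, he⟩ := hd x
    obtain ⟨O, L, hO, hxO, hL, h⟩ := exists_canSmooth_of_chart he hxe k
    obtain ⟨K', hK', hxK', hKO'⟩ := exists_compact_subset hO hxO
    exact ⟨K', mem_nhdsWithin_of_mem_nhds (mem_interior_iff_mem_nhds.1 hxK'), K', O, L, subset_rfl,
      hK', hO, hKO', hL, h⟩

end Smoothing

/-! ### Riemannian distances in charts -/

section Riemannian

open Bundle Set Filter Manifold MeasureTheory

variable {E : Type*} [NormedAddCommGroup E] [NormedSpace ℝ E]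
  {H : Type*} [TopologicalSpace H] (I : ModelWithCorners ℝ E H)
  {M : Type*} [TopologicalSpace M] [ChartedSpace H M]
  [RiemannianBundle (fun x : M => TangentSpace I x)]
  [IsManifold I 1 M] [IsContinuousRiemannianBundle E (fun x : M => TangentSpace I x)]

/-- The derivative of the inverse chart is locally bounded. -/
lemma exists_enorm_mfderivWithin_symm_apply_le (x : M) :
    ∃ C : NNReal, ∀ᶠ y in 𝓝[range I] (extChartAt I x x), ∀ v : E,
      ‖(mfderivWithin 𝓘(ℝ, E) I (extChartAt I x).symm (range I) y v :
        TangentSpace I ((extChartAt I x).symm y))‖ₑ ≤ C * ‖v‖ₑ := by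
  obtain ⟨C, C_pos, hC⟩ := eventually_enorm_mfderivWithin_symm_extChartAt_lt I x
  refine ⟨C, ?_⟩
  filter_upwards [hC] with y hy v
  refine (ContinuousLinearMap.le_opENorm _ v).trans ?_
  exact mul_le_mul_left hy.le _

attribute [local instance] normedAddCommGroupTangentSpaceVectorSpace
attribute [local instance] normedSpaceTangentSpaceVectorSpace

/-- The derivative of the chart is locally bounded. -/
lemma exists_enorm_mfderiv_apply_le (x : M) :
    ∃ C : NNReal, 0 < C ∧ ∀ᶠ y in 𝓝 x, ∀ v : TangentSpace I y,
      ‖mfderiv I 𝓘(ℝ, E) (extChartAt I x) y v‖ₑ ≤ C * ‖v‖ₑ := by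
  obtain ⟨C, C_pos, hC⟩ := eventually_enorm_mfderiv_extChartAt_lt I x
  refine ⟨C, C_pos, ?_⟩
  filter_upwards [hC] with y hy v
  refine (ContinuousLinearMap.le_opENorm _ v).trans ?_
  exact mul_le_mul_left hy.le _

/-- In a neighbourhood of a point, the Riemannian distance is bounded by a multiple of the distance
in the chart: images of segments under the inverse chart are short. -/
lemma exists_riemannianEDist_le_edist_extChartAt (x : M) :
    ∃ C : NNReal, ∃ s ∈ 𝓝 x, ∀ y ∈ s, ∀ z ∈ s,
      riemannianEDist I y z ≤ C * edist (extChartAt I x y) (extChartAt I x z) := by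
  obtain ⟨C, hC⟩ := exists_enorm_mfderivWithin_symm_apply_le I x
  obtain ⟨r, r_pos, hr⟩ : ∃ r > 0,
      Metric.ball (extChartAt I x x) r ∩ range I ⊆ (extChartAt I x).target ∩
        {y | ∀ v : E, ‖(mfderivWithin 𝓘(ℝ, E) I (extChartAt I x).symm (range I) y v :
          TangentSpace I ((extChartAt I x).symm y))‖ₑ ≤ C * ‖v‖ₑ} :=
    Metric.mem_nhdsWithin_iff.1 (inter_mem (extChartAt_target_mem_nhdsWithin x) hC)
  have A : (extChartAt I x) ⁻¹' (Metric.ball (extChartAt I x x) r ∩ range I) ∈ 𝓝 x := by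
    apply extChartAt_preimage_mem_nhds_of_mem_nhdsWithin (by simp)
    rw [inter_comm]
    exact inter_mem_nhdsWithin _ (Metric.ball_mem_nhds _ r_pos)
  refine ⟨C, _, inter_mem A (chart_source_mem_nhds H x), fun y hy z hz => ?_⟩
  let η := ContinuousAffineMap.lineMap (R := ℝ) (extChartAt I x y) (extChartAt I x z)
  set γ := (extChartAt I x).symm ∘ η with hγdef
  have hη : Icc 0 1 ⊆ ⇑η ⁻¹' ((extChartAt I x).target ∩
        {y | ∀ v : E, ‖(mfderivWithin 𝓘(ℝ, E) I (extChartAt I x).symm (range I) y v :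
          TangentSpace I ((extChartAt I x).symm y))‖ₑ ≤ C * ‖v‖ₑ}) := by
    simp only [← image_subset_iff, ContinuousAffineMap.coe_lineMap_eq,
      ← segment_eq_image_lineMap, η]
    apply Subset.trans _ hr
    exact ((convex_ball _ _).inter I.convex_range).segment_subset hy.1 hz.1
  simp only [preimage_inter, subset_inter_iff] at hη
  have η_smooth : ContMDiffOn 𝓘(ℝ, ℝ) 𝓘(ℝ, E) 1 η (Icc 0 1) := by
    apply ContMDiff.contMDiffOn
    rw [contMDiff_iff_contDiff]
    exact ContinuousAffineMap.contDiff _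
  have h1 : riemannianEDist I y z ≤ pathELength I γ 0 1 := by
    apply riemannianEDist_le_pathELength _ _ _ zero_le_one
    · exact (contMDiffOn_extChartAt_symm x).comp η_smooth hη.1
    · simp [γ, η, ContinuousAffineMap.coe_lineMap_eq, hy.2]
    · simp [γ, η, ContinuousAffineMap.coe_lineMap_eq, hz.2]
  apply h1.trans
  rw [← lintegral_fderiv_lineMap_eq_edist, pathELength_eq_lintegral_mfderivWithin_Icc,
    ← lintegral_const_mul' _ _ ENNReal.coe_ne_top]
  apply setLIntegral_mono' measurableSet_Icc (fun t ht => ?_)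
  have h2 : mfderivWithin 𝓘(ℝ, ℝ) I γ (Icc 0 1) t =
      (mfderivWithin 𝓘(ℝ, E) I (extChartAt I x).symm (range I) (η t)) ∘L
        (mfderivWithin 𝓘(ℝ, ℝ) 𝓘(ℝ, E) η (Icc 0 1) t) := by
    apply mfderivWithin_comp
    · exact mdifferentiableWithinAt_extChartAt_symm (hη.1 ht)
    · exact η_smooth.mdifferentiableOn one_ne_zero t ht
    · exact hη.1.trans (preimage_mono (extChartAt_target_subset_range x))
    · rw [uniqueMDiffWithinAt_iff_uniqueDiffWithinAt]
      exact uniqueDiffOn_Icc zero_lt_one t ht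
  have h3 : mfderivWithin 𝓘(ℝ, ℝ) I γ (Icc 0 1) t 1 =
      (mfderivWithin 𝓘(ℝ, E) I (extChartAt I x).symm (range I) (η t))
        (mfderivWithin 𝓘(ℝ, ℝ) 𝓘(ℝ, E) η (Icc 0 1) t 1) := congr($h2 1)
  rw [h3]
  refine (hη.2 ht _).trans (le_of_eq ?_)
  simp only [mfderivWithin_eq_fderivWithin]
  rfl

/-- In a neighbourhood of a point, the distance in the chart is bounded by a multiple of the
Riemannian distance: short paths cannot leave the region where the derivative of the chart is
bounded. -/
lemma exists_edist_extChartAt_le_riemannianEDist [RegularSpace M] (x : M) :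
    ∃ C : NNReal, ∃ s ∈ 𝓝 x, ∀ y ∈ s, ∀ z ∈ s,
      edist (extChartAt I x y) (extChartAt I x z) ≤ C * riemannianEDist I y z := by
  obtain ⟨C, C_pos, hC⟩ := exists_enorm_mfderiv_apply_le I x
  obtain ⟨u, u_mem, u_closed, hu, uc⟩ : ∃ u ∈ 𝓝 x, IsClosed u
      ∧ u ⊆ {y | ∀ v : TangentSpace I y, ‖mfderiv I 𝓘(ℝ, E) (extChartAt I x) y v‖ₑ ≤ C * ‖v‖ₑ}
      ∧ u ⊆ (extChartAt I x).source := by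
    obtain ⟨u, u_mem, u_closed, hu⟩ := exists_mem_nhds_isClosed_subset
      (Filter.inter_mem hC (extChartAt_source_mem_nhds (I := I) x))
    rw [subset_inter_iff] at hu
    exact ⟨u, u_mem, u_closed, hu.1, hu.2⟩
  have uc' : u ⊆ (chartAt H x).source := by simpa [extChartAt_source I x] using uc
  obtain ⟨v, ⟨v_mem, v_open⟩, hv⟩ : ∃ v, (v ∈ 𝓝 x ∧ IsOpen v) ∧ v ⊆ u :=
    (nhds_basis_opens' x).mem_iff.1 u_mem
  obtain ⟨r, r_pos, hr⟩ : ∃ r > 0,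
      Metric.ball (extChartAt I x x) r ⊆ (extChartAt I x).symm ⁻¹' v :=
    Metric.mem_nhds_iff.1 (extChartAt_preimage_mem_nhds v_mem)
  have A : (extChartAt I x) ⁻¹' (Metric.ball (extChartAt I x x) (r / 4)) ∈ 𝓝 x :=
    (continuousAt_extChartAt x).preimage_mem_nhds (Metric.ball_mem_nhds _ (by positivity))
  refine ⟨C, _, inter_mem A v_mem, fun y hy z hz => ?_⟩
  have hyz : edist (extChartAt I x y) (extChartAt I x z) ≤ ENNReal.ofReal (r / 2) := by
    rw [edist_dist]
    refine ENNReal.ofReal_le_ofReal ?_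
    have h1 : dist (extChartAt I x y) (extChartAt I x x) < r / 4 := hy.1
    have h2 : dist (extChartAt I x z) (extChartAt I x x) < r / 4 := hz.1
    linarith [dist_triangle_right (extChartAt I x y) (extChartAt I x z) (extChartAt I x x)]
  have C0 : (C : ℝ≥0∞) ≠ 0 := by exact_mod_cast C_pos.ne'
  by_contra! hlt
  have hd : riemannianEDist I y z < edist (extChartAt I x y) (extChartAt I x z) / C := by
    rwa [ENNReal.lt_div_iff_mul_lt (.inl C0) (.inl ENNReal.coe_ne_top), mul_comm]
  obtain ⟨γ, hγy, hγz, γ_smooth, hγ, -⟩ :=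
    exists_lt_locally_constant_of_riemannianEDist_lt hd zero_lt_one
  rw [ENNReal.lt_div_iff_mul_lt (.inl C0) (.inl ENNReal.coe_ne_top), mul_comm] at hγ
  let γ' := extChartAt I x ∘ γ
  -- as long as the path stays in the region, its length in the chart is controlled
  have est : ∀ t₁ ∈ Icc (0 : ℝ) 1, Icc 0 t₁ ⊆ γ ⁻¹' u →
      ‖γ' t₁ - γ' 0‖ₑ ≤ C * pathELength I γ 0 1 := by
    rintro t₁ ⟨ht₁0, ht₁1⟩ t₁_mem
    have hC' : ContMDiffOn 𝓘(ℝ, ℝ) 𝓘(ℝ, E) 1 γ' (Icc 0 t₁) :=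
      contMDiffOn_extChartAt.comp (I' := I) (t := (chartAt H x).source)
        γ_smooth.contMDiffOn (fun t' ht' => uc' (t₁_mem ht'))
    rcases ht₁0.eq_or_lt with rfl | h't'
    · simp
    calc
      ‖γ' t₁ - γ' 0‖ₑ
      ≤ ∫⁻ t' in Icc 0 t₁, ‖derivWithin γ' (Icc 0 t₁) t'‖ₑ := by
        apply enorm_sub_le_lintegral_derivWithin_Icc_of_contDiffOn_Icc _ ht₁0
        rwa [← contMDiffOn_iff_contDiffOn]
      _ = ∫⁻ t' in Icc 0 t₁, ‖mfderivWithin 𝓘(ℝ, ℝ) 𝓘(ℝ, E) γ' (Icc 0 t₁) t' 1‖ₑ := by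
        simp_rw [← fderivWithin_derivWithin, mfderivWithin_eq_fderivWithin]
        rfl
      _ ≤ ∫⁻ t' in Icc 0 t₁, C * ‖mfderivWithin 𝓘(ℝ, ℝ) I γ (Icc 0 t₁) t' 1‖ₑ := by
        apply setLIntegral_mono' measurableSet_Icc (fun t' ht' => ?_)
        have h1 : mfderivWithin 𝓘(ℝ, ℝ) 𝓘(ℝ, E) γ' (Icc 0 t₁) t' =
            (mfderiv I 𝓘(ℝ, E) (extChartAt I x) (γ t')) ∘L
              (mfderivWithin 𝓘(ℝ, ℝ) I γ (Icc 0 t₁) t') := by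
          apply mfderiv_comp_mfderivWithin
          · refine mdifferentiableAt_extChartAt (uc' ?_)
            apply t₁_mem ht'
          · exact (γ_smooth.mdifferentiable one_ne_zero).mdifferentiableOn _ ht'
          · rw [uniqueMDiffWithinAt_iff_uniqueDiffWithinAt]
            exact uniqueDiffOn_Icc h't' _ ht'
        have h2 : mfderivWithin 𝓘(ℝ, ℝ) 𝓘(ℝ, E) γ' (Icc 0 t₁) t' 1 =
            (mfderiv I 𝓘(ℝ, E) (extChartAt I x) (γ t'))
              (mfderivWithin 𝓘(ℝ, ℝ) I γ (Icc 0 t₁) t' 1) := congr($h1 1)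
        rw [h2]
        exact hu (t₁_mem ht') _
      _ = C * pathELength I γ 0 t₁ := by
        rw [lintegral_const_mul' _ _ ENNReal.coe_ne_top,
          pathELength_eq_lintegral_mfderivWithin_Icc]
      _ ≤ C * pathELength I γ 0 1 := by
        gcongr
  have hγ0 : γ' 0 = extChartAt I x y := by simp only [γ', Function.comp_apply, hγy]
  have hsub : Icc 0 1 ⊆ γ ⁻¹' u := by
    have A_closed : IsClosed (γ ⁻¹' u ∩ Icc 0 1) :=
      (u_closed.preimage γ_smooth.continuous).inter isClosed_Icc
    apply A_closed.Icc_subset_of_forall_mem_nhdsGT_of_Icc_subset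
    · rw [mem_preimage, hγy]
      exact hv hy.2
    · rintro t₁ ht₁ t₁_mem
      suffices h : γ t₁ ∈ v from
        γ_smooth.continuous.continuousWithinAt (mem_of_superset (v_open.mem_nhds h) hv)
      have h1 := ((est t₁ (Ico_subset_Icc_self ht₁) t₁_mem).trans hγ.le).trans hyz
      rw [← edist_eq_enorm_sub, edist_dist, ENNReal.ofReal_le_ofReal_iff (by positivity),
        hγ0] at h1
      have h2 : γ' t₁ ∈ (extChartAt I x).symm ⁻¹' v := by
        apply hr
        rw [Metric.mem_ball]
        have h3 : dist (extChartAt I x y) (extChartAt I x x) < r / 4 := hy.1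
        linarith [dist_triangle (γ' t₁) (extChartAt I x y) (extChartAt I x x)]
      have h3 : (extChartAt I x).symm (γ' t₁) = γ t₁ :=
        (extChartAt I x).left_inv (uc (t₁_mem (right_mem_Icc.mpr ht₁.1)))
      rwa [mem_preimage, h3] at h2
  have h1 := est 1 (right_mem_Icc.2 zero_le_one) hsub
  rw [← edist_eq_enorm_sub, edist_comm, hγ0] at h1
  have hγ1 : γ' 1 = extChartAt I x z := by simp only [γ', Function.comp_apply, hγz]
  rw [hγ1] at h1
  exact h1.not_gt hγ

end Riemannian

/-! ### Charts are bi-Lipschitz -/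

section MetricDist

open Bundle Manifold

variable {n : ℕ} {M : Type*} [TopologicalSpace M] [ChartedSpace (EuclideanSpace ℝ (Fin n)) M]
  [IsManifold (𝓡 n) ∞ M] (g : SmoothRiemannianMetric n M)

lemma metricDist_self (x : M) : metricDist g x x = 0 := by
  let : RiemannianBundle (fun x : M => TangentSpace (𝓡 n) x) := ⟨g.toRiemannianMetric⟩
  exact riemannianEDist_self

lemma metricDist_triangle (x y z : M) : metricDist g x z ≤ metricDist g x y + metricDist g y z := by
  let : RiemannianBundle (fun x : M => TangentSpace (𝓡 n) x) := ⟨g.toRiemannianMetric⟩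
  exact riemannianEDist_triangle

/-- Small charts are bi-Lipschitz with respect to a Riemannian distance. -/
lemma exists_isBiLipschitz_metricDist [RegularSpace M] (x : M) :
    ∃ e : OpenPartialHomeomorph M (EuclideanSpace ℝ (Fin n)), x ∈ e.source ∧
      IsBiLipschitz (metricDist g) e := by
  let : RiemannianBundle (fun x : M => TangentSpace (𝓡 n) x) := ⟨g.toRiemannianMetric⟩
  have : IsContMDiffRiemannianBundle (𝓡 n) ∞ (EuclideanSpace ℝ (Fin n))
    (fun x : M => TangentSpace (𝓡 n) x) := ⟨g.inner, g.contMDiff, fun _ _ _ => rfl⟩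
  have : IsContinuousRiemannianBundle (EuclideanSpace ℝ (Fin n))
    (fun x : M => TangentSpace (𝓡 n) x) := ⟨g.inner, g.contMDiff.continuous, fun _ _ _ => rfl⟩
  have : IsManifold (𝓡 n) 1 M := IsManifold.of_le (n := ∞) (by norm_num)
  obtain ⟨C, s, hs, hC⟩ := exists_riemannianEDist_le_edist_extChartAt (𝓡 n) x
  obtain ⟨D, t, ht, hD⟩ := exists_edist_extChartAt_le_riemannianEDist (𝓡 n) x
  refine ⟨(chartAt (EuclideanSpace ℝ (Fin n)) x).restr (s ∩ t), ?_, max C D, fun y hy z hz => ?_⟩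
  · rw [OpenPartialHomeomorph.restr_source]
    exact ⟨mem_chart_source _ x, mem_interior_iff_mem_nhds.2 (Filter.inter_mem hs ht)⟩
  · rw [OpenPartialHomeomorph.restr_source] at hy hz
    have hy' := interior_subset hy.2
    have hz' := interior_subset hz.2
    refine ⟨(hC y hy'.1 z hz'.1).trans ?_, (hD y hy'.2 z hz'.2).trans ?_⟩
    · exact mul_le_mul_left (ENNReal.coe_le_coe.2 (le_max_left C D)) _
    · exact mul_le_mul_left (ENNReal.coe_le_coe.2 (le_max_right C D)) _

end MetricDist

/-! ### Lipschitz fundamental cycles of small norm -/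

section LipschitzCycles

variable {X : Type*} [TopologicalSpace X] {E : Type*} [NormedAddCommGroup E]
  [InnerProductSpace ℝ E] [FiniteDimensional ℝ E]

lemma l1Norm_sub_truncate_add {k : ℕ} {c : SingularSimplex k X → ℝ} (hc : IsLocallyFiniteChain c)
    {K : Set X} (hK : IsCompact K) :
    l1Norm (c - ⇑(hc.truncate hK)) + l1Norm (hc.truncate hK) = l1Norm c := by
  classical
  rw [l1Norm, l1Norm, l1Norm, ← ENNReal.tsum_add]
  refine tsum_congr fun σ => ?_
  rw [Pi.sub_apply, truncate_apply]
  split_ifs <;> simp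

/-- Adding a finite boundary to a Lipschitz fundamental cycle destroys the Lipschitz property of
finitely many simplices only. Smoothing these restores it without increasing the norm. -/
lemma exists_lipschitz_fundamentalCycle [T2Space X] [LocallyCompactSpace X] [NormalSpace X]
    {m : ℕ} {o : ManifoldOrientation (m + 1) X} {d : X → X → ℝ≥0∞} (h0 : ∀ x, d x x = 0)
    (htri : ∀ x y z, d x z ≤ d x y + d y z)
    (hd : ∀ x : X, ∃ e : OpenPartialHomeomorph X E, x ∈ e.source ∧ IsBiLipschitz d e)
    {c : SingularSimplex (m + 1) X → ℝ} (hc : IsLFFundamentalCycle o c)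
    (hlip : chainLipConst d c < ⊤) (b : Chain ℝ (m + 2) X) :
    ∃ c', IsLFFundamentalCycle o c' ∧ chainLipConst d c' < ⊤ ∧
      l1Norm c' ≤ l1Norm (c + ⇑(boundary ℝ (m + 1) X b)) := by
  classical
  set β := boundary ℝ (m + 1) X b with hβ
  have hc₀ := hc.add_boundary b
  rw [← hβ] at hc₀
  set c₀ := c + ⇑β with hc₀def
  have hlf := hc₀.1.isLocallyFiniteChain
  obtain ⟨O, L, hKO, hL, hsm⟩ := exists_canSmooth_of_isCompact hd m (isCompact_carrier β)
  set w := hlf.truncate hL with hw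
  obtain ⟨T, hT, -, hTO, hTd⟩ := hsm (w.support ∪ β.support) (fun _ => Set.univ)
    fun σ _ => Filter.univ_mem
  have hwcyc : w ∈ relCycles ℝ Lᶜ (m + 1) := truncate_mem_relCycles hc₀.1 hL
  refine ⟨c₀ + ⇑(Finsupp.mapDomain T w - w), hc₀.add ?_ fun x => ?_, ?_, ?_⟩
  · rw [map_sub, hT.boundary_eq w (mem_relCycles_succ.1 hwcyc), sub_self]
  -- the change does not depend on the compact set to which the cycle is truncated
  · have hL' : IsCompact (L ∪ {x}) := hL.union isCompact_singleton
    have h1 := hT.homologous _ (Set.compl_subset_compl.2 Set.subset_union_left) _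
      (truncate_mem_relCycles hc₀.1 hL')
    have h2 := mapDomain_eq_self hT.fixed (truncate_sub_mem hlf hL hL' Set.subset_union_left)
    have h3 : Finsupp.mapDomain T (hlf.truncate hL') - hlf.truncate hL' =
        Finsupp.mapDomain T w - w := by
      have h4 : Finsupp.mapDomain T (hlf.truncate hL' - w) =
          Finsupp.mapDomain T (hlf.truncate hL') - Finsupp.mapDomain T w :=
        map_sub (Finsupp.lmapDomain ℝ ℝ T) _ _
      rw [← hw, h4] at h2
      rw [sub_eq_sub_iff_sub_eq_sub, h2]
    rw [← h3]
    exact relBoundaries_mono (Set.compl_subset_compl.2 Set.subset_union_right) h1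
  · have hfin : ∀ σ ∈ w.support ∪ β.support, lipConst d (T σ) < ⊤ := by
      intro σ hσ
      refine lipConst_lt_top h0 htri fun t => ?_
      by_cases hβσ : β σ = 0
      · have hwσ : w σ ≠ 0 := by
          rcases Finset.mem_union.1 hσ with h | h
          · exact Finsupp.mem_support_iff.1 h
          · exact absurd hβσ (Finsupp.mem_support_iff.1 h)
        refine hTd σ t (lipschitzNear_of_lipConst (lt_of_le_of_lt ?_ hlip) t)
        refine le_iSup₂_of_le σ ?_ le_rfl
        intro hcσ
        refine hwσ ?_
        rw [hw, truncate_apply, hc₀def, Pi.add_apply, hcσ, hβσ, add_zero, ite_self]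
      · refine hTO σ hσ t (hKO ?_)
        exact Set.mem_iUnion₂.2 ⟨σ, Finsupp.mem_support_iff.2 hβσ, t, rfl⟩
    have hsup : (w.support ∪ β.support).sup (fun σ => lipConst d (T σ)) < ⊤ :=
      (Finset.sup_lt_iff (by simp)).2 hfin
    refine lt_of_le_of_lt (iSup₂_le fun σ hσ => ?_) (max_lt hlip hsup)
    by_cases hTw : Finsupp.mapDomain T w σ = 0
    · have hσ' : c₀ σ - w σ ≠ 0 := by
        intro h
        refine hσ ?_
        rw [Pi.add_apply, Finsupp.sub_apply, hTw, zero_sub, ← sub_eq_add_neg, h]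
      have hσL : Set.range σ ⊆ Lᶜ := by
        rw [← range_subset_compl_iff]
        intro hne
        rw [hw, truncate_of_nonempty hlf hL hne, sub_self] at hσ'
        exact hσ' rfl
      by_cases hβσ : β σ = 0
      · refine le_max_of_le_left (le_iSup₂_of_le σ ?_ le_rfl)
        intro hcσ
        rw [hw, truncate_of_subset hlf hL hσL, hc₀def, Pi.add_apply, hcσ, hβσ] at hσ'
        simp at hσ'
      · refine le_max_of_le_right ?_
        conv_lhs => rw [← hT.fixed σ hσL]
        exact Finset.le_sup (f := fun σ => lipConst d (T σ))
          (Finset.mem_union_right _ (Finsupp.mem_support_iff.2 hβσ))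
    · obtain ⟨τ, hτ, rfl⟩ := Finset.mem_image.1
        (Finsupp.mapDomain_support (Finsupp.mem_support_iff.2 hTw))
      exact le_max_of_le_right (Finset.le_sup (f := fun σ => lipConst d (T σ))
        (Finset.mem_union_left _ hτ))
  · have e : c₀ + ⇑(Finsupp.mapDomain T w - w) = (c₀ - ⇑w) + ⇑(Finsupp.mapDomain T w) := by
      rw [Finsupp.coe_sub]
      abel
    rw [e, ← l1Norm_sub_truncate_add hlf hL]
    exact (l1Norm_add_le _ _).trans (add_le_add_right (l1Norm_mapDomain_le T w) _)

end LipschitzCycles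

/-! ### Dimension zero and the comparison of the volumes -/

section Volumes

variable {V : Type*} [TopologicalSpace V]

lemma lfVolume_le_lipVolume {n : ℕ} {M : Type*} [TopologicalSpace M]
    [ChartedSpace (EuclideanSpace ℝ (Fin n)) M] [IsManifold (𝓡 n) ∞ M]
    (o : ManifoldOrientation n M) (g : SmoothRiemannianMetric n M) :
    lfVolume o ≤ lipVolume o g :=
  le_iInf₂ fun c hc => le_iInf fun _ => iInf₂_le c hc

/-- In dimension zero there is no boundary, and relative fundamental cycles are locally finite
fundamental cycles. -/
lemma lfVolume_le_relVolume_zero (hV : IsManifoldWithBoundary 0 V)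
    (o : ManifoldOrientation 0 (manifoldInterior 0 V)) : lfVolume o ≤ relVolume o := by
  have hint : ∀ x : V, x ∈ manifoldInterior 0 V := by
    have := manifoldBoundary_zero hV
    rw [manifoldBoundary, Set.compl_empty_iff] at this
    exact fun x => this ▸ Set.mem_univ x
  let e : C(V, manifoldInterior 0 V) := ⟨fun x => ⟨x, hint x⟩, by fun_prop⟩
  have he : e.comp (interiorInclusion 0 V) = ContinuousMap.id _ := rfl
  refine le_iInf₂ fun α hα => le_iInf₂ fun z hz => ?_
  refine le_trans (iInf₂_le (⇑(chainMap ℝ 0 e z)) ⟨isLocallyFiniteChain_coe _, fun x => ?_⟩)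
    (l1Norm_chainMap_le e z)
  obtain ⟨⟨w, hw⟩, hwx⟩ := Submodule.Quotient.mk_surjective _ (o.realCls x)
  have hrep : Represents w (o.realCls x) := ⟨hw, hwx⟩
  have h1 := hz.restrict (manifoldBoundary_subset x)
  rw [hα x] at h1
  have h2 := h1.sub_mem (hrep.map (interiorInclusion 0 V) (mapsTo_interiorInclusion x))
  have h3 := chainMap_mem_relBoundaries ℝ e (A := {(x : V)}ᶜ) (B := {x}ᶜ)
    (fun y hy h => hy (congrArg Subtype.val h)) 0 h2
  rw [map_sub, chainMap_comp, he, chainMap_id] at h3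
  have h4 : IsLocallyFiniteChain.truncate (isLocallyFiniteChain_coe (chainMap ℝ 0 e z))
      (isCompact_singleton (x := x)) - chainMap ℝ 0 e z ∈ chainsIn ℝ 0 ({x} : Set _)ᶜ :=
    mem_chainsIn_compl fun σ hσ => by
      rw [Finsupp.sub_apply, truncate_of_nonempty _ _ hσ, sub_self]
  have h5 := hrep.add (Submodule.add_mem _ (chainsIn_le_relBoundaries h4) h3)
  convert h5 using 1
  abel

/-- In dimension zero every simplex is constant. -/
lemma chainLipConst_zero {M : Type*} [TopologicalSpace M] {d : M → M → ℝ≥0∞} (h0 : ∀ x, d x x = 0)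
    (c : SingularSimplex 0 M → ℝ) : chainLipConst d c < ⊤ := by
  have : ∀ σ : SingularSimplex 0 M, lipConst d σ ≤ 0 := fun σ => sInf_le fun s t => by
    rw [Subsingleton.elim s t, h0]
    exact zero_le
  exact lt_of_le_of_lt (iSup₂_le fun σ _ => this σ) ENNReal.zero_lt_top

lemma lfVolume_le_relVolume [CompactSpace V] {n : ℕ} (hV : IsManifoldWithBoundary n V)
    (o : ManifoldOrientation n (manifoldInterior n V))
    (hiso : InducesIsometricIso (manifoldBoundary n V) n) (hfin : lfVolume o < ⊤) :
    lfVolume o ≤ relVolume o := by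
  cases n with
  | zero => exact lfVolume_le_relVolume_zero hV o
  | succ m => exact lfVolume_le_relVolume_succ hV hiso hfin

lemma lipVolume_le_relVolume [CompactSpace V] {n : ℕ} (hV : IsManifoldWithBoundary n V)
    (o : ManifoldOrientation n (manifoldInterior n V))
    (hiso : InducesIsometricIso (manifoldBoundary n V) n)
    [ChartedSpace (EuclideanSpace ℝ (Fin n)) (manifoldInterior n V)]
    [IsManifold (𝓡 n) ∞ (manifoldInterior n V)]
    (g : SmoothRiemannianMetric n (manifoldInterior n V)) (hfin : lipVolume o g < ⊤) :
    lipVolume o g ≤ relVolume o := by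
  cases n with
  | zero =>
    refine le_trans (le_iInf₂ fun c hc => ?_) (lfVolume_le_relVolume_zero hV o)
    exact iInf_le_of_le c (iInf₂_le hc (chainLipConst_zero (metricDist_self g) c))
  | succ m =>
    have := hV.t2
    have := hV.secondCountable
    have : LocallyCompactSpace (manifoldInterior (m + 1) V) :=
      (isOpen_manifoldInterior (m + 1)).locallyCompactSpace
    have : NormalSpace (manifoldInterior (m + 1) V) := inferInstance
    obtain ⟨c, hc, hlip, hcf⟩ : ∃ c, IsLFFundamentalCycle o c ∧
        chainLipConst (metricDist g) c < ⊤ ∧ l1Norm c < ⊤ := by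
      simpa only [lipVolume, iInf_lt_iff, exists_prop] using hfin
    refine le_of_forall_gt fun r hr => ?_
    obtain ⟨b, hb⟩ := exists_add_boundary_lt hV hiso hc hcf hr
    obtain ⟨c', hc', hlip', hle⟩ := exists_lipschitz_fundamentalCycle (metricDist_self g)
      (metricDist_triangle g) (exists_isBiLipschitz_metricDist g) hc hlip b
    exact (iInf_le_of_le c' (iInf₂_le hc' hlip')).trans_lt (hle.trans_lt hb)

end Volumes

end SimplicialVolume

end

/-- An orientation of `V` is an orientation of its interior. The second part is asserted for every
smooth structure on the interior and every smooth Riemannian metric on it. -/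
theorem theorem1p3 (n : ℕ) (V : Type*) [TopologicalSpace V] [CompactSpace V] [ConnectedSpace V]
    (hV : SimplicialVolume.IsManifoldWithBoundary n V)
    (o : SimplicialVolume.ManifoldOrientation n (SimplicialVolume.manifoldInterior n V))
    (hiso : SimplicialVolume.InducesIsometricIso (SimplicialVolume.manifoldBoundary n V) n)
    (hfin : SimplicialVolume.lfVolume o < ⊤) :
    SimplicialVolume.relVolume o = SimplicialVolume.lfVolume o ∧
      ∀ [ChartedSpace (EuclideanSpace ℝ (Fin n)) (SimplicialVolume.manifoldInterior n V)]
        [IsManifold (𝓡 n) ∞ (SimplicialVolume.manifoldInterior n V)]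
        (g : SimplicialVolume.SmoothRiemannianMetric n (SimplicialVolume.manifoldInterior n V)),
        SimplicialVolume.lipVolume o g < ⊤ →
          SimplicialVolume.relVolume o = SimplicialVolume.lfVolume o ∧
            SimplicialVolume.lfVolume o = SimplicialVolume.lipVolume o g := by
  have h := le_antisymm (SimplicialVolume.relVolume_le_lfVolume hV)
    (SimplicialVolume.lfVolume_le_relVolume hV o hiso hfin)
  refine ⟨h, fun g hg => ⟨h, le_antisymm (SimplicialVolume.lfVolume_le_lipVolume o g) ?_⟩⟩
  exact (SimplicialVolume.lipVolume_le_relVolume hV o hiso g hg).trans_eq h
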